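/- **Setup.** Let $\mathbb{K}$ be an algebraically closed field, and let $N\cong\mathbb{Z}^k$ and $M=\mathrm{Hom}(N,\mathbb{Z})$ be dual lattices with $T=\operatorname{Spec}\mathbb{K}[M]$. Let $X=X(\mathcal D)$ be a rational affine complexity-one $T$-variety, given by a polyhedral divisor $\mathcal D=\sum_P\Delta_P\cdot P$ on $\mathbb{P}^1$. Thus $\sigma\subset N_\mathbb{Q}$ is a pointed polyhedral cone, each $\Delta_P$ is empty or a polyhedron with tailcone $\sigma$, $\Delta_P=\sigma$ for all but finitely many $P$, and $\sum\Delta_P\subsetneq\sigma$. The coordinate ring is $$R_X=\bigoplus_{u\in\sigma^\vee\cap M}H^0\Big(\mathbb{P}^1,\mathcal{O}\Big(\sum_P\lfloor\Delta_P(u)\rfloor P\Big)\Big)\cdot\chi^u,\qquad \Delta_P(u)=\min_{x\in\Delta_P}\langle x,u\rangle$$ (with $\Delta_P(u)=\infty$ if $\Delta_P=\emptyset$), an $M$-graded subring of $\mathbb{K}(\mathbb{P}^1)[M]$. **Semi-canonical embeddings.** Let $m\geq1$, let $P_0,\dots,P_m\in\mathbb{P}^1$ be distinct points including all $P$ with $\Delta_P\ne\sigma$,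 and write $\Delta_i=\Delta_{P_i}$. Let $\mathbb{P}^1\cong L\subset\mathbb{P}^m$ be a linear embedding for which the coordinate hyperplane $V(y_i)$ pulls back to $P_i$; let $Q_i\in L$ be the image of $P_i$, let $L^\circ=L\setminus\{Q_0,\dots,Q_m\}$, and put $z_i=y_i/y_0$. Let $e_1,\dots,e_m$ be the standard basis of $\mathbb{Z}^m$, let $e_0=-\sum_{i\ge1}e_i$, and let $C\subset N_\mathbb{Q}\times\mathbb{Q}^m$ be the cone generated by all $\Delta_i\times e_i$ and $\sigma\times0$. Let $H$ be a finite generating set of $C^\vee\cap(M\times\mathbb{Z}^m)$. The corresponding semi-canonical generators of $R_X=A(L)$ are the elements $z^v|_L\cdot\chi^u$ for $(u,v)\in H$, and $J(L)$ is the kernel of the map $\pi:\mathbb{K}[x_h\mid h\in H]\to R_X$ sending the variables to them. Put $n=\#H$, let $\phi:(N\oplus\mathbb{Z}^m)_\mathbb{R}\to\mathbb{R}^n$ be $y\mapsto(\langle y,h\rangle)_{h\in H}$, and let $C_i=\phi(N_\mathbb{R}\times\mathbb{R}_{\ge0}e_i)$. **Weights.** Order $\mathbb{Z}^r\subset\mathbb{Q}^r$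 lexicographically. For $W\in\mathbb{Q}^{r\times n}$, $\mathrm{In}_W(f)$ is the sum of the terms $c_\alpha x^\alpha$ of $f$ with $W\alpha$ minimal, and $\mathrm{In}_W(I)=\langle\mathrm{In}_W(f)\mid f\in I\rangle$; likewise $\mathrm{In}_w$ for $w\in\mathbb{R}^n$, with $w\cdot\alpha$ in place of $W\alpha$. The set $\mathrm{trop}^r(I)$ consists of the $W\in\mathbb{Q}^{r\times n}$ such that $\mathrm{In}_W(I)$ contains no monomial, and $\mathrm{trop}(I)\subset\mathbb{R}^n$ of the $w$ such that $\mathrm{In}_w(I)$ contains no monomial. For $0\ne f\in R_X$ put $\mathfrak{v}_W(f)=\max\{\min\{W\alpha\mid c_\alpha\ne0\}\mid p=\sum c_\alpha x^\alpha\in\pi^{-1}(f)\}$. **Theorem.** Let $\mathfrak{v}:R_X\setminus\{0\}\to\mathbb{Z}^r$ be a $\mathbb{K}$-valuation, with value semigroup $S(R_X,\mathfrak{v})=\mathfrak{v}(R_X\setminus\{0\})$, and suppose that $\mathfrak{v}$ has full rank $r$: the group generated by $S(R_X,\mathfrak{v})$ has rank $r=\dim R_X$. The following are equivalent: 1. $\mathfrak{v}$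 is $M$-homogeneous, i.e. $\mathfrak{v}(f)=\min_{u}\mathfrak{v}(f_u)$ for every nonzero $f=\sum_u f_u\in R_X$ with homogeneous components $f_u$ (the minimum being over the nonzero $f_u$); 2. there is a semi-canonical embedding of $X$ whose semi-canonical generators are a Khovanskii basis for $\mathfrak{v}$, i.e. their values generate $S(R_X,\mathfrak{v})$; 3. there are a semi-canonical embedding of $X$, with ideal $J(L)$, and a matrix $W\in\mathrm{trop}^r(J(L))$ of rank $r$ such that $\mathfrak{v}=\mathfrak{v}_W$. If these conditions hold, then for every semi-canonical embedding and every $W$ as in (3) there are $i\in\{0,\dots,m\}$ and $\gamma\in\mathbb{Z}^r$ such that the restriction to $\mathbb{K}(L)$ of the extension of $\mathfrak{v}$ to the fraction field of $R_X$ is $\mathrm{ord}_{Q_i}\cdot\gamma$, where $Q_i\in L\setminus L^\circ$; moreover $C_i\subset\mathrm{trop}(J(L))$, and $\mathrm{In}_W(J(L))$ equals the initial ideal of the facet $C_i$, that is, $\mathrm{In}_W(J(L))=\mathrm{In}_w(J(L))$ for every $w$ in the relative interior $\phi(N_\mathbb{R}\times\mathbb{R}_{>0}e_i)$ of $C_i$.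 Furthermore, $S(R_X,\mathfrak{v})$ is generated by the columns of $W$. -/

import Mathlib

open scoped Pointwise

noncomputable section

namespace TVar

/-! ### The projective line, its function field `K(t)`, and orders of vanishing -/

/-- The order of vanishing at a point of `ℙ¹(K) = K ∪ {∞}` of a nonzero rational function
`f ∈ K(t)` (only used for `f ≠ 0`). -/
def ordAt {K : Type*} [Field K] (P : OnePoint K) (f : RatFunc K) : ℤ :=
  P.elim (-f.intDegree)
    (fun c => (f.num.rootMultiplicity c : ℤ) - (f.denom.rootMultiplicity c : ℤ))

section Ord

variable {K : Type*} [Field K]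

theorem ordAt_infty (f : RatFunc K) : ordAt OnePoint.infty f = -f.intDegree := rfl

theorem ordAt_coe (c : K) (f : RatFunc K) :
    ordAt (c : OnePoint K) f
      = (f.num.rootMultiplicity c : ℤ) - (f.denom.rootMultiplicity c : ℤ) := rfl

theorem ordAt_coe_div (c : K) {p q : Polynomial K} (hp : p ≠ 0) (hq : q ≠ 0) :
    ordAt (c : OnePoint K) (algebraMap _ (RatFunc K) p / algebraMap _ (RatFunc K) q)
      = (p.rootMultiplicity c : ℤ) - (q.rootMultiplicity c : ℤ) := by
  set f : RatFunc K := algebraMap _ (RatFunc K) p / algebraMap _ (RatFunc K) q with hf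
  have hp' : algebraMap _ (RatFunc K) p ≠ 0 := RatFunc.algebraMap_ne_zero hp
  have hq' : algebraMap _ (RatFunc K) q ≠ 0 := RatFunc.algebraMap_ne_zero hq
  have hf0 : f ≠ 0 := div_ne_zero hp' hq'
  have hd : f.denom ≠ 0 := f.denom_ne_zero
  have hn : f.num ≠ 0 := RatFunc.num_ne_zero hf0
  have hd' : algebraMap _ (RatFunc K) f.denom ≠ 0 := RatFunc.algebraMap_ne_zero hd
  have h1 : algebraMap _ (RatFunc K) (p * f.denom) = algebraMap _ (RatFunc K) (f.num * q) := by
    have := RatFunc.num_div_denom f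
    rw [map_mul, map_mul]
    rw [div_eq_iff hd'] at this
    rw [this, hf]
    field_simp
  have h2 : p * f.denom = f.num * q := RatFunc.algebraMap_injective K h1
  have h3 := congrArg (Polynomial.rootMultiplicity c) h2
  rw [Polynomial.rootMultiplicity_mul (mul_ne_zero hp hd),
    Polynomial.rootMultiplicity_mul (mul_ne_zero hn hq)] at h3
  rw [ordAt_coe]
  omega

theorem ordAt_mul (P : OnePoint K) {f g : RatFunc K} (hf : f ≠ 0) (hg : g ≠ 0) :
    ordAt P (f * g) = ordAt P f + ordAt P g := by
  induction P using OnePoint.rec with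
  | infty => rw [ordAt_infty, ordAt_infty, ordAt_infty, RatFunc.intDegree_mul hf hg]; ring
  | coe c =>
    have h : f * g = algebraMap _ (RatFunc K) (f.num * g.num)
        / algebraMap _ (RatFunc K) (f.denom * g.denom) := by
      rw [map_mul, map_mul, mul_div_mul_comm, RatFunc.num_div_denom, RatFunc.num_div_denom]
    have hn := RatFunc.num_ne_zero hf
    have hn' := RatFunc.num_ne_zero hg
    rw [h, ordAt_coe_div c (mul_ne_zero hn hn') (mul_ne_zero f.denom_ne_zero g.denom_ne_zero),
      Polynomial.rootMultiplicity_mul (mul_ne_zero hn hn'),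
      Polynomial.rootMultiplicity_mul (mul_ne_zero f.denom_ne_zero g.denom_ne_zero),
      ordAt_coe, ordAt_coe]
    push_cast
    ring

theorem ordAt_one (P : OnePoint K) : ordAt P (1 : RatFunc K) = 0 := by
  have h := ordAt_mul P (one_ne_zero (α := RatFunc K)) one_ne_zero
  rw [mul_one] at h
  omega

theorem ordAt_inv (P : OnePoint K) {f : RatFunc K} (hf : f ≠ 0) :
    ordAt P f⁻¹ = -ordAt P f := by
  have h := ordAt_mul P hf (inv_ne_zero hf)
  rw [mul_inv_cancel₀ hf, ordAt_one] at h
  omega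

theorem ordAt_div (P : OnePoint K) {f g : RatFunc K} (hf : f ≠ 0) (hg : g ≠ 0) :
    ordAt P (f / g) = ordAt P f - ordAt P g := by
  rw [div_eq_mul_inv, ordAt_mul P hf (inv_ne_zero hg), ordAt_inv P hg]
  ring

theorem ordAt_pow (P : OnePoint K) {f : RatFunc K} (hf : f ≠ 0) (n : ℕ) :
    ordAt P (f ^ n) = n * ordAt P f := by
  induction n with
  | zero => simp [ordAt_one]
  | succ n ih => rw [pow_succ, ordAt_mul P (pow_ne_zero n hf) hf, ih]; push_cast; ring

theorem ordAt_zpow (P : OnePoint K) {f : RatFunc K} (hf : f ≠ 0) (n : ℤ) :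
    ordAt P (f ^ n) = n * ordAt P f := by
  cases n with
  | ofNat n => simpa using ordAt_pow P hf n
  | negSucc n =>
    rw [zpow_negSucc, ordAt_inv P (pow_ne_zero _ hf), ordAt_pow P hf, Int.negSucc_eq]
    push_cast
    ring

theorem ordAt_prod (P : OnePoint K) {ι : Type*} (s : Finset ι) (f : ι → RatFunc K)
    (hf : ∀ i, f i ≠ 0) : ordAt P (∏ i ∈ s, f i) = ∑ i ∈ s, ordAt P (f i) := by
  classical
  induction s using Finset.induction_on with
  | empty => simp [ordAt_one]
  | insert a s ha ih =>
    rw [Finset.prod_insert ha, Finset.sum_insert ha,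
      ordAt_mul P (hf a) (Finset.prod_ne_zero_iff.mpr fun i _ => hf i), ih]

theorem ordAt_C (P : OnePoint K) (c : K) : ordAt P (RatFunc.C c) = 0 := by
  induction P using OnePoint.rec with
  | infty => rw [ordAt_infty, RatFunc.intDegree_C, neg_zero]
  | coe a =>
    rw [ordAt_coe, RatFunc.num_C, RatFunc.denom_C, Polynomial.rootMultiplicity_C,
      ← Polynomial.C_1, Polynomial.rootMultiplicity_C]
    simp

theorem min_ordAt_le_add (P : OnePoint K) {f g : RatFunc K} (hf : f ≠ 0) (hg : g ≠ 0)
    (hfg : f + g ≠ 0) : min (ordAt P f) (ordAt P g) ≤ ordAt P (f + g) := by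
  induction P using OnePoint.rec with
  | infty =>
    have h := RatFunc.intDegree_add_le hg hfg
    simp only [ordAt_infty]
    rcases le_max_iff.mp h with h | h
    · exact (min_le_left _ _).trans (by omega)
    · exact (min_le_right _ _).trans (by omega)
  | coe c =>
    have hdf := f.denom_ne_zero
    have hdg := g.denom_ne_zero
    have hdf' : algebraMap _ (RatFunc K) f.denom ≠ 0 := RatFunc.algebraMap_ne_zero hdf
    have hdg' : algebraMap _ (RatFunc K) g.denom ≠ 0 := RatFunc.algebraMap_ne_zero hdg
    have hnf := RatFunc.num_ne_zero hf
    have hng := RatFunc.num_ne_zero hg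
    have h : f + g = algebraMap _ (RatFunc K) (f.num * g.denom + f.denom * g.num)
        / algebraMap _ (RatFunc K) (f.denom * g.denom) := by
      rw [map_add, map_mul, map_mul, map_mul, ← div_add_div _ _ hdf' hdg',
        RatFunc.num_div_denom, RatFunc.num_div_denom]
    have hne : f.num * g.denom + f.denom * g.num ≠ 0 := by
      intro h0
      rw [h0, map_zero, zero_div] at h
      exact hfg h
    have hr := Polynomial.rootMultiplicity_add c hne
    rw [Polynomial.rootMultiplicity_mul (mul_ne_zero hnf hdg),
      Polynomial.rootMultiplicity_mul (mul_ne_zero hdf hng)] at hr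
    rw [h, ordAt_coe_div c hne (mul_ne_zero hdf hdg),
      Polynomial.rootMultiplicity_mul (mul_ne_zero hdf hdg), ordAt_coe, ordAt_coe]
    rcases min_le_iff.mp hr with hr | hr
    · exact (min_le_left _ _).trans (by omega)
    · exact (min_le_right _ _).trans (by omega)

end Ord

/-- The pairing `⟨x, u⟩ = ∑ j, x j * u j` of a rational (or real) vector `x` with a lattice
vector `u`. -/
def pair {R : Type*} [Ring R] {n : ℕ} (x : Fin n → R) (u : Fin n → ℤ) : R :=
  ∑ j, x j * (u j : R)

section Pair

variable {R : Type*} [Ring R] {n : ℕ}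

theorem pair_add (x : Fin n → R) (u u' : Fin n → ℤ) : pair x (u + u') = pair x u + pair x u' := by
  simp [pair, mul_add, Finset.sum_add_distrib]

theorem pair_zero (x : Fin n → R) : pair x 0 = 0 := by simp [pair]

theorem zero_pair (u : Fin n → ℤ) : pair (0 : Fin n → R) u = 0 := by simp [pair]

end Pair

/-! ### Polyhedral divisors on `ℙ¹` and the algebra they define -/

/-- A polyhedral divisor `∑ Δ_P · P` on `ℙ¹` over `K`, for the lattices `N = ℤᵏ` and
`M = Hom(N, ℤ) = ℤᵏ`: its tailcone `σ` is a pointed (salient) polyhedral cone in `N_ℚ = ℚᵏ`; each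
coefficient is empty or a polyhedron with tailcone `σ`, i.e. the Minkowski sum of a polytope and
`σ` (an empty set of vertices gives the empty coefficient); and all but finitely many coefficients
are the neutral element `σ`. -/
structure PolyhedralDivisor (K : Type*) [Field K] (k : ℕ) where
  tail : PointedCone ℚ (Fin k → ℚ)
  tail_fg : tail.FG
  tail_pointed : (tail : ConvexCone ℚ (Fin k → ℚ)).Salient
  coeff : OnePoint K → Set (Fin k → ℚ)
  coeff_polyhedron : ∀ P, ∃ V : Finset (Fin k → ℚ),
    coeff P = convexHull ℚ (V : Set (Fin k → ℚ)) + (tail : Set (Fin k → ℚ))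
  finite_support : {P | coeff P ≠ (tail : Set (Fin k → ℚ))}.Finite

namespace PolyhedralDivisor

variable {K : Type*} [Field K] {k : ℕ} (D : PolyhedralDivisor K k)

/-- The Minkowski sum of all the coefficients of `D` (a summand `σ` is neutral, except that it
has to be kept when there is no other). -/
def degree : Set (Fin k → ℚ) :=
  (D.tail : Set (Fin k → ℚ)) + ∑ P ∈ D.finite_support.toFinset, D.coeff P

/-- Properness (positivity) on `ℙ¹`: `∑ Δ_P ⊊ σ`. -/
def IsProper : Prop := D.degree ⊂ (D.tail : Set (Fin k → ℚ))

/-- The lattice points `σ^∨ ∩ M` of the dual cone. -/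
def tailDual : AddSubmonoid (Fin k → ℤ) where
  carrier := {u | ∀ s ∈ D.tail, 0 ≤ pair s u}
  zero_mem' := fun s _ => by rw [pair_zero]
  add_mem' := fun {u u'} hu hu' s hs => by
    rw [pair_add]; exact add_nonneg (hu s hs) (hu' s hs)

/-- The sections `H⁰(ℙ¹, 𝒪(D(u)))`, where `D(u) = ∑ Δ_P(u) · P` and `Δ_P(u) = min_{x ∈ Δ_P} ⟨x, u⟩`
(`= ∞`, i.e. no condition at `P`, when `Δ_P = ∅`): the rational functions `f` with `f = 0` or
`ord_P f + Δ_P(u) ≥ 0` for all `P`. Since `ord_P f` is an integer this is the same as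
`ord_P f + ⌊Δ_P(u)⌋ ≥ 0`. -/
def sections (u : Fin k → ℤ) : Submodule K (RatFunc K) where
  carrier := {f | f ≠ 0 → ∀ P, ∀ x ∈ D.coeff P, 0 ≤ (ordAt P f : ℚ) + pair x u}
  zero_mem' := fun h => absurd rfl h
  add_mem' := fun {f g} hf hg hfg P x hx => by
    by_cases hf0 : f = 0
    · subst hf0
      rw [zero_add] at hfg ⊢
      exact hg hfg P x hx
    by_cases hg0 : g = 0
    · subst hg0
      rw [add_zero] at hfg ⊢
      exact hf hfg P x hx
    have h1 := hf hf0 P x hx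
    have h2 := hg hg0 P x hx
    rcases min_le_iff.mp (min_ordAt_le_add P hf0 hg0 hfg) with h | h
    · have h' : (ordAt P f : ℚ) ≤ ordAt P (f + g) := by exact_mod_cast h
      linarith
    · have h' : (ordAt P g : ℚ) ≤ ordAt P (f + g) := by exact_mod_cast h
      linarith
  smul_mem' := fun c f hf hcf P x hx => by
    have hc : c ≠ 0 := by rintro rfl; exact hcf (zero_smul _ _)
    have hf0 : f ≠ 0 := by rintro rfl; exact hcf (smul_zero _)
    have hC : (RatFunc.C c : RatFunc K) ≠ 0 := by simpa using hc
    rw [RatFunc.smul_eq_C_mul, ordAt_mul P hC hf0, ordAt_C P c, zero_add]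
    exact hf hf0 P x hx

theorem mul_mem_sections {u u' : Fin k → ℤ} {f g : RatFunc K} (hf : f ∈ D.sections u)
    (hg : g ∈ D.sections u') : f * g ∈ D.sections (u + u') := by
  intro hfg P x hx
  have hf0 := left_ne_zero_of_mul hfg
  have hg0 := right_ne_zero_of_mul hfg
  have h1 := hf hf0 P x hx
  have h2 := hg hg0 P x hx
  rw [ordAt_mul P hf0 hg0, pair_add]
  push_cast
  linarith

/-- The degree `u` part of the coordinate ring: `H⁰(ℙ¹, 𝒪(D(u)))` for `u ∈ σ^∨ ∩ M`, and `0` for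
the other `u`. -/
def part (u : Fin k → ℤ) : Submodule K (RatFunc K) where
  carrier := {f | f ∈ D.sections u ∧ (f ≠ 0 → u ∈ D.tailDual)}
  zero_mem' := ⟨zero_mem _, fun h => absurd rfl h⟩
  add_mem' := fun {f g} hf hg => ⟨add_mem hf.1 hg.1, fun hfg => by
    by_cases hf0 : f = 0
    · subst hf0
      rw [zero_add] at hfg
      exact hg.2 hfg
    · exact hf.2 hf0⟩
  smul_mem' := fun c f hf => ⟨Submodule.smul_mem _ c hf.1, fun hcf => hf.2 (by
    rintro rfl; exact hcf (smul_zero _))⟩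

theorem mul_mem_part {u u' : Fin k → ℤ} {f g : RatFunc K} (hf : f ∈ D.part u)
    (hg : g ∈ D.part u') : f * g ∈ D.part (u + u') :=
  ⟨D.mul_mem_sections hf.1 hg.1, fun h =>
    add_mem (hf.2 (left_ne_zero_of_mul h)) (hg.2 (right_ne_zero_of_mul h))⟩

theorem algebraMap_mem_part (c : K) : algebraMap K (RatFunc K) c ∈ D.part 0 := by
  refine ⟨fun h P x _ => ?_, fun _ => zero_mem _⟩
  have hc : c ≠ 0 := by rintro rfl; exact h (map_zero _)
  rw [RatFunc.algebraMap_eq_C, ordAt_C P c, pair_zero]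
  simp

/-- The coordinate ring `R_X = ⨁_{u ∈ σ^∨ ∩ M} H⁰(ℙ¹, 𝒪(D(u))) · χ^u` of the affine `T`-variety
`X = X(D)`, as a `K`-subalgebra of `K(ℙ¹)[M]`; the character `χ^u` is `single u 1`. -/
def coordinateRing : Subalgebra K (AddMonoidAlgebra (RatFunc K) (Fin k → ℤ)) where
  carrier := {F | ∀ u, F.coeff u ∈ D.part u}
  add_mem' := fun {F G} hF hG u => by
    rw [AddMonoidAlgebra.coeff_add, Finsupp.add_apply]
    exact add_mem (hF u) (hG u)
  mul_mem' := fun {F G} hF hG u => by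
    classical
    rw [AddMonoidAlgebra.coeff_mul]
    simp only [Finsupp.sum]
    refine Submodule.sum_mem _ fun a _ => Submodule.sum_mem _ fun b _ => ?_
    split_ifs with h
    · rw [← h]
      exact D.mul_mem_part (hF a) (hG b)
    · exact zero_mem _
  algebraMap_mem' := fun c u => by
    classical
    rw [AddMonoidAlgebra.coe_algebraMap]
    simp only [Function.comp_apply, AddMonoidAlgebra.coeff_single, Finsupp.single_apply]
    split_ifs with h
    · rw [← h]
      exact D.algebraMap_mem_part c
    · exact zero_mem _

theorem single_mem {u : Fin k → ℤ} {f : RatFunc K} (hf : f ∈ D.part u) :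
    AddMonoidAlgebra.single u f ∈ D.coordinateRing := fun w => by
  classical
  rw [AddMonoidAlgebra.coeff_single, Finsupp.single_apply]
  split_ifs with h
  · rw [← h]
    exact hf
  · exact zero_mem _

/-- The homogeneous component `F_u = f_u · χ^u` of degree `u ∈ M` of an element of `R_X`. -/
def component (F : D.coordinateRing) (u : Fin k → ℤ) : D.coordinateRing :=
  ⟨AddMonoidAlgebra.single u (F.1.coeff u), D.single_mem (F.2 u)⟩

end PolyhedralDivisor

/-! ### Semi-canonical embeddings -/

/-- The point `(a : b)` of `ℙ¹`, i.e. `a / b` if `b ≠ 0` and `∞` if `b = 0`. -/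
def projPoint {K : Type*} [Field K] (q : K × K) : OnePoint K :=
  open Classical in if q.2 = 0 then OnePoint.infty else ((q.1 / q.2 : K) : OnePoint K)

/-- The linear form `s₀ b - s₁ a` on `ℙ¹` that vanishes at the point `(a : b)`, written in the
coordinate `t = s₀ / s₁` (that is, divided by `s₁`). -/
def linForm {K : Type*} [Field K] (q : K × K) : RatFunc K :=
  RatFunc.C q.2 * RatFunc.X - RatFunc.C q.1

section LinForm

variable {K : Type*} [Field K]

theorem linForm_eq (q : K × K) :
    linForm q = algebraMap _ (RatFunc K) (Polynomial.C q.2 * Polynomial.X - Polynomial.C q.1) := by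
  simp [linForm, RatFunc.algebraMap_C, RatFunc.algebraMap_X]

theorem linPoly_ne_zero {q : K × K} (hq : q ≠ 0) :
    Polynomial.C q.2 * Polynomial.X - Polynomial.C q.1 ≠ 0 := by
  intro h
  apply hq
  have h0 := congrArg (fun p => Polynomial.coeff p 0) h
  have h1 := congrArg (fun p => Polynomial.coeff p 1) h
  simp [Polynomial.coeff_C] at h0 h1
  exact Prod.ext h0 h1

theorem linForm_ne_zero {q : K × K} (hq : q ≠ 0) : linForm q ≠ 0 := by
  rw [linForm_eq]
  exact RatFunc.algebraMap_ne_zero (linPoly_ne_zero hq)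

open Classical in
theorem ordAt_linForm (P : OnePoint K) {q : K × K} (hq : q ≠ 0) :
    ordAt P (linForm q) = (if P = projPoint q then 1 else 0)
      - (if P = OnePoint.infty then 1 else 0) := by
  induction P using OnePoint.rec with
  | infty =>
    rw [ordAt_infty, linForm_eq, RatFunc.intDegree_polynomial]
    by_cases h : q.2 = 0
    · simp [projPoint, h]
    · have : (Polynomial.C q.2 * Polynomial.X - Polynomial.C q.1).natDegree = 1 := by
        rw [sub_eq_add_neg, ← Polynomial.C_neg]
        exact Polynomial.natDegree_linear h
      rw [this]
      simp [projPoint, h]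
  | coe c =>
    have h1 := ordAt_coe_div c (linPoly_ne_zero hq) (one_ne_zero (α := Polynomial K))
    rw [map_one, div_one, ← linForm_eq] at h1
    rw [h1, ← Polynomial.C_1, Polynomial.rootMultiplicity_C]
    by_cases h : q.2 = 0
    · rw [h, Polynomial.C_0, zero_mul, zero_sub, ← Polynomial.C_neg,
        Polynomial.rootMultiplicity_C]
      simp [projPoint, h]
    · have h2 : Polynomial.C q.2 * Polynomial.X - Polynomial.C q.1
          = Polynomial.C q.2 * (Polynomial.X - Polynomial.C (q.1 / q.2)) := by
        rw [mul_sub, ← Polynomial.C_mul, mul_div_cancel₀ _ h]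
      have h3 := linPoly_ne_zero hq
      rw [h2] at h3 ⊢
      rw [Polynomial.rootMultiplicity_mul h3, Polynomial.rootMultiplicity_C,
        Polynomial.rootMultiplicity_X_sub_C]
      simp [projPoint, h]

end LinForm

/-- The vector `e_i ∈ ℤᵐ ⊗ R` for `0 ≤ i ≤ m`: `e_1, …, e_m` is the standard basis and
`e_0 = -(e_1 + ⋯ + e_m)`. -/
def simplexRay (R : Type*) [Ring R] {m : ℕ} (i : Fin (m + 1)) : Fin m → R :=
  fun j => (if i = j.succ then 1 else 0) - (if i = 0 then 1 else 0)

/-- A linear embedding of `ℙ¹` as a line `L = L_D ⊆ ℙᵐ` (`m ≥ 1`) that meets the torus, for a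
polyhedral divisor written as `D = ∑_{i=0}^m Δ_i · P_i` with distinct points `P_0, …, P_m`
(coefficients `Δ_i = σ` are allowed). It is given by homogeneous coordinates `p i` of the points
`P_i`, through `(s₀ : s₁) ↦ (… : s₀ (p i).2 - s₁ (p i).1 : …)`; so the coordinate hyperplane
`V(y_i)` of `ℙᵐ` pulls back to `P_i`. The embedding identifies `L` with `ℙ¹`, `K(L)` with `K(t)`,
the boundary point `Q_i ∈ L ∖ L°` with `P_i`, and `A(L)` with `D.coordinateRing`. -/
structure LineEmbedding {K : Type*} [Field K] {k : ℕ} (D : PolyhedralDivisor K k) where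
  m : ℕ
  one_le_m : 1 ≤ m
  p : Fin (m + 1) → K × K
  p_ne_zero : ∀ i, p i ≠ 0
  injective_point : Function.Injective fun i => projPoint (p i)
  support_subset : ∀ P, D.coeff P ≠ (D.tail : Set (Fin k → ℚ)) → ∃ i, projPoint (p i) = P

namespace LineEmbedding

variable {K : Type*} [Field K] {k : ℕ} {D : PolyhedralDivisor K k} (L : LineEmbedding D)

/-- The boundary point `Q_i` of `L`, as a point of `ℙ¹`. -/
def Q (i : Fin (L.m + 1)) : OnePoint K := projPoint (L.p i)

/-- The cone `C = ℚ_{≥0} · ({Δ_i × e_i} ∪ (σ × 0)) ⊆ N_ℚ × ℚᵐ`. -/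
def coneC : PointedCone ℚ ((Fin k → ℚ) × (Fin L.m → ℚ)) :=
  PointedCone.hull ℚ
    ({c | ∃ i, ∃ x ∈ D.coeff (L.Q i), c = (x, simplexRay ℚ i)} ∪ {c | ∃ s ∈ D.tail, c = (s, 0)})

/-- The monoid `C^∨ ∩ (M × ℤᵐ)`. -/
def dualMonoid : AddSubmonoid ((Fin k → ℤ) × (Fin L.m → ℤ)) where
  carrier := {w | ∀ c ∈ L.coneC, 0 ≤ pair c.1 w.1 + pair c.2 w.2}
  zero_mem' := fun c _ => by simp [pair_zero]
  add_mem' := fun {w w'} hw hw' c hc => by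
    have h1 := hw c hc
    have h2 := hw' c hc
    rw [Prod.fst_add, Prod.snd_add, pair_add, pair_add]
    linarith

/-- The restriction to `L` of the Laurent monomial `z^v`, where `z_i = y_i / y_0`. -/
def zMonomial (v : Fin L.m → ℤ) : RatFunc K :=
  ∏ j, (linForm (L.p j.succ) / linForm (L.p 0)) ^ v j

theorem ordAt_zMonomial (P : OnePoint K) (v : Fin L.m → ℤ) :
    open Classical in
    ordAt P (L.zMonomial v)
      = ∑ j, v j * ((if P = L.Q j.succ then 1 else 0) - (if P = L.Q 0 then 1 else 0)) := by
  classical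
  have h0 := linForm_ne_zero (L.p_ne_zero 0)
  have hj := fun j : Fin L.m => linForm_ne_zero (L.p_ne_zero j.succ)
  rw [zMonomial, ordAt_prod _ _ _ fun j => zpow_ne_zero _ (div_ne_zero (hj j) h0)]
  refine Finset.sum_congr rfl fun j _ => ?_
  rw [ordAt_zpow P (div_ne_zero (hj j) h0), ordAt_div P (hj j) h0,
    ordAt_linForm P (L.p_ne_zero _), ordAt_linForm P (L.p_ne_zero _)]
  congr 1
  rw [Q, Q]
  ring

theorem zMonomial_mem_part {w : (Fin k → ℤ) × (Fin L.m → ℤ)} (hw : w ∈ L.dualMonoid) :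
    L.zMonomial w.2 ∈ D.part w.1 := by
  classical
  have htail : w.1 ∈ D.tailDual := fun s hs => by
    have h := hw (s, 0) (PointedCone.subset_hull (Or.inr ⟨s, hs, rfl⟩))
    simpa [zero_pair] using h
  refine ⟨fun _ P x hx => ?_, fun _ => htail⟩
  rw [ordAt_zMonomial]
  by_cases hP : ∃ i, L.Q i = P
  · obtain ⟨i, rfl⟩ := hP
    have h := hw (x, simplexRay ℚ i) (PointedCone.subset_hull (Or.inl ⟨i, x, hx, rfl⟩))
    have hQ : ∀ i' : Fin (L.m + 1), L.Q i = L.Q i' ↔ i = i' := fun i' =>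
      L.injective_point.eq_iff
    have h2 : pair (simplexRay ℚ i) w.2 = ((∑ j, w.2 j *
        ((if L.Q i = L.Q j.succ then 1 else 0) - (if L.Q i = L.Q 0 then 1 else 0)) : ℤ) : ℚ) := by
      simp only [pair, simplexRay, hQ]
      push_cast
      exact Finset.sum_congr rfl fun j _ => mul_comm _ _
    rw [← h2]
    simpa [add_comm] using h
  · have hne : ∀ i, P ≠ L.Q i := fun i h => hP ⟨i, h.symm⟩
    have hσ : D.coeff P = (D.tail : Set (Fin k → ℚ)) := by
      by_contra h
      exact hP (L.support_subset P h)
    rw [hσ] at hx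
    simpa [hne] using htail x hx

end LineEmbedding

/-- A semi-canonical embedding of `X = X(D)`: the embedding `X ≅ X(L) ⊆ X(C)` for a line `L = L_D`,
followed by the embedding `X(C) ⊆ 𝔸ⁿ` given by a finite set `gens` of generators of the monoid
`C^∨ ∩ (M × ℤᵐ)`. -/
structure SemiCanonicalEmbedding {K : Type*} [Field K] {k : ℕ} (D : PolyhedralDivisor K k)
    extends LineEmbedding D where
  gens : Finset ((Fin k → ℤ) × (Fin m → ℤ))
  closure_gens :
    AddSubmonoid.closure (gens : Set ((Fin k → ℤ) × (Fin m → ℤ))) = toLineEmbedding.dualMonoid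

/-! ### Initial ideals and tropical varieties -/

section Initial

variable {K : Type*} [Field K] {ι : Type*}

open Classical in
/-- The initial form of `f` for a weighting `wt` of the monomials: the sum of the terms of `f` of
minimal weight. -/
def initialForm {Γ : Type*} [LinearOrder Γ] (wt : (ι →₀ ℕ) → Γ) (f : MvPolynomial ι K) :
    MvPolynomial ι K :=
  ∑ α ∈ f.support.filter (fun α => ∀ β ∈ f.support, wt α ≤ wt β),
    MvPolynomial.monomial α (f.coeff α)

/-- The initial ideal `In(I)`, generated by the initial forms of the elements of `I`. -/
def initialIdeal {Γ : Type*} [LinearOrder Γ] (wt : (ι →₀ ℕ) → Γ)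
    (I : Ideal (MvPolynomial ι K)) : Ideal (MvPolynomial ι K) :=
  Ideal.span (initialForm wt '' (I : Set (MvPolynomial ι K)))

/-- The ideal `I` contains a monomial `x^α`. -/
def ContainsMonomial (I : Ideal (MvPolynomial ι K)) : Prop :=
  ∃ α : ι →₀ ℕ, MvPolynomial.monomial α (1 : K) ∈ I

/-- The weight `w · α` of `x^α` for `w ∈ ℝⁿ`. -/
def realWeight [Fintype ι] (w : ι → ℝ) (α : ι →₀ ℕ) : ℝ := ∑ b, w b * (α b : ℝ)

/-- The weight `W α ∈ ℚʳ` of `x^α` for a matrix `W ∈ ℚ^{r × n}`; here `ℚʳ` has the lexicographic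
order. -/
def matWeight [Fintype ι] {r : ℕ} (W : Matrix (Fin r) ι ℚ) (α : ι →₀ ℕ) : Lex (Fin r → ℚ) :=
  toLex (W.mulVec fun b => (α b : ℚ))

/-- The tropical variety of `I`: the weights `w ∈ ℝⁿ` for which `In_w(I)` contains no monomial. -/
def trop [Fintype ι] (I : Ideal (MvPolynomial ι K)) : Set (ι → ℝ) :=
  {w | ¬ ContainsMonomial (initialIdeal (realWeight w) I)}

/-- The rank `r` tropical variety of `I`: the matrices `W ∈ ℚ^{r × n}` for which `In_W(I)` contains
no monomial. -/
def tropRank [Fintype ι] (r : ℕ) (I : Ideal (MvPolynomial ι K)) : Set (Matrix (Fin r) ι ℚ) :=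
  {W | ¬ ContainsMonomial (initialIdeal (matWeight W) I)}

end Initial

/-! ### Valuations with values in `ℤʳ` -/

/-- `ℤʳ` with the lexicographic order. -/
abbrev LexInt (r : ℕ) : Type := Lex (Fin r → ℤ)

/-- The inclusion `ℤʳ ⊆ ℚʳ`. -/
def LexInt.toRat {r : ℕ} (g : LexInt r) : Lex (Fin r → ℚ) := toLex fun i => (ofLex g i : ℚ)

section Valuations

variable {K : Type*} [Field K] {R : Type*} [CommRing R] [Algebra K R] {r : ℕ}

/-- `v` is a `K`-valuation `R ∖ {0} → ℤʳ`: it is trivial on `K^*`, and takes the value `⊤ = ∞` at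
`0` only. -/
structure IsKValuation (K : Type*) [Field K] {R : Type*} [CommRing R] [Algebra K R] {r : ℕ}
    (v : AddValuation R (WithTop (LexInt r))) : Prop where
  eq_zero_of_top : ∀ f, v f = ⊤ → f = 0
  map_const : ∀ c : K, c ≠ 0 → v (algebraMap K R c) = 0

/-- The value semigroup `S(R, v) ⊆ ℤʳ`. -/
def valueSemigroup (v : AddValuation R (WithTop (LexInt r))) : Set (LexInt r) :=
  {g | ∃ f : R, f ≠ 0 ∧ v f = (g : WithTop (LexInt r))}

/-- The rank of `v`: the rank of the abelian group generated by `S(R, v)`. -/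
def valuationRank (v : AddValuation R (WithTop (LexInt r))) : ℕ :=
  Module.finrank ℤ (Submodule.span ℤ (valueSemigroup v))

/-- `v` has full rank: its rank equals the Krull dimension of `R`. -/
def IsFullRank (v : AddValuation R (WithTop (LexInt r))) : Prop :=
  ringKrullDim R = (valuationRank v : WithBot ℕ∞)

/-- A subset `B` of `R` is a Khovanskii basis for `v` if its image under `v` generates `S(R, v)`. -/
def IsKhovanskiiBasis (v : AddValuation R (WithTop (LexInt r))) (B : Set R) : Prop :=
  (AddSubmonoid.closure {g : LexInt r | ∃ b ∈ B, b ≠ 0 ∧ v b = (g : WithTop (LexInt r))} :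
    Set (LexInt r)) = valueSemigroup v

/-- `v = v_W`, the weight (quasi-)valuation of `W` for the presentation `π : K[x] → R`:
`v_W(f) = max {min {W α | p = ∑ c_α x^α, c_α ≠ 0} | p ∈ π⁻¹(f)}` for `f ≠ 0`. -/
def IsWeightValuation {ι : Type*} [Fintype ι] (π : MvPolynomial ι K →ₐ[K] R)
    (W : Matrix (Fin r) ι ℚ) (v : AddValuation R (WithTop (LexInt r))) : Prop :=
  ∀ f : R, f ≠ 0 → ∃ g : LexInt r, v f = (g : WithTop (LexInt r)) ∧
    IsGreatest {d : Lex (Fin r → ℚ) | ∃ p : MvPolynomial ι K, π p = f ∧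
      IsLeast (matWeight W '' (p.support : Set (ι →₀ ℕ))) d} g.toRat

end Valuations

namespace PolyhedralDivisor

variable {K : Type*} [Field K] {k r : ℕ} (D : PolyhedralDivisor K k)

/-- `v` is `M`-homogeneous: `v(f) = min_{u ∈ M} v(f_u)`. -/
def IsHomogeneousValuation (v : AddValuation D.coordinateRing (WithTop (LexInt r))) : Prop :=
  ∀ F : D.coordinateRing, v F = F.1.coeff.support.inf fun u => v (D.component F u)

/-- The restriction to `K(ℙ¹)` of the extension of `v` to the fraction field of `R_X` is
`ord_P · γ`: every `g ∈ K(ℙ¹)`, `g ≠ 0`, is a quotient `a / b` of elements of `R_X` for which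
`v(a) - v(b) = ord_P(g) γ`. -/
def RestrictsToOrd (v : AddValuation D.coordinateRing (WithTop (LexInt r))) (P : OnePoint K)
    (γ : LexInt r) : Prop :=
  ∀ g : RatFunc K, g ≠ 0 → ∃ a b : D.coordinateRing, a ≠ 0 ∧ b ≠ 0 ∧
    (a : AddMonoidAlgebra (RatFunc K) (Fin k → ℤ)) = AddMonoidAlgebra.single 0 g * b.1 ∧
    v a = v b + ((ordAt P g • γ : LexInt r) : WithTop (LexInt r))

end PolyhedralDivisor

namespace SemiCanonicalEmbedding

variable {K : Type*} [Field K] {k r : ℕ} {D : PolyhedralDivisor K k}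
  (E : SemiCanonicalEmbedding D)

/-- The semi-canonical generator of `R_X` given by `w = (u, v) ∈ gens`: the restriction
`z^v|_L · χ^u` to `X` of the character `χ^{(u,v)}` on `X(C)`. -/
def generator (w : E.gens) : D.coordinateRing :=
  ⟨AddMonoidAlgebra.single w.1.1 (E.zMonomial w.1.2),
    D.single_mem (E.zMonomial_mem_part
      (E.closure_gens ▸ AddSubmonoid.subset_closure (Finset.mem_coe.mpr w.2)))⟩

/-- The presentation `π : K[x_w | w ∈ gens] → R_X`, which sends `x_w` to the semi-canonical
generator of `w`. -/
def presentation : MvPolynomial E.gens K →ₐ[K] D.coordinateRing := MvPolynomial.aeval E.generator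

/-- The ideal `J(L)` of `X = X(L)` in `𝔸ⁿ`. -/
def idealJ : Ideal (MvPolynomial E.gens K) := RingHom.ker E.presentation

/-- The linear map `φ : (N ⊕ ℤᵐ)_ℝ → ℝⁿ`, `y ↦ (⟨y, w⟩)_{w ∈ gens}`. -/
def tropMap (y : (Fin k → ℝ) × (Fin E.m → ℝ)) : E.gens → ℝ :=
  fun w => pair y.1 w.1.1 + pair y.2 w.1.2

/-- The cone `C_i = φ(N_ℝ × ρ_i)`, where `ρ_i` is the ray spanned by `e_i`. -/
def facet (i : Fin (E.m + 1)) : Set (E.gens → ℝ) :=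
  {w | ∃ (y : Fin k → ℝ) (s : ℝ), 0 ≤ s ∧ w = E.tropMap (y, s • simplexRay ℝ i)}

/-- The relative interior of `C_i`. -/
def facetInterior (i : Fin (E.m + 1)) : Set (E.gens → ℝ) :=
  {w | ∃ (y : Fin k → ℝ) (s : ℝ), 0 < s ∧ w = E.tropMap (y, s • simplexRay ℝ i)}

/-- `v = v_W` for the matrix `W`, where `W ∈ trop^r(J(L))` has rank `r`. -/
structure IsWeightMatrix (W : Matrix (Fin r) E.gens ℚ)
    (v : AddValuation D.coordinateRing (WithTop (LexInt r))) : Prop where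
  mem_trop : W ∈ tropRank r E.idealJ
  rank_eq : W.rank = r
  eq_weight : IsWeightValuation E.presentation W v

end SemiCanonicalEmbedding

end TVar

end

namespace TVar

/-! ### Rational cones and lattice points -/

/-! Properness makes the divisor D(u) big for u in the interior of σ^∨, so every homogeneous g χ^w
with g ∈ K(ℙ¹)^* is a quotient of homogeneous elements of R_X (`exists_mem_part`). Hence v has
well-defined values on all such g χ^w. On K(ℙ¹) they form a valuation trivial on constants, and over
an algebraically closed field this is ord_P · γ for some point P and some γ ≥ 0 (`exists_ord_smul`).
With l(u) the value of χ^u, every homogeneous element satisfies v(f χ^u) = ord_P(f) γ + l(u)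
(`exists_val_homog_eq`). Laurent monomials z^v realise all divisors of degree 0 supported on the
Q_i. So for f χ^u ∈ R_X and a chosen i there is a monomial of the same degree u in R_X with the same
order at Q_i, and f is a combination of monomials of degree u with orders at Q_i at least that of f
(`exists_mem_dualMonoid`, `part_subset_span`). Take an embedding with P = Q_i. If v is homogeneous,
its values are then values of monomials, which gives the Khovanskii basis; and every F has a
preimage all of whose monomials have value at least v(F), so v is the weight valuation of the matrix
of values of the generators. Conversely, R_X has k + 1 algebraically independent elements, so full
rank forces the value group to have rank at least k + 1. If semi-canonical generators form a
Khovanskii basis, all values lie in the image of (a, u) ↦ aγ + l(u) on ℤ × ℤᵏ, which must therefore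
be injective (`injective_of_isKhovanskiiBasis`). Components of different degrees then have different
values and cannot cancel, so v is homogeneous. Moreover γ > 0, and P must be some Q_i, for otherwise
all z^v have order 0 at P and the rank is at most k. If v = v_W and In_W(J) has no monomial, the
columns of W are the values of the generators, and every value is the weight of a monomial; this
leads from weight matrices to Khovanskii bases. For the initial ideals, both W and the interior
points of C_i weigh x^α through its degree u and its order a at Q_i, strictly increasingly in a for
fixed u. Every such weighting yields the same initial ideal, the `orderIdeal`
(`initialIdeal_eq_orderIdeal`), whose definition refers only to Q_i and which contains no monomial.
-/

theorem exists_common_denominator {ι : Type*} [Finite ι] (q : ι → ℚ) :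
    ∃ d : ℕ, 0 < d ∧ ∀ i, ∃ z : ℤ, (z : ℚ) = d * q i := by
  cases nonempty_fintype ι
  refine ⟨∏ i, (q i).den, Finset.prod_pos fun i _ => (q i).den_pos, fun i => ?_⟩
  obtain ⟨e, he⟩ := Finset.dvd_prod_of_mem (fun i => (q i).den) (Finset.mem_univ i)
  refine ⟨(q i).num * e, ?_⟩
  rw [he]
  push_cast
  have := Rat.mul_den_eq_num (q i)
  rw [← this]
  ring

/-- Gordan's alternative: if `0` is not a nontrivial nonnegative combination of finitely many
vectors, then some linear form is positive on all of them. -/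
theorem exists_linearForm_pos {V : Type*} [AddCommGroup V] [Module ℚ V] {n : ℕ} (g : Fin n → V)
    (h : ∀ c : Fin n → ℚ, (∀ i, 0 ≤ c i) → ∑ i, c i • g i = 0 → c = 0) :
    ∃ l : V →ₗ[ℚ] ℚ, ∀ i, 0 < l (g i) := by
  induction n with
  | zero => exact ⟨0, fun i => i.elim0⟩
  | succ n ih =>
    obtain ⟨u, hu⟩ := ih (fun i => g i.succ) fun c hc h0 => by
      have := h (Fin.cons 0 c) (fun i => by
        refine Fin.cases ?_ (fun i => ?_) i
        · simp
        · simpa using hc i) (by simpa [Fin.sum_univ_succ] using h0)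
      funext i
      simpa using congrFun this i.succ
    by_cases h0 : 0 < u (g 0)
    · exact ⟨u, fun i => Fin.cases h0 hu i⟩
    have ht : 0 ≤ -u (g 0) := by linarith
    -- Now u(g 0) ≤ 0. The vectors -u(g 0) g_i + u(g_i) g 0 lie in the kernel of u, and a
    -- nonnegative relation among them is one among the g_i.
    obtain ⟨u', hu'⟩ := ih (fun i => (-u (g 0)) • g i.succ + u (g i.succ) • g 0) fun c hc hs => by
      have hsum : (∑ i, c i * u (g i.succ)) • g 0 + ∑ i, (c i * -u (g 0)) • g i.succ = 0 := by
        rw [← hs, Finset.sum_smul, ← Finset.sum_add_distrib]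
        refine Finset.sum_congr rfl fun i _ => ?_
        rw [smul_add, smul_smul, smul_smul, add_comm]
      have hnn : ∀ i, 0 ≤ c i * u (g i.succ) := fun i => mul_nonneg (hc i) (hu i).le
      have := h (Fin.cons (∑ i, c i * u (g i.succ)) fun i => c i * -u (g 0)) (fun i => by
        refine Fin.cases ?_ (fun i => ?_) i
        · simpa using Finset.sum_nonneg fun i _ => hnn i
        · simpa using mul_nonneg (hc i) ht) (by simpa [Fin.sum_univ_succ] using hsum)
      have h1 : ∑ i, c i * u (g i.succ) = 0 := by simpa using congrFun this 0
      rw [Finset.sum_eq_zero_iff_of_nonneg fun i _ => hnn i] at h1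
      funext i
      exact (mul_eq_zero.mp (h1 i (Finset.mem_univ i))).resolve_right (hu i).ne'
    have hg0 : g 0 ≠ 0 := fun hz => by
      have := h (Pi.single 0 1) (fun i => by
        by_cases hi : i = 0
        · subst hi; simp
        · simp [hi]) (by simp [hz])
      simpa using congrFun this 0
    obtain ⟨f, hf⟩ : ∃ f : V →ₗ[ℚ] ℚ, 0 < f (g 0) := by
      by_contra! hf
      refine hg0 ((Module.forall_dual_apply_eq_zero_iff ℚ _).mp fun f => le_antisymm (hf f) ?_)
      simpa using hf (-f)
    -- The form -u(g 0) u' + u'(g 0) u vanishes on g 0 and is positive on the other vectors. A large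
    -- multiple of it absorbs the values of a form f with f(g 0) > 0.
    have hw : ∀ i : Fin n, 0 < (-u (g 0)) * u' (g i.succ) + u' (g 0) * u (g i.succ) := fun i => by
      have := hu' i
      simp only [map_add, map_smul, smul_eq_mul] at this
      linarith
    obtain ⟨N, hN⟩ : ∃ N : ℚ, ∀ i : Fin n,
        0 < N * ((-u (g 0)) * u' (g i.succ) + u' (g 0) * u (g i.succ)) + f (g i.succ) := by
      refine (Filter.eventually_all.mpr fun i => ?_ : ∀ᶠ N : ℚ in Filter.atTop, _).exists
      exact ((Filter.tendsto_id.atTop_mul_const (hw i)).atTop_add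
        (tendsto_const_nhds (x := f (g i.succ)))).eventually_gt_atTop 0
    refine ⟨N • ((-u (g 0)) • u' + u' (g 0) • u) + f, fun i => Fin.cases ?_ (fun i => ?_) i⟩
    · simp only [LinearMap.add_apply, LinearMap.smul_apply, smul_eq_mul]
      nlinarith
    · exact hN i

theorem pair_smul {R : Type*} [CommRing R] {n : ℕ} (c : R) (x : Fin n → R) (u : Fin n → ℤ) :
    pair (c • x) u = c * pair x u := by
  simp [pair, Finset.mul_sum, mul_assoc]

theorem add_pair {R : Type*} [Ring R] {n : ℕ} (x y : Fin n → R) (u : Fin n → ℤ) :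
    pair (x + y) u = pair x u + pair y u := by
  simp [pair, add_mul, Finset.sum_add_distrib]

theorem pair_zsmul {R : Type*} [CommRing R] {n : ℕ} (x : Fin n → R) (c : ℤ) (u : Fin n → ℤ) :
    pair x (c • u) = c * pair x u := by
  simp only [pair, Finset.mul_sum, Pi.smul_apply, smul_eq_mul, Int.cast_mul]
  exact Finset.sum_congr rfl fun _ _ => by ring

/-- `x ↦ ⟨x, u⟩` as a linear form. -/
def pairLin {n : ℕ} (u : Fin n → ℤ) : (Fin n → ℚ) →ₗ[ℚ] ℚ where
  toFun x := pair x u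
  map_add' x y := add_pair x y u
  map_smul' c x := pair_smul c x u

/-- By Gordan's alternative for the nonzero generators of σ: in a nontrivial vanishing nonnegative
combination, one term and its negative would both lie in σ, against pointedness. -/
theorem PolyhedralDivisor.exists_interior_functional {K : Type*} [Field K] {k : ℕ}
    (D : PolyhedralDivisor K k) :
    ∃ l : (Fin k → ℚ) →ₗ[ℚ] ℚ, ∀ s ∈ D.tail, s ≠ 0 → 0 < l s := by
  classical
  obtain ⟨S, hS⟩ := D.tail_fg
  have hmem : ∀ s ∈ S, s ∈ D.tail := fun s hs => hS ▸ Submodule.subset_span hs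
  let e := (S.erase 0).equivFin
  have hmem' : ∀ i, ((e.symm i : Fin k → ℚ)) ∈ D.tail := fun i =>
    hmem _ (Finset.mem_of_mem_erase (e.symm i).2)
  have hne : ∀ i, ((e.symm i : Fin k → ℚ)) ≠ 0 := fun i => Finset.ne_of_mem_erase (e.symm i).2
  have hsm : ∀ c : ℚ, 0 ≤ c → ∀ x ∈ D.tail, c • x ∈ D.tail := fun c hc x hx =>
    D.tail.smul_mem hc hx
  obtain ⟨l, hl⟩ := exists_linearForm_pos (fun i => (e.symm i : Fin k → ℚ)) fun c hc h0 => by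
    funext j
    by_contra hj
    have hx : c j • (e.symm j : Fin k → ℚ) ∈ D.tail := hsm _ (hc j) _ (hmem' j)
    refine D.tail_pointed _ hx (smul_ne_zero hj (hne j)) ?_
    have : -(c j • (e.symm j : Fin k → ℚ))
        = ∑ i ∈ Finset.univ.erase j, c i • (e.symm i : Fin k → ℚ) := by
      rw [neg_eq_iff_add_eq_zero]
      exact (Finset.add_sum_erase _ (fun i => c i • (e.symm i : Fin k → ℚ))
        (Finset.mem_univ j)).trans h0
    rw [this]
    exact D.tail.sum_mem fun i _ => hsm _ (hc i) _ (hmem' i)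
  have hpos : ∀ s ∈ S, s ≠ 0 → 0 < l s := fun s hs hs0 => by
    have := hl (e ⟨s, Finset.mem_erase.mpr ⟨hs0, hs⟩⟩)
    simpa using this
  refine ⟨l, fun s hs => ?_⟩
  have key : 0 ≤ l s ∧ (l s = 0 → s = 0) := by
    rw [← hS] at hs
    induction hs using Submodule.span_induction with
    | mem x hx =>
      by_cases hx0 : x = 0
      · subst hx0; simp
      · exact ⟨(hpos x hx hx0).le, fun h => absurd h (hpos x hx hx0).ne'⟩
    | zero => simp
    | add x y _ _ h1 h2 =>
      rw [map_add]
      refine ⟨add_nonneg h1.1 h2.1, fun h => ?_⟩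
      rw [add_eq_zero_iff_of_nonneg h1.1 h2.1] at h
      rw [h1.2 h.1, h2.2 h.2, add_zero]
    | smul a x _ h =>
      have : l (a • x) = (a : ℚ) * l x := map_smul l (a : ℚ) x
      rw [this]
      refine ⟨mul_nonneg a.2 h.1, fun h0 => ?_⟩
      rcases mul_eq_zero.mp h0 with h0 | h0
      · rw [show a = 0 from Subtype.ext h0, zero_smul]
      · rw [h.2 h0, smul_zero]
  exact fun h0 => lt_of_le_of_ne key.1 fun h => h0 (key.2 h.symm)

/-- A lattice vector in the interior of the dual of the tailcone. -/
theorem PolyhedralDivisor.exists_interior {K : Type*} [Field K] {k : ℕ}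
    (D : PolyhedralDivisor K k) :
    ∃ u : Fin k → ℤ, ∀ s ∈ D.tail, s ≠ 0 → 0 < pair s u := by
  classical
  obtain ⟨l, hl⟩ := D.exists_interior_functional
  obtain ⟨d, hd, hz⟩ := exists_common_denominator fun j : Fin k => l (Pi.single j 1)
  choose z hz using hz
  refine ⟨z, fun s hs h0 => ?_⟩
  have : pair s z = d * l s := by
    rw [pair]
    conv_rhs => rw [← Finset.univ_sum_single s, map_sum, Finset.mul_sum]
    refine Finset.sum_congr rfl fun j _ => ?_
    have h1 : (Pi.single j (s j) : Fin k → ℚ) = s j • Pi.single j 1 := by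
      rw [← Pi.single_smul]; simp
    rw [hz, h1, map_smul, smul_eq_mul]
    ring
  rw [this]
  exact mul_pos (by exact_mod_cast hd) (hl s hs h0)

/-- Gordan's lemma: the lattice points in a polyhedral cone are finitely generated. -/
theorem fg_of_forall_nonneg {A ι : Type*} [AddCommGroup A] [AddGroup.FG A] [Finite ι]
    (l : ι → A →+ ℤ) (S : AddSubmonoid A) (hS : ∀ a, a ∈ S ↔ ∀ i, 0 ≤ l i a) : S.FG := by
  have : Module.Finite ℕ A := by
    rw [Module.Finite.iff_addMonoid_fg, ← AddGroup.fg_iff_addMonoid_fg]; infer_instance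
  obtain ⟨n, q, hq⟩ := Module.Finite.exists_fin' ℕ A
  -- Slack variables: after writing A as a quotient of ℕⁿ, the inequalities become equations l(q x)
  -- = y with y ≥ 0. The cone is the image of an equaliser of two homomorphisms on a free
  -- commutative monoid, which is finitely generated.
  let f : (Fin n → ℕ) × (ι → ℕ) →+ (ι → ℤ) :=
    { toFun := fun x i => l i (q x.1)
      map_zero' := by ext; simp
      map_add' := fun x y => by ext; simp }
  let g : (Fin n → ℕ) × (ι → ℕ) →+ (ι → ℤ) :=
    { toFun := fun x i => x.2 i
      map_zero' := by ext; simp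
      map_add' := fun x y => by ext; simp }
  have hfg := (AddSubmonoid.fg_eqLocusM f g).map (q.toAddMonoidHom.comp (AddMonoidHom.fst _ _))
  convert hfg
  ext a
  rw [hS, AddSubmonoid.mem_map]
  constructor
  · intro h
    obtain ⟨x, rfl⟩ := hq a
    refine ⟨(x, fun i => (l i (q x)).toNat), ?_, rfl⟩
    change f _ = g _
    ext i
    simp [f, g, h i]
  · rintro ⟨x, hx, rfl⟩ i
    have := congrFun (show f x = g x from hx) i
    simp only [f, g, AddMonoidHom.coe_mk, ZeroHom.coe_mk] at this
    simp [this]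

/-- Clearing denominators turns a rational ray into an integral inequality, as needed for Gordan's
lemma. -/
theorem exists_integral_form {k m : ℕ} (c : (Fin k → ℚ) × (Fin m → ℚ)) :
    ∃ (l : (Fin k → ℤ) × (Fin m → ℤ) →+ ℤ) (d : ℚ), 0 < d ∧
      ∀ w, (l w : ℚ) = d * (pair c.1 w.1 + pair c.2 w.2) := by
  obtain ⟨d, hd, hz⟩ := exists_common_denominator (Sum.elim c.1 c.2)
  choose z hz using hz
  refine ⟨{ toFun := fun w => ∑ j, z (Sum.inl j) * w.1 j + ∑ j, z (Sum.inr j) * w.2 j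
            map_zero' := by simp
            map_add' := fun w w' => by
              simp only [Prod.fst_add, Prod.snd_add, Pi.add_apply, mul_add,
                Finset.sum_add_distrib]
              ring }, d, by exact_mod_cast hd, fun w => ?_⟩
  simp [hz, pair, mul_add, Finset.mul_sum, mul_assoc]

/-! ### The dual monoid of C -/

namespace LineEmbedding

variable {K : Type*} [Field K] {k : ℕ} {D : PolyhedralDivisor K k} (L : LineEmbedding D)

theorem mem_dualMonoid_iff {w : (Fin k → ℤ) × (Fin L.m → ℤ)} :
    w ∈ L.dualMonoid ↔ w.1 ∈ D.tailDual ∧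
      ∀ i, ∀ x ∈ D.coeff (L.Q i), 0 ≤ pair x w.1 + pair (simplexRay ℚ i) w.2 := by
  constructor
  · intro hw
    refine ⟨fun s hs => ?_, fun i x hx => ?_⟩
    · have h := hw (s, 0) (PointedCone.subset_hull (Or.inr ⟨s, hs, rfl⟩))
      simpa [zero_pair] using h
    · exact hw (x, simplexRay ℚ i) (PointedCone.subset_hull (Or.inl ⟨i, x, hx, rfl⟩))
  · rintro ⟨h1, h2⟩ c hc
    induction hc using Submodule.span_induction with
    | mem c hc =>
      rcases hc with ⟨i, x, hx, rfl⟩ | ⟨s, hs, rfl⟩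
      · exact h2 i x hx
      · simpa [zero_pair] using h1 s hs
    | zero => simp [zero_pair]
    | add x y _ _ hx hy =>
      rw [Prod.fst_add, Prod.snd_add, add_pair, add_pair]
      linarith
    | smul a x _ hx =>
      have e1 : pair (a • x).1 w.1 = (a : ℚ) * pair x.1 w.1 := pair_smul (a : ℚ) x.1 w.1
      have e2 : pair (a • x).2 w.2 = (a : ℚ) * pair x.2 w.2 := pair_smul (a : ℚ) x.2 w.2
      rw [e1, e2, ← mul_add]
      exact mul_nonneg a.2 hx

/-- Finitely many inequalities suffice: those of the vertices of the Δ_i and of the generators of σ.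
The others follow because half-spaces are convex. -/
theorem dualMonoid_fg : L.dualMonoid.FG := by
  obtain ⟨S, hS⟩ := D.tail_fg
  choose V hV using D.coeff_polyhedron
  let c : (Σ i, V (L.Q i)) ⊕ S → (Fin k → ℚ) × (Fin L.m → ℚ) :=
    Sum.elim (fun a => (a.2, simplexRay ℚ a.1)) fun s => (s, 0)
  choose l d hd hl using fun a => exists_integral_form (c a)
  have hnn : ∀ a w, 0 ≤ l a w ↔ 0 ≤ pair (c a).1 w.1 + pair (c a).2 w.2 := fun a w => by
    rw [← Int.cast_nonneg_iff (R := ℚ), hl, mul_nonneg_iff_of_pos_left (hd a)]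
  refine fg_of_forall_nonneg l _ fun w => ?_
  rw [mem_dualMonoid_iff]
  simp only [hnn]
  constructor
  · rintro ⟨h1, h2⟩ (⟨i, x, hx⟩ | ⟨s, hs⟩)
    · refine h2 i x ?_
      rw [hV]
      exact ⟨x, subset_convexHull ℚ _ hx, 0, D.tail.zero_mem, add_zero _⟩
    · simpa [c, zero_pair] using h1 s (hS ▸ Submodule.subset_span hs)
  · intro h
    have h1 : w.1 ∈ D.tailDual := fun s hs => by
      rw [← hS] at hs
      induction hs using Submodule.span_induction with
      | mem s hs => simpa [c, zero_pair] using h (Sum.inr ⟨s, hs⟩)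
      | zero => simp [zero_pair]
      | add x y _ _ hx hy => rw [add_pair]; exact add_nonneg hx hy
      | smul a x _ hx =>
        have e1 : pair (a • x) w.1 = (a : ℚ) * pair x w.1 := pair_smul (a : ℚ) x w.1
        rw [e1]
        exact mul_nonneg a.2 hx
    refine ⟨h1, fun i x hx => ?_⟩
    rw [hV] at hx
    obtain ⟨y, hy, s, hs, rfl⟩ := hx
    have hy' : y ∈ {y : Fin k → ℚ | -pair (simplexRay ℚ i) w.2 ≤ pairLin w.1 y} :=
      convexHull_min (fun y hy => by
          have := h (Sum.inl ⟨i, y, hy⟩)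
          simp only [c, Sum.elim_inl] at this
          change _ ≤ pair y w.1
          linarith)
        (convex_halfSpace_ge (pairLin w.1).isLinear _) hy
    change _ ≤ pair y w.1 at hy'
    have := h1 s hs
    rw [add_pair]
    linarith

end LineEmbedding

end TVar

namespace TVar

/-! ### Rational functions on the projective line -/

section RatFuncOrd

variable {K : Type*} [Field K]

/-- Polynomials split, so constants and the X - c generate the multiplicative group of K(t). -/
theorem ratFunc_induction [IsAlgClosed K] {p : RatFunc K → Prop}
    (hC : ∀ c : K, c ≠ 0 → p (RatFunc.C c)) (hX : ∀ c : K, p (RatFunc.X - RatFunc.C c))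
    (hmul : ∀ f g, f ≠ 0 → g ≠ 0 → p f → p g → p (f * g))
    (hinv : ∀ f, f ≠ 0 → p f → p f⁻¹) (f : RatFunc K) (hf : f ≠ 0) : p f := by
  have hpoly : ∀ q : Polynomial K, q ≠ 0 → p (algebraMap _ (RatFunc K) q) := by
    intro q hq
    have hs := (IsAlgClosed.splits q).eq_prod_roots
    rw [hs, map_mul]
    have h1 : ∀ s : Multiset K,
        (s.map fun a => Polynomial.X - Polynomial.C a).prod ≠ 0 ∧
        p (algebraMap _ (RatFunc K) (s.map fun a => Polynomial.X - Polynomial.C a).prod) := by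
      intro s
      induction s using Multiset.induction with
      | empty => simpa using hC 1 one_ne_zero
      | cons a s ih =>
        rw [Multiset.map_cons, Multiset.prod_cons]
        refine ⟨mul_ne_zero (Polynomial.X_sub_C_ne_zero a) ih.1, ?_⟩
        rw [map_mul]
        refine hmul _ _ (RatFunc.algebraMap_ne_zero (Polynomial.X_sub_C_ne_zero a))
          (RatFunc.algebraMap_ne_zero ih.1) ?_ ih.2
        rw [map_sub, RatFunc.algebraMap_X, RatFunc.algebraMap_C]
        exact hX a
    have hlc := Polynomial.leadingCoeff_ne_zero.mpr hq
    refine hmul _ _ (RatFunc.algebraMap_ne_zero (Polynomial.C_ne_zero.mpr hlc))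
      (RatFunc.algebraMap_ne_zero (h1 _).1) ?_ (h1 _).2
    rw [RatFunc.algebraMap_C]
    exact hC _ hlc
  rw [← RatFunc.num_div_denom f, div_eq_mul_inv]
  have hd := RatFunc.algebraMap_ne_zero (K := K) f.denom_ne_zero
  exact hmul _ _ (RatFunc.algebraMap_ne_zero (RatFunc.num_ne_zero hf)) (inv_ne_zero hd)
    (hpoly _ (RatFunc.num_ne_zero hf)) (hinv _ hd (hpoly _ f.denom_ne_zero))

open Classical in
/-- The order of vanishing at a point, as a valuation of the function field. -/
noncomputable def ordV (P : OnePoint K) : AddValuation (RatFunc K) (WithTop ℤ) :=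
  AddValuation.of (fun f => if f = 0 then ⊤ else (ordAt P f : WithTop ℤ)) (by simp)
    (by simp [ordAt_one])
    (fun f g => by
      by_cases hf : f = 0
      · simp [hf]
      by_cases hg : g = 0
      · simp [hg]
      by_cases hfg : f + g = 0
      · simp [hfg]
      simp only [hf, hg, hfg, if_false]
      exact_mod_cast min_ordAt_le_add P hf hg hfg)
    (fun f g => by
      by_cases hf : f = 0
      · simp [hf]
      by_cases hg : g = 0
      · simp [hg]
      simp only [hf, hg, mul_eq_zero, or_self, if_false, ordAt_mul P hf hg]
      norm_cast)

theorem ordV_of_ne_zero (P : OnePoint K) {f : RatFunc K} (hf : f ≠ 0) :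
    ordV P f = (ordAt P f : WithTop ℤ) := by
  simp [ordV, AddValuation.of_apply, hf]

theorem projPoint_coe (c : K) : projPoint (c, (1 : K)) = (c : OnePoint K) := by
  simp [projPoint]

open Classical in
theorem ordAt_X_sub_C (P : OnePoint K) (c : K) :
    ordAt P (RatFunc.X - RatFunc.C c)
      = (if P = (c : OnePoint K) then 1 else 0) - (if P = OnePoint.infty then 1 else 0) := by
  have h := ordAt_linForm P (q := ((c, 1) : K × K)) (by simp)
  rw [projPoint_coe] at h
  simpa [linForm] using h

theorem X_sub_C_ne_zero (c : K) : (RatFunc.X - RatFunc.C c : RatFunc K) ≠ 0 := by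
  have := linForm_ne_zero (q := ((c, 1) : K × K)) (by simp)
  simpa [linForm] using this

/-- A rational function has finitely many zeros and poles, and its divisor has degree `0`. -/
theorem finsum_ordAt [IsAlgClosed K] (f : RatFunc K) (hf : f ≠ 0) :
    (Function.support fun P => ordAt P f).Finite ∧ ∑ᶠ P, ordAt P f = 0 := by
  classical
  refine ratFunc_induction (p := fun f =>
    (Function.support fun P => ordAt P f).Finite ∧ ∑ᶠ P, ordAt P f = 0) ?_ ?_ ?_ ?_ f hf
  · intro c _
    simp [ordAt_C]
  · intro c
    have hsub : (Function.support fun P => ordAt P (RatFunc.X - RatFunc.C c))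
        ⊆ (({(c : OnePoint K), OnePoint.infty} : Finset (OnePoint K)) : Set (OnePoint K)) := by
      intro P hP
      rw [Function.mem_support, ordAt_X_sub_C] at hP
      by_contra h
      simp only [Finset.coe_insert, Finset.coe_singleton, Set.mem_insert_iff,
        Set.mem_singleton_iff, not_or] at h
      simp [h.1, h.2] at hP
    refine ⟨(Finset.finite_toSet _).subset hsub, ?_⟩
    rw [finsum_eq_sum_of_support_subset _ hsub, Finset.sum_pair (OnePoint.coe_ne_infty c)]
    simp [ordAt_X_sub_C]
  · intro f g hf hg h1 h2
    have he : (fun P => ordAt P (f * g)) = fun P => ordAt P f + ordAt P g := by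
      funext P; exact ordAt_mul P hf hg
    rw [he]
    refine ⟨(h1.1.union h2.1).subset (Function.support_add _ _), ?_⟩
    rw [finsum_add_distrib h1.1 h2.1, h1.2, h2.2, add_zero]
  · intro f hf h
    have he : (fun P => ordAt P f⁻¹) = fun P => -ordAt P f := by
      funext P; exact ordAt_inv P hf
    rw [he]
    refine ⟨by rw [Function.support_fun_neg]; exact h.1, ?_⟩
    rw [finsum_neg_distrib, h.2, neg_zero]

/-- The divisor of f has degree 0, and the points left out contribute nonnegatively. -/
theorem sum_ordAt_nonpos [IsAlgClosed K] {f : RatFunc K} (hf : f ≠ 0) (T : Finset (OnePoint K))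
    (hT : ∀ P ∉ T, 0 ≤ ordAt P f) : ∑ P ∈ T, ordAt P f ≤ 0 := by
  classical
  obtain ⟨h1, h2⟩ := finsum_ordAt f hf
  rw [← h2, finsum_eq_sum_of_support_subset (s := T ∪ h1.toFinset) _ (by
    intro P hP; simp only [Finset.coe_union, Set.Finite.coe_toFinset]; exact Or.inr hP)]
  exact Finset.sum_le_sum_of_subset_of_nonneg Finset.subset_union_left fun P _ hP => hT P hP

/-- There is a rational function with zeros or poles of prescribed minimal orders, if the total
order is nonpositive. -/
theorem exists_ordAt_ge (T : Finset (OnePoint K)) (b : OnePoint K → ℤ) (hb : ∑ P ∈ T, b P ≤ 0) :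
    ∃ f : RatFunc K, f ≠ 0 ∧ (∀ P ∈ T, b P ≤ ordAt P f) ∧ ∀ P ∉ T, 0 ≤ ordAt P f := by
  classical
  -- The point at infinity gets the trivial factor 1: the order there is minus the sum of the b P
  -- over finite P ∈ T, which is large enough because the total of b is nonpositive.
  let g : OnePoint K → RatFunc K := fun P => P.elim 1 fun c => RatFunc.X - RatFunc.C c
  have hg : ∀ P, g P ≠ 0 := fun P => by
    induction P using OnePoint.rec with
    | infty => exact one_ne_zero
    | coe c => exact X_sub_C_ne_zero c
  have hgc : ∀ (c : K) P, ordAt (c : OnePoint K) (g P) = if P = c then 1 else 0 := fun c P => by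
    induction P using OnePoint.rec with
    | infty => simp [g, ordAt_one, OnePoint.infty_ne_coe]
    | coe a => simp [g, ordAt_X_sub_C, eq_comm]
  have hgi : ∀ P, ordAt OnePoint.infty (g P) = if P = OnePoint.infty then 0 else -1 := fun P => by
    induction P using OnePoint.rec with
    | infty => simp [g, ordAt_one]
    | coe a => simp [g, ordAt_X_sub_C]
  have hfc : ∀ c : K, ordAt (c : OnePoint K) (∏ P ∈ T, g P ^ b P)
      = if (c : OnePoint K) ∈ T then b c else 0 := fun c => by
    rw [ordAt_prod _ _ _ fun P => zpow_ne_zero _ (hg P)]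
    simp [ordAt_zpow _ (hg _), hgc]
  have hfi : ordAt OnePoint.infty (∏ P ∈ T, g P ^ b P)
      = (if OnePoint.infty ∈ T then b OnePoint.infty else 0) - ∑ P ∈ T, b P := by
    rw [ordAt_prod _ _ _ fun P => zpow_ne_zero _ (hg P), eq_sub_iff_add_eq,
      ← Finset.sum_add_distrib,
      ← Finset.sum_ite_eq' T OnePoint.infty b]
    refine Finset.sum_congr rfl fun P _ => ?_
    rw [ordAt_zpow _ (hg _), hgi]
    split_ifs <;> simp
  refine ⟨∏ P ∈ T, g P ^ b P, Finset.prod_ne_zero_iff.mpr fun P _ => zpow_ne_zero _ (hg P),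
    fun P hP => ?_, fun P hP => ?_⟩
  · induction P using OnePoint.rec with
    | infty => rw [hfi, if_pos hP]; linarith
    | coe c => rw [hfc, if_pos hP]
  · induction P using OnePoint.rec with
    | infty => rw [hfi, if_neg hP]; linarith
    | coe c => rw [hfc, if_neg hP]

/-- The residue field at P is K: subtract the value of f at P, which at infinity is the ratio of
leading coefficients. -/
theorem exists_const_sub (P : OnePoint K) {f : RatFunc K} (hf : f ≠ 0) (h0 : ordAt P f = 0) :
    ∃ c : K, f - RatFunc.C c ≠ 0 → 0 < ordAt P (f - RatFunc.C c) := by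
  have hn := RatFunc.num_ne_zero hf
  have hd := f.denom_ne_zero
  have hd' : algebraMap _ (RatFunc K) f.denom ≠ 0 := RatFunc.algebraMap_ne_zero hd
  have key : ∀ c : K, f - RatFunc.C c
      = algebraMap _ (RatFunc K) (f.num - Polynomial.C c * f.denom)
        / algebraMap _ (RatFunc K) f.denom := fun c => by
    rw [map_sub, map_mul, RatFunc.algebraMap_C, sub_div, mul_div_cancel_right₀ _ hd',
      RatFunc.num_div_denom]
  have hne : ∀ c : K, f - RatFunc.C c ≠ 0 → f.num - Polynomial.C c * f.denom ≠ 0 :=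
    fun c h hz => h (by rw [key, hz, map_zero, zero_div])
  induction P using OnePoint.rec with
  | infty =>
    refine ⟨f.num.leadingCoeff / f.denom.leadingCoeff, fun h => ?_⟩
    set c := f.num.leadingCoeff / f.denom.leadingCoeff with hc
    have hdl := Polynomial.leadingCoeff_ne_zero.mpr hd
    have hnl := Polynomial.leadingCoeff_ne_zero.mpr hn
    have hc0 : c ≠ 0 := div_ne_zero hnl hdl
    have hne' := hne c h
    rw [ordAt_infty, RatFunc.intDegree] at h0
    rw [ordAt_infty, key, div_eq_mul_inv, RatFunc.intDegree_mul (RatFunc.algebraMap_ne_zero hne')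
      (inv_ne_zero hd'), RatFunc.intDegree_inv, RatFunc.intDegree_polynomial,
      RatFunc.intDegree_polynomial]
    have hdeg : f.num.natDegree = f.denom.natDegree := by omega
    have hlt := Polynomial.degree_sub_lt_left (p := f.num) (q := Polynomial.C c * f.denom) (by
        rw [Polynomial.degree_C_mul hc0, Polynomial.degree_eq_natDegree hn,
          Polynomial.degree_eq_natDegree hd, hdeg]) hn (by
        rw [Polynomial.leadingCoeff_mul, Polynomial.leadingCoeff_C, hc, div_mul_cancel₀ _ hdl])
    have := Polynomial.natDegree_lt_natDegree hne' hlt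
    omega
  | coe a =>
    have hcop := RatFunc.isCoprime_num_denom f
    rw [ordAt_coe] at h0
    have hda : f.denom.eval a ≠ 0 := fun hz => by
      have h1 : 0 < f.denom.rootMultiplicity a := (Polynomial.rootMultiplicity_pos hd).mpr hz
      have h2 : 0 < f.num.rootMultiplicity a := by omega
      obtain ⟨x, y, hxy⟩ := hcop
      have := congrArg (Polynomial.eval a) hxy
      rw [Polynomial.rootMultiplicity_pos hn] at h2
      simp [hz, h2.eq_zero] at this
    refine ⟨f.num.eval a / f.denom.eval a, fun h => ?_⟩
    have hne' := hne _ h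
    rw [key, ordAt_coe_div a hne' hd]
    have h1 : f.denom.rootMultiplicity a = 0 := Polynomial.rootMultiplicity_eq_zero hda
    have h2 := (Polynomial.rootMultiplicity_pos (x := a) hne').mpr (by
      rw [Polynomial.IsRoot, Polynomial.eval_sub, Polynomial.eval_mul, Polynomial.eval_C,
        div_mul_cancel₀ _ hda, sub_self])
    omega

theorem exists_smul_sub (P : OnePoint K) {f g : RatFunc K} (hf : f ≠ 0) (hg : g ≠ 0)
    (h : ordAt P f = ordAt P g) :
    ∃ c : K, f - c • g ≠ 0 → ordAt P f < ordAt P (f - c • g) := by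
  obtain ⟨c, hc⟩ := exists_const_sub P (div_ne_zero hf hg) (by rw [ordAt_div P hf hg, h, sub_self])
  have he : f - c • g = (f / g - RatFunc.C c) * g := by
    rw [sub_mul, div_mul_cancel₀ _ hg, RatFunc.smul_eq_C_mul]
  refine ⟨c, fun hne => ?_⟩
  rw [he] at hne ⊢
  have h1 := left_ne_zero_of_mul hne
  rw [ordAt_mul P h1 hg, h]
  linarith [hc h1]

end RatFuncOrd

/-! ### Laurent monomials on the line -/

namespace LineEmbedding

variable {K : Type*} [Field K] {k : ℕ} {D : PolyhedralDivisor K k} (L : LineEmbedding D)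

theorem Q_injective : Function.Injective L.Q := L.injective_point

theorem ordAt_zMonomial_of_ne {P : OnePoint K} (hP : ∀ i, P ≠ L.Q i) (v : Fin L.m → ℤ) :
    ordAt P (L.zMonomial v) = 0 := by
  rw [ordAt_zMonomial]
  simp [hP]

/-- This links the fan of ℙᵐ with divisors on L: pairing with e_i is the order at Q_i. -/
theorem pair_simplexRay (R : Type*) [Ring R] (i : Fin (L.m + 1)) (v : Fin L.m → ℤ) :
    pair (simplexRay R i) v = (ordAt (L.Q i) (L.zMonomial v) : R) := by
  rw [ordAt_zMonomial]
  simp only [pair, simplexRay, L.Q_injective.eq_iff]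
  push_cast
  refine Finset.sum_congr rfl fun j _ => ?_
  split_ifs <;> simp

theorem ordAt_Q_succ (j : Fin L.m) (v : Fin L.m → ℤ) :
    ordAt (L.Q j.succ) (L.zMonomial v) = v j := by
  rw [ordAt_zMonomial]
  simp [L.Q_injective.eq_iff, Fin.succ_ne_zero]

theorem ordAt_Q_zero (v : Fin L.m → ℤ) :
    ordAt (L.Q 0) (L.zMonomial v) = -∑ j, v j := by
  rw [ordAt_zMonomial]
  simp [L.Q_injective.eq_iff, (Fin.succ_ne_zero _).symm]

theorem zMonomial_ne_zero (v : Fin L.m → ℤ) : L.zMonomial v ≠ 0 :=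
  Finset.prod_ne_zero_iff.mpr fun _ _ => zpow_ne_zero _
    (div_ne_zero (linForm_ne_zero (L.p_ne_zero _)) (linForm_ne_zero (L.p_ne_zero _)))

theorem zMonomial_zero : L.zMonomial 0 = 1 := by simp [zMonomial]

theorem zMonomial_add (v w : Fin L.m → ℤ) :
    L.zMonomial (v + w) = L.zMonomial v * L.zMonomial w := by
  simp only [zMonomial, ← Finset.prod_mul_distrib, Pi.add_apply]
  exact Finset.prod_congr rfl fun j _ => zpow_add₀
    (div_ne_zero (linForm_ne_zero (L.p_ne_zero _)) (linForm_ne_zero (L.p_ne_zero _))) _ _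

/-- The exponents are the orders at Q_1, …, Q_m; the order at Q_0 is then forced by degree 0. -/
theorem exists_zMonomial (b : Fin (L.m + 1) → ℤ) (hb : ∑ i, b i = 0) :
    ∃ v, ∀ i, ordAt (L.Q i) (L.zMonomial v) = b i := by
  refine ⟨fun j => b j.succ, fun i => Fin.cases ?_ (fun j => ?_) i⟩
  · rw [ordAt_Q_zero]
    rw [Fin.sum_univ_succ] at hb
    linarith
  · rw [ordAt_Q_succ]

/-- A Laurent monomial with a prescribed order at one boundary point, and orders bounded below at
the other ones. -/
theorem exists_zMonomial_ge (a : Fin (L.m + 1) → ℤ) (ha : ∑ i, a i ≤ 0) (i₀ : Fin (L.m + 1)) :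
    ∃ v, (∀ i, a i ≤ ordAt (L.Q i) (L.zMonomial v)) ∧
      ordAt (L.Q i₀) (L.zMonomial v) = a i₀ := by
  -- Since m ≥ 1 there is a second boundary point, which absorbs the surplus -∑ a i.
  have : Nontrivial (Fin (L.m + 1)) := Fin.nontrivial_iff_two_le.mpr (by have := L.one_le_m; omega)
  obtain ⟨i₁, hi⟩ := exists_ne i₀
  obtain ⟨v, hv⟩ := L.exists_zMonomial (a + Pi.single i₁ (-∑ i, a i)) (by
    simp [Finset.sum_add_distrib])
  refine ⟨v, fun i => ?_, by simp [hv, hi.symm]⟩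
  rw [hv]
  by_cases h : i = i₁
  · subst h; simpa using ha
  · simp [h]

theorem sum_ordAt_Q_nonpos [IsAlgClosed K] {f : RatFunc K} (hf : f ≠ 0)
    (hreg : ∀ P, (∀ i, P ≠ L.Q i) → 0 ≤ ordAt P f) : ∑ i, ordAt (L.Q i) f ≤ 0 := by
  classical
  have := sum_ordAt_nonpos hf (Finset.univ.image L.Q) fun P hP => hreg P fun i h =>
    hP (h ▸ Finset.mem_image_of_mem _ (Finset.mem_univ i))
  rwa [Finset.sum_image fun _ _ _ _ h => L.Q_injective h] at this

/-- Sections of a line bundle supported at the boundary points are spanned by Laurent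
monomials. -/
theorem mem_span_zMonomial [IsAlgClosed K] (i₀ : Fin (L.m + 1)) (a : Fin (L.m + 1) → ℤ)
    (f : RatFunc K) (hQ : f ≠ 0 → ∀ i, a i ≤ ordAt (L.Q i) f)
    (hreg : f ≠ 0 → ∀ P, (∀ i, P ≠ L.Q i) → 0 ≤ ordAt P f) :
    f ∈ Submodule.span K (L.zMonomial '' {v | ∀ i, a i ≤ ordAt (L.Q i) (L.zMonomial v)}) := by
  -- Induction on the degree -∑ a i of the line bundle. Subtracting a multiple of a monomial of
  -- order exactly a i₀ at Q_{i₀} raises the order there, so a i₀ may be increased by 1; in negative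
  -- degree only f = 0 is left.
  obtain ⟨n, hn⟩ : ∃ n : ℕ, -∑ i, a i < n := ⟨(-∑ i, a i).toNat + 1, by omega⟩
  induction n generalizing a f with
  | zero =>
    by_cases hf : f = 0
    · rw [hf]; exact zero_mem _
    have h1 := L.sum_ordAt_Q_nonpos hf (hreg hf)
    have h2 := Finset.sum_le_sum fun i (_ : i ∈ Finset.univ) => hQ hf i
    push_cast at hn
    omega
  | succ n ih =>
    by_cases hf : f = 0
    · rw [hf]; exact zero_mem _
    have hsum : ∑ i, a i ≤ 0 :=
      (Finset.sum_le_sum fun i _ => hQ hf i).trans (L.sum_ordAt_Q_nonpos hf (hreg hf))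
    obtain ⟨v, hv, hv0⟩ := L.exists_zMonomial_ge a hsum i₀
    have hz := L.zMonomial_ne_zero v
    obtain ⟨c, hc⟩ : ∃ c : K, f - c • L.zMonomial v ≠ 0 →
        a i₀ < ordAt (L.Q i₀) (f - c • L.zMonomial v) := by
      rcases (hQ hf i₀).lt_or_eq with h | h
      · exact ⟨0, fun _ => by simpa using h⟩
      · obtain ⟨c, hc⟩ := exists_smul_sub (L.Q i₀) hf hz (by rw [hv0, h])
        exact ⟨c, fun hne => h ▸ hc hne⟩
    have hge : ∀ P (x : ℤ), x ≤ ordAt P f → x ≤ ordAt P (L.zMonomial v) →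
        f - c • L.zMonomial v ≠ 0 → x ≤ ordAt P (f - c • L.zMonomial v) := by
      intro P x h1 h2 hne
      have h3 := (ordV P).map_le_sub (g := (x : WithTop ℤ)) (x := f) (y := c • L.zMonomial v)
        (by rw [ordV_of_ne_zero P hf]; exact_mod_cast h1) (by
          rw [RatFunc.smul_eq_C_mul, (ordV P).map_mul, ordV_of_ne_zero P hz]
          by_cases hc0 : c = 0
          · simp [hc0]
          · rw [ordV_of_ne_zero P (by simpa using hc0), ordAt_C]
            simpa using h2)
      rw [ordV_of_ne_zero P hne] at h3
      exact_mod_cast h3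
    have hmain := ih (a + Pi.single i₀ 1) (f - c • L.zMonomial v) (fun hne i => by
        by_cases hi : i = i₀
        · subst hi
          simpa using hc hne
        · simpa [hi] using hge _ _ (hQ hf i) (hv i) hne)
      (fun hne P hP => hge _ _ (hreg hf P hP) (L.ordAt_zMonomial_of_ne hP v).ge hne)
      (by simp [Finset.sum_add_distrib]; push_cast at hn; omega)
    have hsub : L.zMonomial '' {v | ∀ i, (a + Pi.single i₀ 1 : Fin (L.m + 1) → ℤ) i ≤ ordAt (L.Q i) (L.zMonomial v)}
        ⊆ L.zMonomial '' {v | ∀ i, a i ≤ ordAt (L.Q i) (L.zMonomial v)} :=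
      Set.image_mono fun w hw i => by
        have := hw i
        rw [Pi.add_apply] at this
        have h0 : (0 : ℤ) ≤ (Pi.single i₀ 1 : Fin (L.m + 1) → ℤ) i := by
          by_cases hi : i = i₀
          · subst hi; simp
          · simp [hi]
        omega
    have := add_mem (Submodule.span_mono hsub hmain)
      (Submodule.smul_mem _ c (Submodule.subset_span ⟨v, hv, rfl⟩))
    simpa using this

/-- The inequalities defining C^∨ at Q_i are the section conditions at that point, and raising
orders preserves them. -/
theorem mem_dualMonoid_of_ge {u : Fin k → ℤ} {f : RatFunc K} (hf : f ∈ D.part u) (hf0 : f ≠ 0)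
    {v : Fin L.m → ℤ} (hv : ∀ i, ordAt (L.Q i) f ≤ ordAt (L.Q i) (L.zMonomial v)) :
    (u, v) ∈ L.dualMonoid := by
  rw [mem_dualMonoid_iff]
  refine ⟨hf.2 hf0, fun i x hx => ?_⟩
  have h1 := hf.1 hf0 (L.Q i) x hx
  have h2 : (ordAt (L.Q i) f : ℚ) ≤ ordAt (L.Q i) (L.zMonomial v) := by exact_mod_cast hv i
  rw [pair_simplexRay]
  linarith

theorem ordAt_nonneg_of_mem_part {u : Fin k → ℤ} {f : RatFunc K} (hf : f ∈ D.part u)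
    (hf0 : f ≠ 0) {P : OnePoint K} (hP : ∀ i, P ≠ L.Q i) : 0 ≤ ordAt P f := by
  have hσ : D.coeff P = (D.tail : Set (Fin k → ℚ)) := by
    by_contra h
    obtain ⟨i, hi⟩ := L.support_subset P h
    exact hP i hi.symm
  have := hf.1 hf0 P 0 (by rw [hσ]; exact D.tail.zero_mem)
  rw [zero_pair, add_zero] at this
  exact_mod_cast this

/-- Every order at Q_i that occurs in degree u already occurs for a monomial; this is the source of
the Khovanskii property. -/
theorem exists_mem_dualMonoid [IsAlgClosed K] {u : Fin k → ℤ} {f : RatFunc K}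
    (hf : f ∈ D.part u) (hf0 : f ≠ 0) (i : Fin (L.m + 1)) :
    ∃ v, (u, v) ∈ L.dualMonoid ∧ ordAt (L.Q i) (L.zMonomial v) = ordAt (L.Q i) f := by
  obtain ⟨v, h1, h2⟩ := L.exists_zMonomial_ge (fun i => ordAt (L.Q i) f)
    (L.sum_ordAt_Q_nonpos hf0 fun P hP => L.ordAt_nonneg_of_mem_part hf hf0 hP) i
  exact ⟨v, L.mem_dualMonoid_of_ge hf hf0 h1, h2⟩

/-- The spanning monomials may be taken with orders at Q_i no smaller than that of f; this is what
makes v a weight valuation. The bound uses `ordV`, so that it also makes sense for f = 0. -/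
theorem part_subset_span [IsAlgClosed K] {u : Fin k → ℤ} {f : RatFunc K} (hf : f ∈ D.part u)
    (i : Fin (L.m + 1)) :
    f ∈ Submodule.span K (L.zMonomial '' {v | (u, v) ∈ L.dualMonoid ∧
      ordV (L.Q i) f ≤ (ordAt (L.Q i) (L.zMonomial v) : WithTop ℤ)}) := by
  by_cases hf0 : f = 0
  · rw [hf0]; exact zero_mem _
  have hsub : {v | ∀ i, ordAt (L.Q i) f ≤ ordAt (L.Q i) (L.zMonomial v)} ⊆
      {v | (u, v) ∈ L.dualMonoid ∧
        ordV (L.Q i) f ≤ (ordAt (L.Q i) (L.zMonomial v) : WithTop ℤ)} := fun v hv => by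
    refine ⟨L.mem_dualMonoid_of_ge hf hf0 hv, ?_⟩
    rw [ordV_of_ne_zero _ hf0]
    exact_mod_cast hv i
  exact Submodule.span_mono (Set.image_mono hsub)
    (L.mem_span_zMonomial i (fun i => ordAt (L.Q i) f) f (fun _ _ => le_rfl)
      fun _ P hP => L.ordAt_nonneg_of_mem_part hf hf0 hP)

end LineEmbedding

end TVar

namespace TVar
namespace PolyhedralDivisor

/-! ### Quotients of homogeneous elements -/

variable {K : Type*} [Field K] {k : ℕ} (D : PolyhedralDivisor K k)

/-- For w outside σ^∨ the pairing is unbounded below on Δ_P, but it is bounded on the polytope part.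
The tail part s is handled separately, after adding a large multiple of an interior u to w. -/
theorem exists_bound (P : OnePoint K) (w : Fin k → ℤ) :
    ∃ c : ℚ, ∀ y ∈ D.coeff P, ∃ x ∈ D.coeff P, ∃ s ∈ D.tail, y = x + s ∧ c ≤ pair x w := by
  obtain ⟨V, hV⟩ := D.coeff_polyhedron P
  obtain ⟨c, hc⟩ := (V.image fun x => pair x w).bddBelow
  refine ⟨c, fun y hy => ?_⟩
  rw [hV] at hy ⊢
  obtain ⟨x, hx, s, hs, rfl⟩ := hy
  refine ⟨x, ⟨x, hx, 0, D.tail.zero_mem, add_zero _⟩, s, hs, rfl, ?_⟩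
  exact convexHull_min (t := {x | c ≤ pairLin w x})
    (fun x hx => hc (Finset.mem_coe.mpr (Finset.mem_image_of_mem _ hx)))
    (convex_halfSpace_ge (pairLin w).isLinear _) hx

/-- As u is nonnegative on σ, the minimum is attained at a vertex. -/
theorem exists_min {u : Fin k → ℤ} (hu : u ∈ D.tailDual) (P : OnePoint K)
    (hP : (D.coeff P).Nonempty) : ∃ x ∈ D.coeff P, ∀ y ∈ D.coeff P, pair x u ≤ pair y u := by
  obtain ⟨V, hV⟩ := D.coeff_polyhedron P
  have hVn : V.Nonempty := by
    rw [hV] at hP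
    obtain ⟨_, x, hx, _⟩ := hP
    simpa using convexHull_nonempty_iff.mp ⟨x, hx⟩
  obtain ⟨x, hx, hmin⟩ := V.exists_min_image (fun x => pair x u) hVn
  rw [hV]
  refine ⟨x, ⟨x, subset_convexHull ℚ _ hx, 0, D.tail.zero_mem, add_zero _⟩, ?_⟩
  rintro _ ⟨y, hy, s, hs, rfl⟩
  have h1 : pair x u ≤ pair y u := convexHull_min (t := {y | pair x u ≤ pairLin u y})
    (fun y hy => hmin y hy) (convex_halfSpace_ge (pairLin u).isLinear _) hy
  have h2 := hu s hs
  change _ ≤ pair (y + s) u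
  rw [add_pair]
  linarith

theorem coeff_of_notMem_support {P : OnePoint K} (hP : P ∉ D.finite_support.toFinset) :
    D.coeff P = (D.tail : Set (Fin k → ℚ)) := by
  simpa using hP

/-- Lower bounds for `Δ_P(u)`, for `u` in the interior of the dual of the tailcone, with positive
sum: this is the bigness of `D(u)`. -/
theorem exists_lowerBounds (hD : D.IsProper) {u : Fin k → ℤ}
    (hu : ∀ s ∈ D.tail, s ≠ 0 → 0 < pair s u) :
    ∃ μ : OnePoint K → ℚ, (∀ P, ∀ x ∈ D.coeff P, μ P ≤ pair x u) ∧
      ∀ T : Finset (OnePoint K), D.finite_support.toFinset ⊆ T → 0 < ∑ P ∈ T, μ P := by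
  classical
  have hu' : u ∈ D.tailDual := fun s hs => by
    by_cases h0 : s = 0
    · rw [h0, zero_pair]
    · exact (hu s hs h0).le
  have hpos : ∀ P ∉ D.finite_support.toFinset, ∀ x ∈ D.coeff P, 0 ≤ pair x u := fun P hP x hx =>
    hu' x (by rwa [D.coeff_of_notMem_support hP] at hx)
  by_cases hne : ∀ P, (D.coeff P).Nonempty
  · choose x hx hmin using fun P => D.exists_min hu' P (hne P)
    refine ⟨fun P => pair (x P) u, fun P y hy => hmin P y hy, fun T hT => ?_⟩
    refine lt_of_lt_of_le ?_ (Finset.sum_le_sum_of_subset_of_nonneg hT fun P _ hP =>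
      hpos P hP _ (hx P))
    have hsum : ∑ P ∈ D.finite_support.toFinset, x P
        ∈ ∑ P ∈ D.finite_support.toFinset, D.coeff P :=
      Set.finsetSum_mem_finsetSum _ _ _ fun P _ => hx P
    have hdeg : ∑ P ∈ D.finite_support.toFinset, x P ∈ D.degree :=
      ⟨0, D.tail.zero_mem, _, hsum, zero_add _⟩
    have heq : ∑ P ∈ D.finite_support.toFinset, pair (x P) u
        = pair (∑ P ∈ D.finite_support.toFinset, x P) u :=
      (map_sum (pairLin u) x _).symm
    rw [heq]
    -- The sum of minimisers lies in σ. It is nonzero, since otherwise the degree would contain 0 +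
    -- σ = σ, against properness.
    refine hu _ (hD.1 hdeg) fun h0 => hD.2 fun s hs => ⟨s, hs, 0, ?_, add_zero _⟩
    rw [← h0]
    exact hsum
  · push Not at hne
    obtain ⟨P₀, hP₀⟩ := hne
    have hP₀' : P₀ ∈ D.finite_support.toFinset := by
      by_contra h
      have h1 := D.coeff_of_notMem_support h
      rw [hP₀] at h1
      have h2 : (0 : Fin k → ℚ) ∈ (∅ : Set (Fin k → ℚ)) := h1 ▸ D.tail.zero_mem
      exact h2
    have hm : ∀ P, ∃ c : ℚ, (∀ x ∈ D.coeff P, c ≤ pair x u) ∧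
        (P ∉ D.finite_support.toFinset → 0 ≤ c) := fun P => by
      by_cases hP : (D.coeff P).Nonempty
      · obtain ⟨x, hx, hmin⟩ := D.exists_min hu' P hP
        exact ⟨pair x u, hmin, fun h => hpos P h x hx⟩
      · exact ⟨0, fun x hx => absurd ⟨x, hx⟩ hP, fun _ => le_rfl⟩
    choose μ hμ hμ' using hm
    -- An empty coefficient imposes no condition at P₀, so its bound can be chosen to make the total
    -- over the support equal to 1.
    refine ⟨Function.update μ P₀ (1 - ∑ P ∈ D.finite_support.toFinset.erase P₀, μ P),
      fun P x hx => ?_, fun T hT => ?_⟩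
    · have : P ≠ P₀ := by
        rintro rfl
        rw [hP₀] at hx
        exact hx
      rw [Function.update_of_ne this]
      exact hμ P x hx
    · refine lt_of_lt_of_le ?_ (Finset.sum_le_sum_of_subset_of_nonneg hT fun P _ hP => ?_)
      · rw [← Finset.add_sum_erase _ _ hP₀', Function.update_self,
          Finset.sum_congr rfl fun P hP => Function.update_of_ne (Finset.ne_of_mem_erase hP) _ _]
        simp
      · rw [Function.update_of_ne (by rintro rfl; exact hP hP₀')]
        exact hμ' P hP

/-- On each of the finitely many nonzero generators of σ the pairing grows linearly in n. -/
theorem eventually_mem_tailDual {u : Fin k → ℤ} (hu : ∀ s ∈ D.tail, s ≠ 0 → 0 < pair s u)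
    (w : Fin k → ℤ) : ∀ᶠ n : ℕ in Filter.atTop, (n : ℤ) • u + w ∈ D.tailDual := by
  obtain ⟨S, hS⟩ := D.tail_fg
  have h1 : ∀ᶠ n : ℕ in Filter.atTop, ∀ s ∈ S, 0 ≤ pair s ((n : ℤ) • u + w) := by
    rw [Filter.eventually_all_finset]
    intro s hs
    simp only [pair_add, pair_zsmul, Int.cast_natCast]
    by_cases h0 : s = 0
    · simp [h0, zero_pair]
    · exact ((tendsto_natCast_atTop_atTop.atTop_mul_const
        (hu s (hS ▸ Submodule.subset_span hs) h0)).atTop_add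
        (tendsto_const_nhds (x := pair s w))).eventually_ge_atTop 0
  filter_upwards [h1] with n hn s hs
  rw [← hS] at hs
  induction hs using Submodule.span_induction with
  | mem s hs => exact hn s hs
  | zero => simp [zero_pair]
  | add x y _ _ hx hy => rw [add_pair]; exact add_nonneg hx hy
  | smul a x _ hx =>
    have e1 : pair (a • x) ((n : ℤ) • u + w) = (a : ℚ) * pair x ((n : ℤ) • u + w) :=
      pair_smul (a : ℚ) x _
    rw [e1]
    exact mul_nonneg a.2 hx

/-- Every homogeneous element `g χ^w` of `K(ℙ¹)[M]` is a quotient of homogeneous elements of the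
coordinate ring. -/
theorem exists_mem_part [IsAlgClosed K] (hD : D.IsProper) (w : Fin k → ℤ) {g : RatFunc K}
    (hg : g ≠ 0) : ∃ (u : Fin k → ℤ) (b : RatFunc K), b ≠ 0 ∧ b ∈ D.part u ∧
      g * b ∈ D.part (w + u) := by
  classical
  obtain ⟨u, hu⟩ := D.exists_interior
  obtain ⟨μ, hμ, hsum⟩ := D.exists_lowerBounds hD hu
  choose c₀ hc₀ using fun P => D.exists_bound P 0
  choose c₁ hc₁ using fun P => D.exists_bound P w
  let T := D.finite_support.toFinset ∪ (finsum_ordAt g hg).1.toFinset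
  -- If ord_P(b) ≥ -n μ_P + C_P on T, then b is a section in degree n u and g b in degree w + n u.
  -- The two entries of the maximum serve these two conditions.
  let C : OnePoint K → ℚ := fun P => max (-c₀ P) (-ordAt P g - c₁ P)
  -- The positive sum of the μ_P beats all constants for large n; the 1 at each point pays for
  -- rounding up to integral orders.
  have hev : ∀ᶠ n : ℕ in Filter.atTop, ∑ P ∈ T, (C P + 1) ≤ n * ∑ P ∈ T, μ P :=
    (tendsto_natCast_atTop_atTop.atTop_mul_const
      (hsum T Finset.subset_union_left)).eventually_ge_atTop _
  obtain ⟨n, hn, h0, h1⟩ := (hev.and ((D.eventually_mem_tailDual hu 0).and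
    (D.eventually_mem_tailDual hu w))).exists
  have hb : ∑ P ∈ T, ⌈-(n * μ P) + C P⌉ ≤ 0 := by
    have : (∑ P ∈ T, ⌈-(n * μ P) + C P⌉ : ℚ) ≤ ∑ P ∈ T, (-(n * μ P) + C P + 1) :=
      Finset.sum_le_sum fun P _ => (Int.ceil_lt_add_one _).le
    have h2 : ∑ P ∈ T, (-(n * μ P) + C P + 1) = -(n * ∑ P ∈ T, μ P) + ∑ P ∈ T, (C P + 1) := by
      rw [Finset.mul_sum, ← Finset.sum_neg_distrib, ← Finset.sum_add_distrib]
      exact Finset.sum_congr rfl fun _ _ => add_assoc _ _ _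
    have h3 : ((∑ P ∈ T, ⌈-(n * μ P) + C P⌉ : ℤ) : ℚ) ≤ 0 := by
      push_cast
      linarith
    exact_mod_cast h3
  obtain ⟨b, hb0, hbT, hbT'⟩ := exists_ordAt_ge T (fun P => ⌈-(n * μ P) + C P⌉) hb
  have hbT'' : ∀ P ∈ T, -(n * μ P) + C P ≤ ordAt P b := fun P hP =>
    Int.ceil_le.mp (hbT P hP)
  have key : ∀ (P : OnePoint K) (w' : Fin k → ℤ) (c : ℚ), (n : ℤ) • u + w' ∈ D.tailDual →
      (∀ y ∈ D.coeff P, ∃ x ∈ D.coeff P, ∃ s ∈ D.tail, y = x + s ∧ c ≤ pair x w') →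
      ∀ y ∈ D.coeff P, n * μ P + c ≤ pair y ((n : ℤ) • u + w') := by
    intro P w' c hw hc y hy
    obtain ⟨x, hx, s, hs, rfl, hxc⟩ := hc y hy
    have e1 := hw s hs
    have e2 := mul_le_mul_of_nonneg_left (hμ P x hx) (Nat.cast_nonneg (α := ℚ) n)
    have e3 : pair x ((n : ℤ) • u + w') = n * pair x u + pair x w' := by
      rw [pair_add, pair_zsmul, Int.cast_natCast]
    rw [add_pair, e3]
    linarith
  refine ⟨(n : ℤ) • u, b, hb0, ⟨fun _ P x hx => ?_, fun _ => by simpa using h0⟩,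
    ⟨fun _ P x hx => ?_, fun _ => by rw [add_comm]; exact h1⟩⟩
  · by_cases hP : P ∈ T
    · have e1 := key P 0 _ h0 (hc₀ P) x hx
      have e2 := hbT'' P hP
      have e3 : -c₀ P ≤ C P := le_max_left _ _
      rw [add_zero] at e1
      linarith
    · have hσ := D.coeff_of_notMem_support fun h => hP (Finset.mem_union_left _ h)
      rw [hσ] at hx
      have e1 := h0 x hx
      have e2 : (0 : ℚ) ≤ ordAt P b := by exact_mod_cast hbT' P hP
      rw [add_zero] at e1
      linarith
  · rw [ordAt_mul P hg hb0, add_comm w]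
    push_cast
    by_cases hP : P ∈ T
    · have e1 := key P w _ h1 (hc₁ P) x hx
      have e2 := hbT'' P hP
      have e3 : -ordAt P g - c₁ P ≤ C P := le_max_right _ _
      linarith
    · have hσ := D.coeff_of_notMem_support fun h => hP (Finset.mem_union_left _ h)
      have hg0 : ordAt P g = 0 := by
        by_contra h
        exact hP (Finset.mem_union_right _ (by simpa using h))
      rw [hσ] at hx
      have e1 := h1 x hx
      have e2 : (0 : ℚ) ≤ ordAt P b := by exact_mod_cast hbT' P hP
      rw [hg0]
      push_cast
      linarith

end PolyhedralDivisor
end TVar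

namespace TVar

/-! ### Restrictions of valuations to homogeneous elements -/

namespace PolyhedralDivisor

variable {K : Type*} [Field K] {k r : ℕ} (D : PolyhedralDivisor K k)

open Classical in
/-- The homogeneous element `f χ^u` of the coordinate ring (and `0` if it is not in it). -/
noncomputable def homog (u : Fin k → ℤ) (f : RatFunc K) : D.coordinateRing :=
  if h : f ∈ D.part u then ⟨AddMonoidAlgebra.single u f, D.single_mem h⟩ else 0

variable {D}

theorem coe_homog {u : Fin k → ℤ} {f : RatFunc K} (h : f ∈ D.part u) :
    (D.homog u f : AddMonoidAlgebra (RatFunc K) (Fin k → ℤ)) = AddMonoidAlgebra.single u f := by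
  rw [homog, dif_pos h]

theorem homog_mul {u u' : Fin k → ℤ} {f g : RatFunc K} (hf : f ∈ D.part u) (hg : g ∈ D.part u') :
    D.homog u f * D.homog u' g = D.homog (u + u') (f * g) := by
  apply Subtype.ext
  rw [MulMemClass.coe_mul, coe_homog hf, coe_homog hg, coe_homog (D.mul_mem_part hf hg),
    AddMonoidAlgebra.single_mul_single]

theorem homog_add {u : Fin k → ℤ} {f g : RatFunc K} (hf : f ∈ D.part u) (hg : g ∈ D.part u) :
    D.homog u f + D.homog u g = D.homog u (f + g) := by
  apply Subtype.ext
  rw [AddMemClass.coe_add, coe_homog hf, coe_homog hg, coe_homog (add_mem hf hg),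
    AddMonoidAlgebra.single_add]

theorem homog_smul {u : Fin k → ℤ} {f : RatFunc K} (hf : f ∈ D.part u) (c : K) :
    D.homog u (c • f) = c • D.homog u f := by
  apply Subtype.ext
  rw [Subalgebra.coe_smul, coe_homog hf, coe_homog (Submodule.smul_mem _ c hf),
    AddMonoidAlgebra.smul_single]

theorem homog_ne_zero {u : Fin k → ℤ} {f : RatFunc K} (hf : f ∈ D.part u) (hf0 : f ≠ 0) :
    D.homog u f ≠ 0 := fun h => by
  have := congrArg Subtype.val h
  rw [coe_homog hf] at this
  exact hf0 (AddMonoidAlgebra.single_eq_zero.mp this)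

theorem one_mem_part : (1 : RatFunc K) ∈ D.part 0 := by
  simpa using D.algebraMap_mem_part 1

theorem homog_zero_one : D.homog 0 1 = 1 := by
  apply Subtype.ext
  rw [coe_homog one_mem_part]
  rfl

theorem component_eq_homog (F : D.coordinateRing) (u : Fin k → ℤ) :
    D.component F u = D.homog u (F.1.coeff u) := by
  apply Subtype.ext
  rw [coe_homog (F.2 u)]
  rfl

theorem sum_component (F : D.coordinateRing) :
    ∑ u ∈ F.1.coeff.support, D.component F u = F := by
  apply Subtype.ext
  rw [AddSubmonoidClass.coe_finsetSum]
  exact F.1.sum_coeff_single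

variable {v : AddValuation D.coordinateRing (WithTop (LexInt r))}

theorem exists_val (hv : IsKValuation K v) {f : D.coordinateRing} (hf : f ≠ 0) :
    ∃ g : LexInt r, v f = (g : WithTop (LexInt r)) := by
  obtain ⟨g, hg⟩ := WithTop.ne_top_iff_exists.mp fun h => hf (hv.eq_zero_of_top f h)
  exact ⟨g, hg.symm⟩

/-- `γ` is the value of `g χ^w` for the extension of `v` to the fraction field. -/
def IsValueAt (v : AddValuation D.coordinateRing (WithTop (LexInt r))) (w : Fin k → ℤ)
    (g : RatFunc K) (γ : LexInt r) : Prop :=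
  ∀ (u : Fin k → ℤ) (b : RatFunc K), b ≠ 0 → b ∈ D.part u → g * b ∈ D.part (w + u) →
    v (D.homog (w + u) (g * b)) = v (D.homog u b) + (γ : WithTop (LexInt r))

/-- Cross-multiplying two presentations of g χ^w as a quotient shows that the difference of values
does not depend on the presentation. -/
theorem exists_isValueAt [IsAlgClosed K] (hD : D.IsProper) (hv : IsKValuation K v)
    (w : Fin k → ℤ) {g : RatFunc K} (hg : g ≠ 0) : ∃ γ, IsValueAt v w g γ := by
  obtain ⟨u, b, hb0, hb, hgb⟩ := D.exists_mem_part hD w hg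
  obtain ⟨x, hx⟩ := exists_val hv (homog_ne_zero hb hb0)
  obtain ⟨y, hy⟩ := exists_val hv (homog_ne_zero hgb (mul_ne_zero hg hb0))
  refine ⟨y - x, fun u' b' hb0' hb' hgb' => ?_⟩
  have h1 : D.homog (w + u') (g * b') * D.homog u b = D.homog (w + u) (g * b) * D.homog u' b' := by
    rw [homog_mul hgb' hb, homog_mul hgb hb']
    congr 1
    · abel
    · ring
  have h2 := congrArg v h1
  obtain ⟨x', hx'⟩ := exists_val hv (homog_ne_zero hb' hb0')
  obtain ⟨y', hy'⟩ := exists_val hv (homog_ne_zero hgb' (mul_ne_zero hg hb0'))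
  rw [v.map_mul, v.map_mul, hx, hy, hx', hy', ← WithTop.coe_add, ← WithTop.coe_add,
    WithTop.coe_inj] at h2
  rw [hx', hy', ← WithTop.coe_add, WithTop.coe_inj]
  rw [eq_sub_of_add_eq h2]
  abel

open Classical in
/-- The value of `g χ^w` for the extension of `v` to the fraction field. -/
noncomputable def valueAt (v : AddValuation D.coordinateRing (WithTop (LexInt r)))
    (w : Fin k → ℤ) (g : RatFunc K) : LexInt r :=
  if h : ∃ γ, IsValueAt v w g γ then h.choose else 0

section ValueAt

variable [IsAlgClosed K] (hD : D.IsProper) (hv : IsKValuation K v)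
include hD hv

theorem valueAt_spec (w : Fin k → ℤ) {g : RatFunc K} (hg : g ≠ 0) :
    IsValueAt v w g (valueAt v w g) := by
  have h := exists_isValueAt hD hv w hg
  rw [valueAt, dif_pos h]
  exact h.choose_spec

theorem valueAt_mul (w w' : Fin k → ℤ) {g g' : RatFunc K} (hg : g ≠ 0) (hg' : g' ≠ 0) :
    valueAt v (w + w') (g * g') = valueAt v w g + valueAt v w' g' := by
  obtain ⟨u, b, hb0, hb, hgb⟩ := D.exists_mem_part hD w hg
  obtain ⟨u', b', hb0', hb', hgb'⟩ := D.exists_mem_part hD w' hg'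
  have e1 : w + w' + (u + u') = (w + u) + (w' + u') := by abel
  have e2 : g * g' * (b * b') = (g * b) * (g' * b') := by ring
  have h := valueAt_spec hD hv (w + w') (mul_ne_zero hg hg') (u + u') (b * b')
    (mul_ne_zero hb0 hb0') (D.mul_mem_part hb hb') (by
      rw [e1, e2]; exact D.mul_mem_part hgb hgb')
  rw [e1, e2, ← homog_mul hgb hgb', ← homog_mul hb hb', v.map_mul, v.map_mul,
    valueAt_spec hD hv w hg u b hb0 hb hgb, valueAt_spec hD hv w' hg' u' b' hb0' hb' hgb'] at h
  obtain ⟨x, hx⟩ := exists_val hv (homog_ne_zero hb hb0)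
  obtain ⟨x', hx'⟩ := exists_val hv (homog_ne_zero hb' hb0')
  rw [hx, hx'] at h
  simp only [← WithTop.coe_add, WithTop.coe_inj] at h
  have h' : x + x' + (valueAt v w g + valueAt v w' g')
      = x + x' + valueAt v (w + w') (g * g') := by
    rw [← h]; abel
  exact (add_left_cancel h').symm

theorem valueAt_C {c : K} (hc : c ≠ 0) : valueAt v 0 (RatFunc.C c) = 0 := by
  have hc' : (RatFunc.C c : RatFunc K) ≠ 0 := by simpa using hc
  have hm : RatFunc.C c * 1 ∈ D.part (0 + 0) := by
    simpa using D.algebraMap_mem_part c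
  have h := valueAt_spec hD hv 0 hc' 0 1 one_ne_zero one_mem_part hm
  have e : D.homog (0 + 0) (RatFunc.C c * 1) = algebraMap K _ c := by
    apply Subtype.ext
    rw [coe_homog hm, mul_one, add_zero]
    rfl
  rw [e, hv.map_const c hc, homog_zero_one, v.map_one, zero_add] at h
  exact_mod_cast h.symm

theorem val_homog {u : Fin k → ℤ} {f : RatFunc K} (hf : f ∈ D.part u) (hf0 : f ≠ 0) :
    v (D.homog u f) = (valueAt v u f : WithTop (LexInt r)) := by
  have h := valueAt_spec hD hv u hf0 0 1 one_ne_zero one_mem_part (by simpa using hf)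
  rwa [homog_zero_one, v.map_one, zero_add, add_zero, mul_one] at h

/-- Multiplying by a common denominator b b' moves the inequality into a single graded piece of R_X.
-/
theorem min_valueAt_le {g g' : RatFunc K} (hg : g ≠ 0) (hg' : g' ≠ 0) (h0 : g + g' ≠ 0) :
    min (valueAt v 0 g) (valueAt v 0 g') ≤ valueAt v 0 (g + g') := by
  obtain ⟨u, b, hb0, hb, hgb⟩ := D.exists_mem_part hD 0 hg
  obtain ⟨u', b', hb0', hb', hgb'⟩ := D.exists_mem_part hD 0 hg'
  have hbb := D.mul_mem_part hb hb'
  have hbb0 := mul_ne_zero hb0 hb0'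
  have h1 : g * (b * b') ∈ D.part (0 + (u + u')) := by
    have := D.mul_mem_part hgb hb'
    rwa [add_assoc, mul_assoc] at this
  have h2 : g' * (b * b') ∈ D.part (0 + (u + u')) := by
    have := D.mul_mem_part hb hgb'
    rw [show u + (0 + u') = 0 + (u + u') by abel] at this
    rwa [show b * (g' * b') = g' * (b * b') by ring] at this
  have h3 : (g + g') * (b * b') ∈ D.part (0 + (u + u')) := by
    rw [add_mul]; exact add_mem h1 h2
  have hs := v.map_add (D.homog (0 + (u + u')) (g * (b * b')))
    (D.homog (0 + (u + u')) (g' * (b * b')))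
  rw [homog_add h1 h2, ← add_mul, valueAt_spec hD hv 0 hg _ _ hbb0 hbb h1,
    valueAt_spec hD hv 0 hg' _ _ hbb0 hbb h2, valueAt_spec hD hv 0 h0 _ _ hbb0 hbb h3] at hs
  obtain ⟨x, hx⟩ := exists_val hv (homog_ne_zero hbb hbb0)
  rw [hx] at hs
  simp only [← WithTop.coe_add, ← WithTop.coe_min, WithTop.coe_le_coe] at hs
  rw [min_add_add_left] at hs
  exact le_of_add_le_add_left hs

end ValueAt

end PolyhedralDivisor

/-- Over an algebraically closed field, every valuation of `K(t)` is a multiple of the order at a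
point. -/
theorem exists_ord_smul {K : Type*} [Field K] [IsAlgClosed K] {Γ : Type*} [AddCommGroup Γ]
    [LinearOrder Γ] [IsOrderedAddMonoid Γ] (w : RatFunc K → Γ)
    (hmul : ∀ f g, f ≠ 0 → g ≠ 0 → w (f * g) = w f + w g)
    (hadd : ∀ f g, f ≠ 0 → g ≠ 0 → f + g ≠ 0 → min (w f) (w g) ≤ w (f + g))
    (hC : ∀ c : K, c ≠ 0 → w (RatFunc.C c) = 0) :
    ∃ (P : OnePoint K) (γ : Γ), 0 ≤ γ ∧ ∀ g, g ≠ 0 → w g = ordAt P g • γ := by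
  classical
  have hinv : ∀ f, f ≠ 0 → w f⁻¹ = -w f := fun f hf => by
    have h1 : w 1 = 0 := by simpa using hC 1 one_ne_zero
    have := hmul f f⁻¹ hf (inv_ne_zero hf)
    rw [mul_inv_cancel₀ hf, h1] at this
    exact eq_neg_of_add_eq_zero_right this.symm
  -- Both sides are homomorphisms that vanish on constants, so it suffices to compare them on the X
  -- - c.
  have ext : ∀ (P : OnePoint K) (γ : Γ),
      (∀ c : K, w (RatFunc.X - RatFunc.C c) = ordAt P (RatFunc.X - RatFunc.C c) • γ) →
      ∀ g, g ≠ 0 → w g = ordAt P g • γ := by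
    intro P γ h g hg
    refine ratFunc_induction (p := fun g => w g = ordAt P g • γ) (fun c hc => ?_) h
      (fun f g hf hg h1 h2 => ?_) (fun f hf h => ?_) g hg
    · rw [hC c hc, ordAt_C, zero_smul]
    · rw [hmul f g hf hg, h1, h2, ordAt_mul P hf hg, add_smul]
    · rw [hinv f hf, h, ordAt_inv P hf, neg_smul]
  have hshift : ∀ a b : K, a ≠ b → min (w (RatFunc.X - RatFunc.C a)) 0
      ≤ w (RatFunc.X - RatFunc.C b) := fun a b hab => by
    have hne : (RatFunc.C (a - b) : RatFunc K) ≠ 0 := by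
      rw [Ne, map_eq_zero]; exact sub_ne_zero.mpr hab
    have e : RatFunc.X - RatFunc.C a + RatFunc.C (a - b) = RatFunc.X - RatFunc.C b := by
      rw [map_sub]; ring
    have := hadd (RatFunc.X - RatFunc.C a) (RatFunc.C (a - b)) (X_sub_C_ne_zero a) hne
      (by rw [e]; exact X_sub_C_ne_zero b)
    rwa [e, hC _ (sub_ne_zero.mpr hab)] at this
  have hconst : ∀ a b : K, a ≠ b → min (w (RatFunc.X - RatFunc.C a)) (w (RatFunc.X - RatFunc.C b))
      ≤ 0 := fun a b hab => by
    have hne : (RatFunc.C (b - a) : RatFunc K) ≠ 0 := by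
      rw [Ne, map_eq_zero]; exact sub_ne_zero.mpr hab.symm
    have hneg : w (-(RatFunc.X - RatFunc.C b)) = w (RatFunc.X - RatFunc.C b) := by
      have := hmul (RatFunc.C (-1)) (RatFunc.X - RatFunc.C b) (by simp) (X_sub_C_ne_zero b)
      rwa [hC _ (by simp), zero_add, map_neg, map_one, neg_one_mul] at this
    have e : RatFunc.X - RatFunc.C a + -(RatFunc.X - RatFunc.C b) = RatFunc.C (b - a) := by
      rw [map_sub]; ring
    have := hadd (RatFunc.X - RatFunc.C a) (-(RatFunc.X - RatFunc.C b)) (X_sub_C_ne_zero a)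
      (neg_ne_zero.mpr (X_sub_C_ne_zero b)) (by rw [e]; exact hne)
    rwa [e, hC _ (sub_ne_zero.mpr hab.symm), hneg] at this
  -- If some X - a has positive value, the other X - c differ from it by nonzero constants and have
  -- value 0, so P = a. If some value is negative, all X - c share it and P = ∞. Otherwise w is
  -- trivial and γ = 0 works at any point.
  by_cases hpos : ∃ a : K, 0 < w (RatFunc.X - RatFunc.C a)
  · obtain ⟨a, ha⟩ := hpos
    refine ⟨a, _, ha.le, ext _ _ fun c => ?_⟩
    rw [ordAt_X_sub_C]
    by_cases hc : a = c
    · subst hc; simp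
    · have h1 := hshift a c hc
      have h2 := hconst a c hc
      rw [min_eq_right ha.le] at h1
      have h3 := (min_le_iff.mp h2).resolve_left ha.not_ge
      simp [hc, le_antisymm h3 h1]
  · push Not at hpos
    by_cases hneg : ∃ a : K, w (RatFunc.X - RatFunc.C a) < 0
    · obtain ⟨a, ha⟩ := hneg
      refine ⟨OnePoint.infty, -w (RatFunc.X - RatFunc.C a), by simpa using ha.le,
        ext _ _ fun c => ?_⟩
      rw [ordAt_X_sub_C]
      have key : w (RatFunc.X - RatFunc.C c) = w (RatFunc.X - RatFunc.C a) := by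
        by_cases hc : a = c
        · rw [hc]
        · have h1 := hshift a c hc
          have h2 := hshift c a (Ne.symm hc)
          rw [min_eq_left ha.le] at h1
          rw [min_eq_left (hpos c)] at h2
          exact le_antisymm h2 h1
      simp [key]
    · push Not at hneg
      refine ⟨OnePoint.infty, 0, le_rfl, ext _ _ fun c => ?_⟩
      rw [smul_zero]
      exact le_antisymm (hpos c) (hneg c)

namespace PolyhedralDivisor

variable {K : Type*} [Field K] {k r : ℕ} {D : PolyhedralDivisor K k}
  {v : AddValuation D.coordinateRing (WithTop (LexInt r))}

/-- The values of a `K`-valuation on the homogeneous elements of the coordinate ring. -/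
theorem exists_val_homog_eq [IsAlgClosed K] (hD : D.IsProper) (hv : IsKValuation K v) :
    ∃ (P : OnePoint K) (γ : LexInt r) (l : (Fin k → ℤ) →+ LexInt r), 0 ≤ γ ∧
      D.RestrictsToOrd v P γ ∧
      ∀ (u : Fin k → ℤ) (f : RatFunc K), f ∈ D.part u → f ≠ 0 →
        v (D.homog u f) = ((ordAt P f • γ + l u : LexInt r) : WithTop (LexInt r)) := by
  obtain ⟨P, γ, hγ, hw⟩ := exists_ord_smul (valueAt v 0)
    (fun f g hf hg => by simpa using valueAt_mul hD hv 0 0 hf hg)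
    (fun f g hf hg h => min_valueAt_le hD hv hf hg h) (fun c hc => valueAt_C hD hv hc)
  -- The homomorphism l sends u to the value of χ^u, and f χ^u is the product of f and χ^u.
  refine ⟨P, γ, AddMonoidHom.mk' (fun u => valueAt v u 1) fun a b => by
    simpa using valueAt_mul hD hv a b one_ne_zero one_ne_zero, hγ, fun g hg => ?_,
    fun u f hf hf0 => ?_⟩
  · obtain ⟨u, b, hb0, hb, hgb⟩ := D.exists_mem_part hD 0 hg
    refine ⟨D.homog (0 + u) (g * b), D.homog u b, homog_ne_zero hgb (mul_ne_zero hg hb0),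
      homog_ne_zero hb hb0, ?_, ?_⟩
    · rw [coe_homog hgb, coe_homog hb, AddMonoidAlgebra.single_mul_single]
    · rw [valueAt_spec hD hv 0 hg u b hb0 hb hgb, hw g hg]
  · rw [val_homog hD hv hf hf0]
    have := valueAt_mul hD hv 0 u hf0 one_ne_zero
    rw [zero_add, mul_one, hw f hf0] at this
    rw [this]
    rfl

end PolyhedralDivisor
end TVar

namespace TVar

/-! ### Krull dimension -/

/-- Lying over provides a prime above the bottom of a chain, and going up lifts the rest. -/
theorem ringKrullDim_le_of_isIntegral {S R : Type*} [CommRing S] [CommRing R] [Algebra S R]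
    [IsDomain R] [Algebra.IsIntegral S R] (hinj : Function.Injective (algebraMap S R)) :
    ringKrullDim S ≤ ringKrullDim R := by
  refine iSup_le fun l => ?_
  obtain ⟨P, hP, hPl⟩ := Ideal.exists_ideal_over_prime_of_isIntegral_of_isDomain (S := R)
    (RelSeries.head l).asIdeal (by
      rw [(RingHom.injective_iff_ker_eq_bot _).mp hinj]; exact bot_le)
  have : P.LiesOver (RelSeries.head l).asIdeal := ⟨hPl.symm⟩
  obtain ⟨L, hL, -, -⟩ := Ideal.exists_ltSeries_of_hasGoingUp l P
  rw [← hL]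
  exact Order.LTSeries.length_le_krullDim L

/-- By Noether normalisation R is integral over a polynomial ring in s variables. Here s is the
transcendence degree of R and at most its dimension. -/
theorem card_le_ringKrullDim {K R ι : Type*} [Field K] [CommRing R] [IsDomain R] [Algebra K R]
    [Algebra.FiniteType K R] [Finite ι] {x : ι → R} (hx : AlgebraicIndependent K x) :
    (Nat.card ι : WithBot ℕ∞) ≤ ringKrullDim R := by
  obtain ⟨s, g, hinj, hint⟩ := exists_integral_inj_algHom_of_fg K R
  let _ : Algebra (MvPolynomial (Fin s) K) R := g.toRingHom.toAlgebra
  have : IsScalarTower K (MvPolynomial (Fin s) K) R :=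
    IsScalarTower.of_algebraMap_eq fun c => (g.commutes c).symm
  have : Algebra.IsIntegral (MvPolynomial (Fin s) K) R := ⟨hint⟩
  have : FaithfulSMul (MvPolynomial (Fin s) K) R :=
    (faithfulSMul_iff_algebraMap_injective _ _).mpr hinj
  have h1 := ringKrullDim_le_of_isIntegral (S := MvPolynomial (Fin s) K) (R := R) hinj
  rw [MvPolynomial.ringKrullDim_of_isNoetherianRing, ringKrullDim_eq_zero_of_field, zero_add,
    Nat.card_fin] at h1
  refine le_trans ?_ h1
  have h2 := hx.lift_cardinalMk_le_trdeg
  have h3 := lift_trdeg_add_eq K (MvPolynomial (Fin s) K) R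
  rw [MvPolynomial.trdeg_of_isDomain, trdeg_eq_zero, Cardinal.mk_fin,
    Cardinal.lift_natCast, Cardinal.lift_natCast, Cardinal.lift_zero, add_zero, eq_comm,
    Cardinal.lift_eq_nat_iff] at h3
  rw [h3, Cardinal.lift_natCast, ← Nat.cast_card (α := ι), Cardinal.lift_natCast,
    Nat.cast_le] at h2
  exact_mod_cast h2

/-- Terms with pairwise distinct values cannot cancel. -/
theorem map_sum_of_injOn {R Γ ι : Type*} [Ring R] [LinearOrderedAddCommMonoidWithTop Γ]
    (v : AddValuation R Γ) (s : Finset ι) (f : ι → R) (h : Set.InjOn (fun i => v (f i)) s) :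
    v (∑ i ∈ s, f i) = s.inf fun i => v (f i) := by
  classical
  induction s using Finset.induction_on with
  | empty => simp
  | insert a s ha ih =>
    have ih' := ih (h.mono (by simp))
    rw [Finset.sum_insert ha, Finset.inf_insert, ← ih']
    rcases s.eq_empty_or_nonempty with rfl | hs
    · simp
    refine v.map_add_of_distinct_val fun heq => ?_
    rw [ih'] at heq
    obtain ⟨b, hb, hb'⟩ := Finset.exists_mem_eq_inf s hs fun i => v (f i)
    rw [hb'] at heq
    have := h (by simp) (by simp [hb]) heq
    exact ha (this ▸ hb)

/-! ### Algebraically independent homogeneous elements -/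

namespace PolyhedralDivisor

variable {K : Type*} [Field K] {k : ℕ} {D : PolyhedralDivisor K k}

/-- The images of the monomials `x^α` under `x_j ↦ f_j χ^{u_j}`, for multiplicative families
`α ↦ U α` and `α ↦ F α`. -/
theorem aeval_monomial_eq {ι : Type*} (U : (ι →₀ ℕ) →+ (Fin k → ℤ)) (F : (ι →₀ ℕ) → RatFunc K)
    (h0 : F 0 = 1) (hadd : ∀ α β, F (α + β) = F α * F β) (hF : ∀ α, F α ∈ D.part (U α))
    {x : ι → D.coordinateRing}
    (hx : ∀ j, x j = D.homog (U (Finsupp.single j 1)) (F (Finsupp.single j 1)))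
    (α : ι →₀ ℕ) (c : K) :
    MvPolynomial.aeval x (MvPolynomial.monomial α c) = c • D.homog (U α) (F α) := by
  have h1 : MvPolynomial.aeval x (MvPolynomial.monomial α (1 : K)) = D.homog (U α) (F α) := by
    induction α using Finsupp.induction_linear with
    | zero => simp [h0, homog_zero_one]
    | add α β ha hb =>
      rw [← one_mul (1 : K), ← MvPolynomial.monomial_mul, map_mul, ha, hb,
        homog_mul (hF α) (hF β), map_add, hadd]
    | single j n =>
      induction n with
      | zero => simp [h0, homog_zero_one]
      | succ n ih =>
        rw [Finsupp.single_add, ← one_mul (1 : K), ← MvPolynomial.monomial_mul, map_mul, ih,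
          map_add, hadd, ← homog_mul (hF _) (hF _), ← hx]
        congr 1
        exact MvPolynomial.aeval_X x j
  rw [← mul_one c, ← smul_eq_mul, ← MvPolynomial.smul_monomial, map_smul, h1, smul_eq_mul, mul_one]

theorem coeff_aeval {ι : Type*} (U : (ι →₀ ℕ) →+ (Fin k → ℤ)) (F : (ι →₀ ℕ) → RatFunc K)
    (h0 : F 0 = 1) (hadd : ∀ α β, F (α + β) = F α * F β) (hF : ∀ α, F α ∈ D.part (U α))
    {x : ι → D.coordinateRing}
    (hx : ∀ j, x j = D.homog (U (Finsupp.single j 1)) (F (Finsupp.single j 1)))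
    (p : MvPolynomial ι K) (u : Fin k → ℤ) :
    (MvPolynomial.aeval x p).1.coeff u
      = ∑ α ∈ p.support with U α = u, p.coeff α • F α := by
  classical
  conv_lhs => rw [p.as_sum, map_sum]
  simp only [aeval_monomial_eq U F h0 hadd hF hx]
  rw [AddSubmonoidClass.coe_finsetSum, AddMonoidAlgebra.coeff_sum, Finsupp.finsetSum_apply,
    Finset.sum_filter]
  refine Finset.sum_congr rfl fun α _ => ?_
  rw [Subalgebra.coe_smul, AddMonoidAlgebra.coeff_smul, coe_homog (hF α),
    AddMonoidAlgebra.coeff_single, Finsupp.smul_apply, Finsupp.single_apply]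
  split_ifs <;> simp

theorem ordV_smul (P : OnePoint K) {c : K} (hc : c ≠ 0) (f : RatFunc K) :
    ordV P (c • f) = ordV P f := by
  rw [RatFunc.smul_eq_C_mul, (ordV P).map_mul, ordV_of_ne_zero P (by simpa using hc), ordAt_C]
  simp

/-- In the degree u of any term of a relation, the terms of that degree have pairwise distinct
orders at P, so they cannot sum to 0. -/
theorem algebraicIndependent_of_injective {ι : Type*} (P : OnePoint K)
    (U : (ι →₀ ℕ) →+ (Fin k → ℤ)) (F : (ι →₀ ℕ) → RatFunc K)
    (h0 : F 0 = 1) (hadd : ∀ α β, F (α + β) = F α * F β) (hF : ∀ α, F α ∈ D.part (U α))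
    (hF0 : ∀ α, F α ≠ 0) {x : ι → D.coordinateRing}
    (hx : ∀ j, x j = D.homog (U (Finsupp.single j 1)) (F (Finsupp.single j 1)))
    (hinj : Function.Injective fun α => (ordAt P (F α), U α)) : AlgebraicIndependent K x := by
  classical
  rw [algebraicIndependent_iff]
  intro p hp
  by_contra hp0
  obtain ⟨α, hα⟩ := Finset.nonempty_of_ne_empty (mt MvPolynomial.support_eq_empty.mp hp0)
  have h1 := coeff_aeval U F h0 hadd hF hx p (U α)
  have h2 : ∀ β ∈ p.support.filter (fun β => U β = U α),
      ordV P (p.coeff β • F β) = (ordAt P (F β) : WithTop ℤ) := fun β hβ => by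
    rw [ordV_smul P (MvPolynomial.mem_support_iff.mp (Finset.mem_filter.mp hβ).1),
      ordV_of_ne_zero P (hF0 β)]
  have h3 := map_sum_of_injOn (ordV P) (p.support.filter fun β => U β = U α)
    (fun β => p.coeff β • F β) fun β hβ β' hβ' h => by
      simp only [h2 β hβ, h2 β' hβ', WithTop.coe_inj] at h
      exact hinj (Prod.ext h ((Finset.mem_filter.mp hβ).2.trans (Finset.mem_filter.mp hβ').2.symm))
  rw [← h1, hp] at h3
  have h4 := Finset.inf_le (f := fun β => ordV P (p.coeff β • F β))
    (Finset.mem_filter.mpr ⟨hα, rfl⟩ : α ∈ p.support.filter fun β => U β = U α)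
  rw [← h3] at h4
  have h5 : (0 : D.coordinateRing).1.coeff (U α) = 0 := rfl
  rw [h5, (ordV P).map_zero, h2 α (Finset.mem_filter.mpr ⟨hα, rfl⟩)] at h4
  exact absurd h4 (by simp)

end PolyhedralDivisor

end TVar

namespace TVar

theorem exists_ordAt_eq_one {K : Type*} [Field K] (P : OnePoint K) :
    ∃ g : RatFunc K, g ≠ 0 ∧ ordAt P g = 1 := by
  induction P using OnePoint.rec with
  | infty =>
    refine ⟨(RatFunc.X - RatFunc.C 0)⁻¹, inv_ne_zero (X_sub_C_ne_zero 0), ?_⟩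
    rw [ordAt_inv _ (X_sub_C_ne_zero 0), ordAt_X_sub_C]
    simp
  | coe c =>
    refine ⟨RatFunc.X - RatFunc.C c, X_sub_C_ne_zero c, ?_⟩
    rw [ordAt_X_sub_C]
    simp

namespace PolyhedralDivisor

variable {K : Type*} [Field K] {k : ℕ} (D : PolyhedralDivisor K k)

/-- The bidegree `(ord_P f, u)` of a homogeneous element `f χ^u`. -/
noncomputable def bidegree (P : OnePoint K) (u : Fin k → ℤ) (f : RatFunc K) : ℚ × (Fin k → ℚ) :=
  ((ordAt P f : ℚ), fun j => (u j : ℚ))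

theorem bidegree_mul (P : OnePoint K) (u u' : Fin k → ℤ) {f g : RatFunc K} (hf : f ≠ 0)
    (hg : g ≠ 0) : bidegree P (u + u') (f * g) = bidegree P u f + bidegree P u' g := by
  ext <;> simp [bidegree, ordAt_mul P hf hg]

/-- Every g χ^w is a quotient of homogeneous elements, so its bidegree is a difference of two from
the set. A g of order 1 at P together with the characters χ^{e_j} gives a basis. -/
theorem span_bidegree [IsAlgClosed K] (hD : D.IsProper) (P : OnePoint K) :
    Submodule.span ℚ {x | ∃ u f, f ∈ D.part u ∧ f ≠ 0 ∧ x = bidegree P u f} = ⊤ := by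
  classical
  have hmem : ∀ (w : Fin k → ℤ) (g : RatFunc K), g ≠ 0 → bidegree P w g ∈
      Submodule.span ℚ {x | ∃ u f, f ∈ D.part u ∧ f ≠ 0 ∧ x = bidegree P u f} := by
    intro w g hg
    obtain ⟨u, b, hb0, hb, hgb⟩ := D.exists_mem_part hD w hg
    have h : bidegree P w g = bidegree P (w + u) (g * b) - bidegree P u b := by
      rw [bidegree_mul P w u hg hb0, add_sub_cancel_right]
    rw [h]
    exact sub_mem (Submodule.subset_span ⟨_, _, hgb, mul_ne_zero hg hb0, rfl⟩)
      (Submodule.subset_span ⟨_, _, hb, hb0, rfl⟩)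
  rw [eq_top_iff]
  rintro ⟨a, x⟩ -
  obtain ⟨g, hg0, hg⟩ := exists_ordAt_eq_one P
  have h : (a, x) = a • bidegree P (0 : Fin k → ℤ) g
      + ∑ j, x j • bidegree P (Pi.single j 1 : Fin k → ℤ) (1 : RatFunc K) := by
    ext i
    · simp [bidegree, hg, ordAt_one, Prod.fst_sum]
    · simp [bidegree, Prod.snd_sum, Finset.sum_apply, Pi.single_apply]
  rw [h]
  exact add_mem (Submodule.smul_mem _ _ (hmem _ _ hg0))
    (Submodule.sum_mem _ fun j _ => Submodule.smul_mem _ _ (hmem _ _ one_ne_zero))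

/-- Homogeneous elements whose bidegrees form a ℚ-basis of ℚ × ℚᵏ will do: bidegrees add under
products, so distinct monomials in them have distinct bidegrees. -/
theorem exists_algebraicIndependent [IsAlgClosed K] (hD : D.IsProper) :
    ∃ (ι : Type) (_ : Finite ι) (x : ι → D.coordinateRing), Nat.card ι = k + 1 ∧
      AlgebraicIndependent K x := by
  classical
  let P : OnePoint K := OnePoint.infty
  obtain ⟨b, hbS, hspan, hli⟩ := exists_linearIndependent ℚ
    {x | ∃ u f, f ∈ D.part u ∧ f ≠ 0 ∧ x = bidegree P u f}
  rw [D.span_bidegree hD P] at hspan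
  choose u f hf hf0 huf using fun j : b => hbS j.2
  let B := Module.Basis.mk hli (by rw [Subtype.range_coe_subtype, Set.ofPred_mem_eq, hspan])
  have hfin : Finite b := Module.Finite.finite_basis B
  let U : (b →₀ ℕ) →+ (Fin k → ℤ) := (Finsupp.linearCombination ℕ u).toAddMonoidHom
  let F : (b →₀ ℕ) → RatFunc K := fun α => α.prod fun j n => f j ^ n
  have h0 : F 0 = 1 := Finsupp.prod_zero_index
  have hadd : ∀ α β, F (α + β) = F α * F β := fun α β =>
    Finsupp.prod_add_index' (fun _ => pow_zero _) fun _ _ _ => pow_add _ _ _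
  have hU1 : ∀ j, U (Finsupp.single j 1) = u j := fun j => by
    simp [U]
  have hF1 : ∀ j, F (Finsupp.single j 1) = f j := fun j => by
    simp [F]
  have hFne : ∀ α, F α ≠ 0 := fun α =>
    Finset.prod_ne_zero_iff.mpr fun j _ => pow_ne_zero _ (hf0 j)
  have hFmem : ∀ α, F α ∈ D.part (U α) := fun α => by
    induction α using Finsupp.induction_linear with
    | zero => rw [h0, map_zero]; exact one_mem_part
    | add α β ha hb => rw [hadd, map_add]; exact D.mul_mem_part ha hb
    | single j n =>
      induction n with
      | zero => rw [Finsupp.single_zero, h0, map_zero]; exact one_mem_part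
      | succ n ih =>
        rw [Finsupp.single_add, hadd, map_add]
        exact D.mul_mem_part ih (by rw [hU1, hF1]; exact hf j)
  have hdeg : ∀ α, bidegree P (U α) (F α) = Finsupp.linearCombination ℕ (Subtype.val : b → _) α := by
    have hz : bidegree P (0 : Fin k → ℤ) (1 : RatFunc K) = 0 := by
      ext <;> simp [bidegree, ordAt_one]
    intro α
    induction α using Finsupp.induction_linear with
    | zero => rw [h0, map_zero, map_zero, hz]
    | add α β ha hb => rw [hadd, map_add, bidegree_mul P _ _ (hFne α) (hFne β), ha, hb, map_add]
    | single j n =>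
      induction n with
      | zero => rw [Finsupp.single_zero, h0, map_zero, map_zero, hz]
      | succ n ih =>
        rw [Finsupp.single_add, hadd, map_add, bidegree_mul P _ _ (hFne _) (hFne _), ih, map_add,
          hU1, hF1, ← huf]
        simp
  have hli' : LinearIndependent ℕ (Subtype.val : b → ℚ × (Fin k → ℚ)) :=
    hli.restrict_scalars fun m n h => by simpa using h
  let e := Finite.equivFin b
  refine ⟨Fin (Nat.card b), inferInstance, fun i => D.homog (u (e.symm i)) (f (e.symm i)), ?_, ?_⟩
  · rw [Nat.card_fin, ← Module.finrank_eq_nat_card_basis B]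
    simp [add_comm]
  · refine AlgebraicIndependent.comp (x := fun j => D.homog (u j) (f j)) ?_ _ e.symm.injective
    refine algebraicIndependent_of_injective P U F h0 hadd hFmem hFne
      (fun j => by rw [hU1, hF1]) fun α β h => hli' ?_
    obtain ⟨h1, h2⟩ := Prod.ext_iff.mp h
    simp only at h1 h2
    rw [← hdeg, ← hdeg, bidegree, bidegree, h1, h2]

theorem le_ringKrullDim [IsAlgClosed K] (hD : D.IsProper)
    [Algebra.FiniteType K D.coordinateRing] :
    ((k + 1 : ℕ) : WithBot ℕ∞) ≤ ringKrullDim D.coordinateRing := by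
  obtain ⟨ι, _, x, hι, hx⟩ := D.exists_algebraicIndependent hD
  rw [← hι]
  exact card_le_ringKrullDim hx

end PolyhedralDivisor

/-! ### Semi-canonical presentations -/

namespace SemiCanonicalEmbedding

variable {K : Type*} [Field K] {k : ℕ} {D : PolyhedralDivisor K k}

/-- Every point of `ℙ¹` is a boundary point of some semi-canonical embedding. -/
theorem exists_Q_eq (D : PolyhedralDivisor K k) (P : OnePoint K) :
    ∃ (E : SemiCanonicalEmbedding D) (i : Fin (E.m + 1)), E.Q i = P := by
  classical
  -- Including 0 and ∞ guarantees two boundary points, that is m ≥ 1.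
  let T : Finset (OnePoint K) := D.finite_support.toFinset ∪ {P} ∪ {((0 : K) : OnePoint K), OnePoint.infty}
  have hT : 2 ≤ T.card := by
    rw [← Finset.card_pair (OnePoint.coe_ne_infty (0 : K))]
    exact Finset.card_le_card Finset.subset_union_right
  obtain ⟨m, hm⟩ : ∃ m, T.card = m + 1 := ⟨T.card - 1, by omega⟩
  let e : T ≃ Fin (m + 1) := T.equivFinOfCardEq hm
  let q : OnePoint K → K × K := fun P => P.elim (1, 0) fun c => (c, 1)
  have hq : ∀ P, q P ≠ 0 := fun P => by
    induction P using OnePoint.rec <;> simp [q]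
  have hqP : ∀ P, projPoint (q P) = P := fun P => by
    induction P using OnePoint.rec <;> simp [q, projPoint]
  let L : LineEmbedding D :=
    { m := m
      one_le_m := by omega
      p := fun i => q (e.symm i)
      p_ne_zero := fun i => hq _
      injective_point := fun i j h => by
        simp only [hqP] at h
        exact e.symm.injective (Subtype.ext h)
      support_subset := fun P hP => ⟨e ⟨P, by simp [T, hP]⟩, by simp [hqP]⟩ }
  obtain ⟨S, hS⟩ := L.dualMonoid_fg
  refine ⟨{ toLineEmbedding := L, gens := S, closure_gens := hS }, e ⟨P, by simp [T]⟩, ?_⟩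
  simp [LineEmbedding.Q, L, hqP]

variable (E : SemiCanonicalEmbedding D)

/-- The lattice point `(u, v)` with `π(x^α) = z^v χ^u`. -/
noncomputable def expo : (E.gens →₀ ℕ) →+ (Fin k → ℤ) × (Fin E.m → ℤ) :=
  (Finsupp.linearCombination ℕ fun b : E.gens => b.1).toAddMonoidHom

theorem expo_single (b : E.gens) : E.expo (Finsupp.single b 1) = b.1 := by simp [expo]

theorem exists_expo_eq {w : (Fin k → ℤ) × (Fin E.m → ℤ)} :
    w ∈ E.dualMonoid ↔ ∃ α, E.expo α = w := by
  rw [← E.closure_gens, ← Submodule.span_nat_eq_addSubmonoidClosure]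
  have h : (E.gens : Set ((Fin k → ℤ) × (Fin E.m → ℤ))) = Set.range fun b : E.gens => b.1 := by
    simp
  rw [Submodule.mem_toAddSubmonoid]
  conv_lhs => rw [h]
  rw [Finsupp.mem_span_range_iff_exists_finsupp]
  rfl

theorem expo_mem (α : E.gens →₀ ℕ) : E.expo α ∈ E.dualMonoid := E.exists_expo_eq.mpr ⟨α, rfl⟩

/-- The degree `u ∈ M` of `π(x^α)`. -/
noncomputable def expoU : (E.gens →₀ ℕ) →+ (Fin k → ℤ) := (AddMonoidHom.fst _ _).comp E.expo

/-- The rational function `z^v` with `π(x^α) = z^v χ^u`. -/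
noncomputable def expoF (α : E.gens →₀ ℕ) : RatFunc K := E.zMonomial (E.expo α).2

theorem expoF_zero : E.expoF 0 = 1 := by
  rw [expoF, map_zero]; exact E.zMonomial_zero

theorem expoF_add (α β : E.gens →₀ ℕ) : E.expoF (α + β) = E.expoF α * E.expoF β := by
  rw [expoF, map_add]; exact E.zMonomial_add _ _

theorem expoF_ne_zero (α : E.gens →₀ ℕ) : E.expoF α ≠ 0 := E.zMonomial_ne_zero _

theorem expoF_mem (α : E.gens →₀ ℕ) : E.expoF α ∈ D.part (E.expoU α) :=
  E.zMonomial_mem_part (E.expo_mem α)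

theorem generator_eq (b : E.gens) : E.generator b
    = D.homog (E.expoU (Finsupp.single b 1)) (E.expoF (Finsupp.single b 1)) := by
  apply Subtype.ext
  rw [PolyhedralDivisor.coe_homog (E.expoF_mem _), expoF, expoU, AddMonoidHom.comp_apply,
    expo_single]
  rfl

theorem presentation_monomial (α : E.gens →₀ ℕ) (c : K) :
    E.presentation (MvPolynomial.monomial α c) = c • D.homog (E.expoU α) (E.expoF α) :=
  PolyhedralDivisor.aeval_monomial_eq E.expoU E.expoF E.expoF_zero E.expoF_add E.expoF_mem
    E.generator_eq α c

theorem coeff_presentation (p : MvPolynomial E.gens K) (u : Fin k → ℤ) :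
    open Classical in (E.presentation p).1.coeff u
      = ∑ α ∈ p.support with E.expoU α = u, p.coeff α • E.expoF α := by
  classical
  exact (PolyhedralDivisor.coeff_aeval E.expoU E.expoF E.expoF_zero E.expoF_add E.expoF_mem
    E.generator_eq p u).trans (Finset.sum_congr (by congr) fun _ _ => rfl)

/-- Homogeneous elements have preimages whose monomials have the same degree, and orders at least
as large. -/
theorem exists_presentation_eq [IsAlgClosed K] {u : Fin k → ℤ} {f : RatFunc K}
    (hf : f ∈ D.part u) (i : Fin (E.m + 1)) :
    ∃ q : MvPolynomial E.gens K, E.presentation q = D.homog u f ∧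
      ∀ α ∈ q.support, E.expoU α = u ∧
        ordV (E.Q i) f ≤ (ordAt (E.Q i) (E.expoF α) : WithTop ℤ) := by
  classical
  have h := E.part_subset_span hf i
  -- The bound has to stay fixed during the induction over the span. Membership in the graded piece
  -- is carried along because `homog` takes the default value 0 outside it and is additive only
  -- inside.
  generalize ordV (E.Q i) f = a at h ⊢
  have key : f ∈ D.part u ∧ ∃ q : MvPolynomial E.gens K, E.presentation q = D.homog u f ∧
      ∀ α ∈ q.support, E.expoU α = u ∧
        a ≤ (ordAt (E.Q i) (E.expoF α) : WithTop ℤ) := by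
    clear hf
    induction h using Submodule.span_induction with
    | mem x hx =>
      obtain ⟨v, ⟨hv, hav⟩, rfl⟩ := hx
      obtain ⟨α, hα⟩ := E.exists_expo_eq.mp hv
      have hz : E.zMonomial v ∈ D.part u := E.zMonomial_mem_part (w := (u, v)) hv
      refine ⟨hz, MvPolynomial.monomial α 1, ?_, fun β hβ => ?_⟩
      · rw [presentation_monomial, one_smul, expoU, expoF, AddMonoidHom.comp_apply, hα]
        rfl
      · have := Finset.mem_singleton.mp (MvPolynomial.support_monomial_subset hβ)
        subst this
        rw [expoU, expoF, AddMonoidHom.comp_apply, hα]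
        exact ⟨rfl, hav⟩
    | zero =>
      refine ⟨zero_mem _, 0, ?_, by simp⟩
      apply Subtype.ext
      rw [PolyhedralDivisor.coe_homog (zero_mem _)]
      simp
    | add x y _ _ hx hy =>
      obtain ⟨hx, p, hp, hp'⟩ := hx
      obtain ⟨hy, q, hq, hq'⟩ := hy
      refine ⟨add_mem hx hy, p + q, by rw [map_add, hp, hq, PolyhedralDivisor.homog_add hx hy],
        fun α hα => ?_⟩
      rcases Finset.mem_union.mp (MvPolynomial.support_add hα) with h | h
      · exact hp' α h
      · exact hq' α h
    | smul c x _ hx =>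
      obtain ⟨hx, p, hp, hp'⟩ := hx
      exact ⟨Submodule.smul_mem _ c hx, c • p, by
        rw [map_smul, hp, PolyhedralDivisor.homog_smul hx],
        fun α hα => hp' α (MvPolynomial.support_smul hα)⟩
  exact key.2

theorem presentation_surjective [IsAlgClosed K] : Function.Surjective E.presentation := by
  intro F
  choose q hq _ using fun u => E.exists_presentation_eq (F.2 u) 0
  refine ⟨∑ u ∈ F.1.coeff.support, q u, ?_⟩
  rw [map_sum]
  simp only [hq]
  conv_rhs => rw [← PolyhedralDivisor.sum_component F]
  exact Finset.sum_congr rfl fun u _ => (PolyhedralDivisor.component_eq_homog F u).symm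

theorem finiteType [IsAlgClosed K] (E : SemiCanonicalEmbedding D) : Algebra.FiniteType K D.coordinateRing :=
  Algebra.FiniteType.of_surjective E.presentation E.presentation_surjective

end SemiCanonicalEmbedding

end TVar

namespace TVar

/-! ### Initial ideals -/

section Initial

variable {K : Type*} [Field K] {ι Γ : Type*} [LinearOrder Γ]

open Classical in
theorem coeff_initialForm (wt : (ι →₀ ℕ) → Γ) (f : MvPolynomial ι K) (β : ι →₀ ℕ) :
    (initialForm wt f).coeff β
      = if β ∈ f.support ∧ ∀ γ ∈ f.support, wt β ≤ wt γ then f.coeff β else 0 := by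
  rw [initialForm, MvPolynomial.coeff_sum]
  simp only [MvPolynomial.coeff_monomial]
  rw [Finset.sum_ite_eq']
  simp only [Finset.mem_filter]

theorem mem_support_initialForm {wt : (ι →₀ ℕ) → Γ} {f : MvPolynomial ι K} {β : ι →₀ ℕ} :
    β ∈ (initialForm wt f).support ↔ β ∈ f.support ∧ ∀ γ ∈ f.support, wt β ≤ wt γ := by
  classical
  rw [MvPolynomial.mem_support_iff, coeff_initialForm]
  constructor
  · intro h
    by_contra hn
    exact h (if_neg hn)
  · intro h
    rw [if_pos h]
    exact MvPolynomial.mem_support_iff.mp h.1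

theorem coeff_initialForm_of_mem {wt : (ι →₀ ℕ) → Γ} {f : MvPolynomial ι K} {β : ι →₀ ℕ}
    (h : β ∈ (initialForm wt f).support) : (initialForm wt f).coeff β = f.coeff β := by
  classical
  rw [coeff_initialForm, if_pos (mem_support_initialForm.mp h)]

/-- The device for producing elements of initial ideals: if p and q have the same image in R_X and q
has larger weights, then p is the initial form of p - q ∈ J. -/
theorem initialForm_sub {wt : (ι →₀ ℕ) → Γ} {p q : MvPolynomial ι K} {d : Γ} (hp0 : p ≠ 0)
    (hp : ∀ α ∈ p.support, wt α = d) (hq : ∀ α ∈ q.support, d < wt α) :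
    initialForm wt (p - q) = p := by
  classical
  have hpq : ∀ α ∈ p.support, q.coeff α = 0 := fun α hα => by
    by_contra h
    exact (hq α (MvPolynomial.mem_support_iff.mpr h)).ne' (hp α hα)
  have hsub : ∀ α ∈ p.support, α ∈ (p - q).support := fun α hα => by
    rw [MvPolynomial.mem_support_iff, MvPolynomial.coeff_sub, hpq α hα, sub_zero]
    exact MvPolynomial.mem_support_iff.mp hα
  have hle : ∀ γ ∈ (p - q).support, d ≤ wt γ := fun γ hγ => by
    rcases Finset.mem_union.mp (MvPolynomial.support_sub _ p q hγ) with h | h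
    · exact (hp γ h).ge
    · exact (hq γ h).le
  ext β
  rw [coeff_initialForm]
  by_cases hβ : β ∈ p.support
  · rw [if_pos ⟨hsub β hβ, fun γ hγ => by rw [hp β hβ]; exact hle γ hγ⟩, MvPolynomial.coeff_sub,
      hpq β hβ, sub_zero]
  · rw [MvPolynomial.notMem_support_iff.mp hβ, if_neg]
    rintro ⟨h1, h2⟩
    obtain ⟨α, hα⟩ := Finset.nonempty_of_ne_empty (mt MvPolynomial.support_eq_empty.mp hp0)
    have h3 := h2 α (hsub α hα)
    rw [hp α hα] at h3
    rcases Finset.mem_union.mp (MvPolynomial.support_sub _ p q h1) with h | h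
    · exact hβ h
    · exact (hq β h).not_ge h3

theorem initialForm_mem {wt : (ι →₀ ℕ) → Γ} {I : Ideal (MvPolynomial ι K)} {f : MvPolynomial ι K}
    (hf : f ∈ I) : initialForm wt f ∈ initialIdeal wt I :=
  Ideal.subset_span ⟨f, hf, rfl⟩

end Initial

/-! ### The initial ideal of J(L) at a boundary point -/

namespace SemiCanonicalEmbedding

variable {K : Type*} [Field K] {k : ℕ} {D : PolyhedralDivisor K k}
  (E : SemiCanonicalEmbedding D)

open Classical in
/-- The image in `K(ℙ¹)` of the sum of the terms of `p` whose exponents satisfy `S`. -/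
noncomputable def partialSum (S : (E.gens →₀ ℕ) → Prop) : MvPolynomial E.gens K →ₗ[K] RatFunc K :=
  (MvPolynomial.basisMonomials E.gens K).constr K fun α => if S α then E.expoF α else 0

theorem partialSum_monomial (S : (E.gens →₀ ℕ) → Prop) [DecidablePred S] (α : E.gens →₀ ℕ) (c : K) :
    E.partialSum S (MvPolynomial.monomial α c) = if S α then c • E.expoF α else 0 := by
  have h : MvPolynomial.monomial α c = c • MvPolynomial.basisMonomials E.gens K α := by
    rw [MvPolynomial.coe_basisMonomials, MvPolynomial.smul_monomial, smul_eq_mul, mul_one]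
  rw [h, map_smul, partialSum, Module.Basis.constr_basis]
  by_cases hS : S α <;> simp [hS]

theorem partialSum_apply (S : (E.gens →₀ ℕ) → Prop) [DecidablePred S] (p : MvPolynomial E.gens K) :
    E.partialSum S p = ∑ α ∈ p.support with S α, p.coeff α • E.expoF α := by
  conv_lhs => rw [p.as_sum, map_sum]
  simp only [partialSum_monomial]
  rw [Finset.sum_filter]

theorem coeff_presentation_eq_partialSum (p : MvPolynomial E.gens K) (u : Fin k → ℤ) :
    (E.presentation p).1.coeff u = E.partialSum (fun α => E.expoU α = u) p := by
  rw [coeff_presentation, partialSum_apply]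
/-- The exponents of the monomials of degree `u` and order `a` at the point `Q_i`. -/
def HasBidegree (i : Fin (E.m + 1)) (u : Fin k → ℤ) (a : ℤ) (α : E.gens →₀ ℕ) : Prop :=
  E.expoU α = u ∧ ordAt (E.Q i) (E.expoF α) = a

theorem hasBidegree_add (i : Fin (E.m + 1)) (u : Fin k → ℤ) (a : ℤ) (α β : E.gens →₀ ℕ) :
    E.HasBidegree i u a (β + α) ↔
      E.HasBidegree i (u - E.expoU β) (a - ordAt (E.Q i) (E.expoF β)) α := by
  rw [HasBidegree, HasBidegree, map_add, expoF_add,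
    ordAt_mul _ (E.expoF_ne_zero _) (E.expoF_ne_zero _), eq_sub_iff_add_eq', eq_sub_iff_add_eq']

/-- Multiplication by a monomial shifts bidegrees by its own; this makes `orderIdeal` closed under
multiplication. -/
theorem partialSum_monomial_mul (i : Fin (E.m + 1)) (u : Fin k → ℤ) (a : ℤ) (β : E.gens →₀ ℕ)
    (c : K) (g : MvPolynomial E.gens K) :
    E.partialSum (E.HasBidegree i u a) (MvPolynomial.monomial β c * g) =
      (c • E.expoF β) * E.partialSum
        (E.HasBidegree i (u - E.expoU β) (a - ordAt (E.Q i) (E.expoF β))) g := by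
  classical
  induction g using MvPolynomial.induction_on' with
  | monomial α e =>
    rw [MvPolynomial.monomial_mul, partialSum_monomial, partialSum_monomial, hasBidegree_add]
    split_ifs
    · rw [expoF_add, smul_mul_smul_comm]
    · rw [mul_zero]
  | add p q hp hq => rw [mul_add, map_add, hp, hq, map_add, mul_add]

/-- The ideal of the polynomials whose bihomogeneous components are mapped to elements of larger
order at `Q_i` than their monomials. -/
noncomputable def orderIdeal (i : Fin (E.m + 1)) : Ideal (MvPolynomial E.gens K) where
  carrier := {g | ∀ u (a : ℤ),
    (a : WithTop ℤ) < ordV (E.Q i) (E.partialSum (E.HasBidegree i u a) g)}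
  zero_mem' := fun u a => by rw [map_zero, (ordV (E.Q i)).map_zero]; exact WithTop.coe_lt_top a
  add_mem' := fun {f g} hf hg u a => by
    rw [map_add]
    exact (ordV (E.Q i)).map_lt_add (hf u a) (hg u a)
  smul_mem' := fun p g hg => by
    rw [smul_eq_mul]
    induction p using MvPolynomial.induction_on' with
    | monomial β c =>
      intro u a
      rw [partialSum_monomial_mul, (ordV (E.Q i)).map_mul]
      have h := hg (u - E.expoU β) (a - ordAt (E.Q i) (E.expoF β))
      by_cases hc : c = 0
      · simp [hc]
      rw [PolyhedralDivisor.ordV_smul _ hc, ordV_of_ne_zero _ (E.expoF_ne_zero β)]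
      revert h
      generalize ordV (E.Q i) _ = x
      intro h
      induction x using WithTop.recTopCoe with
      | top => simp
      | coe x =>
        rw [WithTop.coe_lt_coe] at h
        rw [← WithTop.coe_add, WithTop.coe_lt_coe]
        omega
    | add p q hp hq =>
      intro u a
      rw [add_mul, map_add]
      exact (ordV (E.Q i)).map_lt_add (hp u a) (hq u a)

/-- A monomial is bihomogeneous, and its image has exactly its own order. -/
theorem not_containsMonomial_orderIdeal (i : Fin (E.m + 1)) :
    ¬ ContainsMonomial (E.orderIdeal i) := by
  classical
  rintro ⟨α, hα⟩
  have h := hα (E.expoU α) (ordAt (E.Q i) (E.expoF α))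
  rw [partialSum_monomial, if_pos ⟨rfl, rfl⟩, one_smul,
    ordV_of_ne_zero _ (E.expoF_ne_zero α)] at h
  exact lt_irrefl _ h

theorem not_containsMonomial_idealJ : ¬ ContainsMonomial E.idealJ := by
  rintro ⟨α, hα⟩
  rw [idealJ, RingHom.mem_ker, presentation_monomial, one_smul] at hα
  exact PolyhedralDivisor.homog_ne_zero (E.expoF_mem α) (E.expoF_ne_zero α) hα

variable {Γ : Type*} [LinearOrder Γ]

/-- For f ∈ J the terms of each degree u sum to 0 in K(ℙ¹), so the sum of those of lowest order
equals minus the sum of the others and has larger order. Only monotonicity within a fixed degree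
matters; weights of different degrees may compare in any way. -/
theorem initialIdeal_le_orderIdeal (i : Fin (E.m + 1)) {wt : (E.gens →₀ ℕ) → Γ}
    {θ : (Fin k → ℤ) → ℤ → Γ} (hθ : ∀ u, StrictMono (θ u))
    (hwt : ∀ α, wt α = θ (E.expoU α) (ordAt (E.Q i) (E.expoF α))) :
    initialIdeal wt E.idealJ ≤ E.orderIdeal i := by
  classical
  rw [initialIdeal, Ideal.span_le]
  rintro _ ⟨f, hf, rfl⟩ u a
  by_cases hex : ∃ α₀ ∈ f.support, (∀ γ ∈ f.support, wt α₀ ≤ wt γ) ∧ E.HasBidegree i u a α₀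
  · obtain ⟨α₀, hα₀, hmin, hdeg⟩ := hex
    have hwt₀ : wt α₀ = θ u a := by rw [hwt, hdeg.1, hdeg.2]
    -- All terms of bidegree (u, a) have the weight of α₀, so they all survive in the initial form.
    have h1 : E.partialSum (E.HasBidegree i u a) (initialForm wt f)
        = E.partialSum (E.HasBidegree i u a) f := by
      rw [partialSum_apply, partialSum_apply]
      refine Finset.sum_subset_zero_on_sdiff (fun α hα => ?_) (fun α hα => ?_) fun α hα => ?_
      · obtain ⟨h2, h3⟩ := Finset.mem_filter.mp hα
        exact Finset.mem_filter.mpr ⟨(mem_support_initialForm.mp h2).1, h3⟩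
      · obtain ⟨h2, h3⟩ := Finset.mem_sdiff.mp hα
        obtain ⟨h4, h5⟩ := Finset.mem_filter.mp h2
        exfalso
        refine h3 (Finset.mem_filter.mpr ⟨?_, h5⟩)
        refine mem_support_initialForm.mpr ⟨h4, fun γ hγ => ?_⟩
        rw [hwt α, h5.1, h5.2, ← hwt₀]
        exact hmin γ hγ
      · obtain ⟨h2, -⟩ := Finset.mem_filter.mp hα
        rw [coeff_initialForm_of_mem h2]
    have h2 : E.partialSum (fun α => E.expoU α = u) f = 0 := by
      rw [← coeff_presentation_eq_partialSum, show E.presentation f = 0 from hf]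
      rfl
    have h3 : E.partialSum (E.HasBidegree i u a) f
        = -∑ α ∈ (f.support.filter fun α => E.expoU α = u).filter
          (fun α => ¬ ordAt (E.Q i) (E.expoF α) = a), f.coeff α • E.expoF α := by
      rw [eq_neg_iff_add_eq_zero, ← h2, partialSum_apply, partialSum_apply,
        ← Finset.sum_filter_add_sum_filter_not (f.support.filter fun α => E.expoU α = u)
          (fun α => ordAt (E.Q i) (E.expoF α) = a)]
      congr 1
      rw [Finset.filter_filter]
      exact Finset.sum_congr (Finset.filter_congr fun _ _ => Iff.rfl) fun _ _ => rfl
    rw [h1, h3, (ordV (E.Q i)).map_neg]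
    refine (ordV (E.Q i)).map_lt_sum (WithTop.coe_ne_top) fun α hα => ?_
    obtain ⟨h4, h5⟩ := Finset.mem_filter.mp hα
    obtain ⟨h6, h7⟩ := Finset.mem_filter.mp h4
    rw [PolyhedralDivisor.ordV_smul _ (MvPolynomial.mem_support_iff.mp h6),
      ordV_of_ne_zero _ (E.expoF_ne_zero α), WithTop.coe_lt_coe]
    have h8 := hmin α h6
    rw [hwt₀, hwt α, h7, (hθ u).le_iff_le] at h8
    exact lt_of_le_of_ne h8 (Ne.symm h5)
  · have : E.partialSum (E.HasBidegree i u a) (initialForm wt f) = 0 := by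
      rw [partialSum_apply]
      refine Finset.sum_eq_zero fun α hα => ?_
      obtain ⟨h2, h3⟩ := Finset.mem_filter.mp hα
      obtain ⟨h4, h5⟩ := mem_support_initialForm.mp h2
      exact absurd ⟨α, h4, h5, h3⟩ hex
    rw [this, (ordV (E.Q i)).map_zero]
    exact WithTop.coe_lt_top a

theorem _root_.TVar.PolyhedralDivisor.homog_sum {ι : Type*} (s : Finset ι) (u : Fin k → ℤ)
    (f : ι → RatFunc K) (hf : ∀ i ∈ s, f i ∈ D.part u) :
    ∑ i ∈ s, D.homog u (f i) = D.homog u (∑ i ∈ s, f i) := by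
  apply Subtype.ext
  rw [PolyhedralDivisor.coe_homog (Submodule.sum_mem _ hf), AddSubmonoidClass.coe_finsetSum,
    Finset.sum_congr rfl fun i hi => PolyhedralDivisor.coe_homog (hf i hi)]
  exact (map_sum (AddMonoidAlgebra.singleAddHom u) f s).symm

/-- A bihomogeneous component p of g has an image of order above a. That image is also the image of
some q whose monomials have degree u and orders above a, so p is the initial form of p - q. -/
theorem orderIdeal_le_initialIdeal [IsAlgClosed K] (i : Fin (E.m + 1)) {wt : (E.gens →₀ ℕ) → Γ}
    {θ : (Fin k → ℤ) → ℤ → Γ} (hθ : ∀ u, StrictMono (θ u))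
    (hwt : ∀ α, wt α = θ (E.expoU α) (ordAt (E.Q i) (E.expoF α))) :
    E.orderIdeal i ≤ initialIdeal wt E.idealJ := by
  classical
  intro g hg
  rw [g.as_sum, ← Finset.sum_fiberwise_of_maps_to (t := g.support.image fun α =>
    (E.expoU α, ordAt (E.Q i) (E.expoF α))) fun α hα => Finset.mem_image_of_mem _ hα]
  refine Ideal.sum_mem _ fun δ _ => ?_
  obtain ⟨u, a⟩ := δ
  set T := g.support.filter fun α => (E.expoU α, ordAt (E.Q i) (E.expoF α)) = (u, a) with hT
  have hTdeg : ∀ α ∈ T, E.HasBidegree i u a α := fun α hα => by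
    have := (Finset.mem_filter.mp hα).2
    exact ⟨congrArg Prod.fst this, congrArg Prod.snd this⟩
  set p := ∑ α ∈ T, MvPolynomial.monomial α (g.coeff α) with hp
  have hpc : ∀ β, p.coeff β = if β ∈ T then g.coeff β else 0 := fun β => by
    rw [hp, MvPolynomial.coeff_sum]
    simp only [MvPolynomial.coeff_monomial]
    rw [Finset.sum_ite_eq']
  by_cases hp0 : p = 0
  · rw [hp0]; exact zero_mem _
  set h := E.partialSum (E.HasBidegree i u a) g with hh
  have hhT : h = ∑ α ∈ T, g.coeff α • E.expoF α := by
    rw [hh, partialSum_apply]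
    refine Finset.sum_congr (Finset.filter_congr fun α _ => ?_) fun _ _ => rfl
    rw [HasBidegree, Prod.mk.injEq]
  have hmem : ∀ α ∈ T, g.coeff α • E.expoF α ∈ D.part u := fun α hα =>
    Submodule.smul_mem _ _ ((hTdeg α hα).1 ▸ E.expoF_mem α)
  have hhmem : h ∈ D.part u := hhT ▸ Submodule.sum_mem _ hmem
  have hpi : E.presentation p = D.homog u h := by
    rw [hp, map_sum, hhT, ← PolyhedralDivisor.homog_sum T u _ hmem]
    refine Finset.sum_congr rfl fun α hα => ?_
    rw [presentation_monomial, (hTdeg α hα).1, PolyhedralDivisor.homog_smul]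
    exact (hTdeg α hα).1 ▸ E.expoF_mem α
  obtain ⟨q, hq, hq'⟩ := E.exists_presentation_eq hhmem i
  have hJ : p - q ∈ E.idealJ := by
    rw [idealJ, RingHom.mem_ker, map_sub, hpi, hq, sub_self]
  rw [← initialForm_sub (wt := wt) (d := θ u a) hp0 (fun α hα => ?_) fun α hα => ?_]
  · exact initialForm_mem hJ
  · rw [MvPolynomial.mem_support_iff, hpc] at hα
    have hα' := hTdeg α (by
      by_contra h
      exact hα (if_neg h))
    rw [hwt, hα'.1, hα'.2]
  · rw [hwt, (hq' α hα).1]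
    refine hθ u ?_
    have := (hg u a).trans_le (hq' α hα).2
    exact_mod_cast this

theorem initialIdeal_eq_orderIdeal [IsAlgClosed K] (i : Fin (E.m + 1)) {wt : (E.gens →₀ ℕ) → Γ}
    {θ : (Fin k → ℤ) → ℤ → Γ} (hθ : ∀ u, StrictMono (θ u))
    (hwt : ∀ α, wt α = θ (E.expoU α) (ordAt (E.Q i) (E.expoF α))) :
    initialIdeal wt E.idealJ = E.orderIdeal i :=
  le_antisymm (E.initialIdeal_le_orderIdeal i hθ hwt) (E.orderIdeal_le_initialIdeal i hθ hwt)

/-- The ideal `J(L)` is homogeneous for the grading by `M`. -/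
theorem initialIdeal_le_idealJ {wt : (E.gens →₀ ℕ) → Γ} {θ : (Fin k → ℤ) → Γ}
    (hwt : ∀ α, wt α = θ (E.expoU α)) : initialIdeal wt E.idealJ ≤ E.idealJ := by
  classical
  rw [initialIdeal, Ideal.span_le]
  rintro _ ⟨f, hf, rfl⟩
  rw [SetLike.mem_coe, idealJ, RingHom.mem_ker]
  apply Subtype.ext
  refine AddMonoidAlgebra.coeff_injective (Finsupp.ext fun u => ?_)
  have h2 : E.partialSum (fun α => E.expoU α = u) f = 0 := by
    rw [← coeff_presentation_eq_partialSum, show E.presentation f = 0 from hf]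
    rfl
  rw [coeff_presentation_eq_partialSum]
  change _ = (0 : RatFunc K)
  -- The terms of degree u all have the same weight: either all of them survive or none does.
  by_cases hex : ∃ α₀ ∈ f.support, (∀ γ ∈ f.support, wt α₀ ≤ wt γ) ∧ E.expoU α₀ = u
  · obtain ⟨α₀, hα₀, hmin, hdeg⟩ := hex
    rw [← h2, partialSum_apply, partialSum_apply, Finset.sum_filter, Finset.sum_filter]
    rw [Finset.sum_subset (fun α hα => ?_ : (initialForm wt f).support ⊆ f.support)
      fun α _ hα => by rw [MvPolynomial.notMem_support_iff.mp hα, zero_smul, ite_self]]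
    · refine Finset.sum_congr rfl fun α hα => ?_
      split_ifs with hu
      · have hα' : α ∈ (initialForm wt f).support := mem_support_initialForm.mpr
          ⟨hα, fun γ hγ => by rw [hwt α, hu, ← hdeg, ← hwt]; exact hmin γ hγ⟩
        rw [coeff_initialForm_of_mem hα']
      · rfl
    · exact (mem_support_initialForm.mp hα).1
  · rw [partialSum_apply]
    refine Finset.sum_eq_zero fun α hα => ?_
    obtain ⟨h2, h3⟩ := Finset.mem_filter.mp hα
    obtain ⟨h4, h5⟩ := mem_support_initialForm.mp h2
    exact absurd ⟨α, h4, h5, h3⟩ hex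

theorem realWeight_tropMap (y : (Fin k → ℝ) × (Fin E.m → ℝ)) (α : E.gens →₀ ℕ) :
    realWeight (E.tropMap y) α = pair y.1 (E.expo α).1 + pair y.2 (E.expo α).2 := by
  induction α using Finsupp.induction_linear with
  | zero => simp [realWeight, pair_zero]
  | add α β ha hb =>
    have : realWeight (E.tropMap y) (α + β)
        = realWeight (E.tropMap y) α + realWeight (E.tropMap y) β := by
      simp [realWeight, mul_add, Finset.sum_add_distrib]
    rw [this, ha, hb, map_add, Prod.fst_add, Prod.snd_add, pair_add, pair_add]
    ring
  | single b n =>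
    have h : E.expo (Finsupp.single b n) = (n : ℤ) • b.1 := by simp [expo]
    rw [h, Prod.smul_fst, Prod.smul_snd, pair_zsmul, pair_zsmul, realWeight,
      Finset.sum_eq_single b (fun c _ hc => by simp [hc.symm]) (by simp),
      tropMap, Finsupp.single_eq_same]
    push_cast
    ring

/-- On C_i the weight depends only on the degree and the order at Q_i, which is the form required of
θ. -/
theorem realWeight_facet (i : Fin (E.m + 1)) (y : Fin k → ℝ) (s : ℝ) (α : E.gens →₀ ℕ) :
    realWeight (E.tropMap (y, s • simplexRay ℝ i)) α
      = pair y (E.expoU α) + s * (ordAt (E.Q i) (E.expoF α) : ℝ) := by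
  rw [realWeight_tropMap, pair_smul, E.pair_simplexRay]
  rfl

theorem strictMono_facet (y : Fin k → ℝ) {s : ℝ} (hs : 0 < s) (u : Fin k → ℤ) :
    StrictMono fun a : ℤ => pair y u + s * (a : ℝ) := fun a b hab => by
  have : (a : ℝ) < b := by exact_mod_cast hab
  have := mul_lt_mul_of_pos_left this hs
  simp only
  linarith

/-- For s = 0 the weight sees only the degree, so the initial ideal lies in J, which contains no
monomial. For s > 0 it lies in the order ideal. -/
theorem facet_subset_trop (i : Fin (E.m + 1)) : E.facet i ⊆ trop E.idealJ := by
  rintro _ ⟨y, s, hs, rfl⟩ ⟨α, hα⟩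
  rcases hs.eq_or_lt with rfl | hs
  · exact E.not_containsMonomial_idealJ ⟨α, E.initialIdeal_le_idealJ (θ := fun u => pair y u)
      (fun α => by rw [realWeight_facet, zero_mul, add_zero]) hα⟩
  · exact E.not_containsMonomial_orderIdeal i ⟨α, E.initialIdeal_le_orderIdeal i
      (θ := fun u a => pair y u + s * (a : ℝ)) (strictMono_facet y hs)
      (fun α => E.realWeight_facet i y s α) hα⟩

/-- Neither y nor s enters the order ideal, so it serves every interior point. -/
theorem initialIdeal_facetInterior [IsAlgClosed K] (i : Fin (E.m + 1)) {w : E.gens → ℝ}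
    (hw : w ∈ E.facetInterior i) : initialIdeal (realWeight w) E.idealJ = E.orderIdeal i := by
  obtain ⟨y, s, hs, rfl⟩ := hw
  exact E.initialIdeal_eq_orderIdeal i (θ := fun u a => pair y u + s * (a : ℝ))
    (strictMono_facet y hs) fun α => E.realWeight_facet i y s α

end SemiCanonicalEmbedding

end TVar

namespace TVar

/-! ### Lexicographic weights -/

theorem LexInt.toRat_add {r : ℕ} (g h : LexInt r) : (g + h).toRat = g.toRat + h.toRat := by
  apply ofLex.injective
  funext i
  exact Int.cast_add (ofLex g i) (ofLex h i)

theorem LexInt.toRat_zero {r : ℕ} : (0 : LexInt r).toRat = 0 := by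
  apply ofLex.injective
  funext i
  exact Int.cast_zero

theorem LexInt.toRat_strictMono {r : ℕ} : StrictMono (LexInt.toRat (r := r)) := by
  rintro a b ⟨i, h1, h2⟩
  refine ⟨i, fun j hj => ?_, ?_⟩
  · exact congrArg (Int.cast : ℤ → ℚ) (h1 j hj)
  · exact Int.cast_lt.mpr h2

section MatWeight

variable {ι : Type*} [Fintype ι] {r : ℕ}

theorem matWeight_zero (W : Matrix (Fin r) ι ℚ) : matWeight W 0 = 0 := by
  have h : (W.mulVec fun b => (((0 : ι →₀ ℕ) b : ℕ) : ℚ)) = 0 := by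
    funext i
    simp [Matrix.mulVec, dotProduct]
  exact congrArg toLex h

theorem matWeight_add (W : Matrix (Fin r) ι ℚ) (α β : ι →₀ ℕ) :
    matWeight W (α + β) = matWeight W α + matWeight W β := by
  have h : (W.mulVec fun b => (((α + β) b : ℕ) : ℚ))
      = (W.mulVec fun b => (α b : ℚ)) + W.mulVec fun b => (β b : ℚ) := by
    funext i
    simp [Matrix.mulVec, dotProduct, mul_add, Finset.sum_add_distrib]
  exact congrArg toLex h

theorem matWeight_single (W : Matrix (Fin r) ι ℚ) (b : ι) :
    matWeight W (Finsupp.single b 1) = toLex fun a => W a b := by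
  classical
  apply ofLex.injective
  funext i
  simp [matWeight, Matrix.mulVec, dotProduct, Finsupp.single_apply]

theorem matWeight_eq_toRat {W : Matrix (Fin r) ι ℚ} {h : (ι →₀ ℕ) →+ LexInt r}
    (hW : ∀ b, (toLex fun a => W a b : Lex (Fin r → ℚ)) = (h (Finsupp.single b 1)).toRat)
    (α : ι →₀ ℕ) : matWeight W α = (h α).toRat := by
  induction α using Finsupp.induction_linear with
  | zero => rw [matWeight_zero, map_zero, LexInt.toRat_zero]
  | add α β ha hb => rw [matWeight_add, ha, hb, map_add, LexInt.toRat_add]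
  | single b n =>
    induction n with
    | zero => rw [Finsupp.single_zero, matWeight_zero, map_zero, LexInt.toRat_zero]
    | succ n ih =>
      rw [Finsupp.single_add, matWeight_add, ih, map_add, LexInt.toRat_add, matWeight_single, hW]

end MatWeight

theorem addMonoidHom_mem_closure {ι A : Type*} [AddCommMonoid A] (h : (ι →₀ ℕ) →+ A)
    (α : ι →₀ ℕ) :
    h α ∈ AddSubmonoid.closure (Set.range fun b => h (Finsupp.single b 1)) := by
  induction α using Finsupp.induction_linear with
  | zero => rw [map_zero]; exact zero_mem _
  | add α β ha hb => rw [map_add]; exact add_mem ha hb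
  | single b n =>
    have : Finsupp.single b n = n • Finsupp.single b 1 := by simp
    rw [this, map_nsmul]
    exact nsmul_mem (AddSubmonoid.subset_closure (Set.mem_range_self b)) n

theorem closure_toRat_image {ι : Type*} {r : ℕ} {h : ι → LexInt r} {W : Matrix (Fin r) ι ℚ}
    (hW : ∀ b, (toLex fun a => W a b : Lex (Fin r → ℚ)) = (h b).toRat) :
    (AddSubmonoid.closure (Set.range fun b => (toLex fun a => W a b : Lex (Fin r → ℚ))) :
      Set (Lex (Fin r → ℚ))) = LexInt.toRat '' AddSubmonoid.closure (Set.range h) := by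
  let f : LexInt r →+ Lex (Fin r → ℚ) :=
    { toFun := LexInt.toRat, map_zero' := LexInt.toRat_zero, map_add' := LexInt.toRat_add }
  have h1 : (Set.range fun b => (toLex fun a => W a b : Lex (Fin r → ℚ))) = f '' Set.range h := by
    rw [← Set.range_comp]
    exact congrArg Set.range (funext hW)
  rw [h1, ← AddMonoidHom.map_mclosure]
  rfl

/-! ### Ranks -/

instance LexInt.moduleFinite (r : ℕ) : Module.Finite ℤ (LexInt r) :=
  inferInstanceAs (Module.Finite ℤ (Fin r → ℤ))

/-- By rank-nullity the kernel has rank 0, and a submodule of rank 0 of a torsion-free module is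
zero. -/
theorem injective_of_le_finrank {M N : Type*} [AddCommGroup M] [AddCommGroup N]
    [Module.Finite ℤ M] [Module.IsTorsionFree ℤ M] [Module.Finite ℤ N]
    (f : M →ₗ[ℤ] N) (S : Set N) (hS : S ⊆ LinearMap.range f)
    (h : Module.finrank ℤ M ≤ Module.finrank ℤ (Submodule.span ℤ S)) : Function.Injective f := by
  have h1 : Module.finrank ℤ (LinearMap.range f) + Module.finrank ℤ (LinearMap.ker f)
      = Module.finrank ℤ M := by
    rw [← Submodule.finrank_quotient_add_finrank (LinearMap.ker f),
      f.quotKerEquivRange.finrank_eq]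
  have h2 := Submodule.finrank_mono (Submodule.span_le.mpr hS)
  rw [← LinearMap.ker_eq_bot, ← Submodule.finrank_eq_zero (R := ℤ)]
  omega

/-- Elements of the span of S that are independent over ℤ stay independent over ℚ and lie in the
column space of W. -/
theorem le_rank_of_subset_closure {ι : Type*} [Fintype ι] {r : ℕ} (W : Matrix (Fin r) ι ℚ)
    (h : ι → LexInt r) (hW : ∀ b, (toLex fun a => W a b : Lex (Fin r → ℚ)) = (h b).toRat)
    (S : Set (LexInt r)) (hS : S ⊆ AddSubmonoid.closure (Set.range h)) :
    Module.finrank ℤ (Submodule.span ℤ S) ≤ W.rank := by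
  classical
  obtain ⟨f, hf⟩ := exists_linearIndependent_of_le_finrank
    (le_refl (Module.finrank ℤ (Submodule.span ℤ S)))
  let c : LexInt r →ₗ[ℤ] (Fin r → ℚ) :=
    { toFun := fun g i => (ofLex g i : ℚ)
      map_add' := fun g g' => by funext i; exact Int.cast_add (ofLex g i) (ofLex g' i)
      map_smul' := fun n g => by
        funext i
        exact (Int.cast_mul n (ofLex g i)).trans (zsmul_eq_mul _ _).symm }
  have hc : Function.Injective c := fun g g' hg => by
    apply ofLex.injective
    funext i
    exact Int.cast_injective (congrFun hg i)
  have hcol : ∀ b, c (h b) = W.mulVecLin (Pi.single b 1) := fun b => by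
    rw [Matrix.mulVecLin_apply, Matrix.mulVec_single_one]
    exact congrArg ofLex (hW b).symm
  have hcl : ∀ g ∈ AddSubmonoid.closure (Set.range h), c g ∈ LinearMap.range W.mulVecLin := by
    intro g hg
    induction hg using AddSubmonoid.closure_induction with
    | mem x hx =>
      obtain ⟨b, rfl⟩ := hx
      exact ⟨_, (hcol b).symm⟩
    | zero => rw [map_zero]; exact zero_mem _
    | add x y _ _ hx hy => rw [map_add]; exact add_mem hx hy
  have hmem : ∀ g ∈ Submodule.span ℤ S, c g ∈ LinearMap.range W.mulVecLin := by
    intro g hg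
    induction hg using Submodule.span_induction with
    | mem g hg => exact hcl g (hS hg)
    | zero => rw [map_zero]; exact zero_mem _
    | add x y _ _ hx hy => rw [map_add]; exact add_mem hx hy
    | smul n x _ hx => rw [map_smul]; exact zsmul_mem hx n
  have hli : LinearIndependent ℚ fun j => c (f j) := by
    rw [← LinearIndependent.iff_fractionRing ℤ ℚ]
    have h1 := (hf.map' (Submodule.subtype _) (Submodule.ker_subtype _)).map' c
      (LinearMap.ker_eq_bot.mpr hc)
    exact h1
  have hli' : LinearIndependent ℚ fun j =>
      (⟨c (f j), hmem _ (f j).2⟩ : LinearMap.range W.mulVecLin) :=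
    LinearIndependent.of_comp (Submodule.subtype _) hli
  simpa [Matrix.rank] using hli'.fintype_card_le_finrank

/-! ### Values of semi-canonical generators -/

namespace SemiCanonicalEmbedding

variable {K : Type*} [Field K] {k r : ℕ} {D : PolyhedralDivisor K k}
  (E : SemiCanonicalEmbedding D)

/-- The value of `π(x^α)` for a valuation with `v(f χ^u) = ord_P(f) γ + l(u)`. -/
noncomputable def valHom (P : OnePoint K) (γ : LexInt r) (l : (Fin k → ℤ) →+ LexInt r) :
    (E.gens →₀ ℕ) →+ LexInt r where
  toFun α := ordAt P (E.expoF α) • γ + l (E.expoU α)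
  map_zero' := by simp [expoF_zero, ordAt_one]
  map_add' α β := by
    rw [expoF_add, ordAt_mul _ (E.expoF_ne_zero _) (E.expoF_ne_zero _), map_add, map_add, add_smul]
    abel

variable {v : AddValuation D.coordinateRing (WithTop (LexInt r))} {P : OnePoint K} {γ : LexInt r}
  {l : (Fin k → ℤ) →+ LexInt r}

theorem val_smul (hv : IsKValuation K v) {c : K} (hc : c ≠ 0) (f : D.coordinateRing) :
    v (c • f) = v f := by
  rw [Algebra.smul_def, v.map_mul, hv.map_const c hc, zero_add]

theorem generator_eq_presentation (b : E.gens) :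
    E.generator b = E.presentation (MvPolynomial.monomial (Finsupp.single b 1) 1) := by
  rw [presentation_monomial, one_smul, generator_eq]

theorem generator_ne_zero (b : E.gens) : E.generator b ≠ 0 := by
  rw [generator_eq]
  exact PolyhedralDivisor.homog_ne_zero (E.expoF_mem _) (E.expoF_ne_zero _)

/-- The values of the generators generate the submonoid of the values of the monomials. -/
theorem isKhovanskiiBasis_iff {val : E.gens → LexInt r}
    (hval : ∀ b, v (E.generator b) = (val b : WithTop (LexInt r))) :
    IsKhovanskiiBasis v (Set.range E.generator) ↔
      (AddSubmonoid.closure (Set.range val) : Set (LexInt r)) = valueSemigroup v := by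
  have : {g : LexInt r | ∃ b ∈ Set.range E.generator, b ≠ 0 ∧ v b = (g : WithTop (LexInt r))}
      = Set.range val := by
    ext g
    constructor
    · rintro ⟨_, ⟨b, rfl⟩, -, hb⟩
      rw [hval, WithTop.coe_inj] at hb
      exact ⟨b, hb⟩
    · rintro ⟨b, rfl⟩
      exact ⟨_, ⟨b, rfl⟩, E.generator_ne_zero b, hval b⟩
  rw [IsKhovanskiiBasis, this]

theorem closure_subset_valueSemigroup {val : E.gens → LexInt r}
    (hval : ∀ b, v (E.generator b) = (val b : WithTop (LexInt r))) :
    (AddSubmonoid.closure (Set.range val) : Set (LexInt r)) ⊆ valueSemigroup v := by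
  intro g hg
  induction hg using AddSubmonoid.closure_induction with
  | mem x hx =>
    obtain ⟨b, rfl⟩ := hx
    exact ⟨_, E.generator_ne_zero b, hval b⟩
  | zero => exact ⟨1, one_ne_zero, by rw [v.map_one]; rfl⟩
  | add x y _ _ hx hy =>
    obtain ⟨f, hf, hfx⟩ := hx
    obtain ⟨g, hg, hgy⟩ := hy
    exact ⟨f * g, mul_ne_zero hf hg, by rw [v.map_mul, hfx, hgy]; rfl⟩

section

variable (hl : ∀ (u : Fin k → ℤ) (f : RatFunc K), f ∈ D.part u → f ≠ 0 →
  v (D.homog u f) = ((ordAt P f • γ + l u : LexInt r) : WithTop (LexInt r)))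
include hl

theorem val_monomial (hv : IsKValuation K v) (α : E.gens →₀ ℕ) {c : K} (hc : c ≠ 0) :
    v (E.presentation (MvPolynomial.monomial α c)) = (E.valHom P γ l α : WithTop (LexInt r)) := by
  rw [presentation_monomial, val_smul hv hc, hl _ _ (E.expoF_mem α) (E.expoF_ne_zero α)]
  rfl

theorem val_generator (b : E.gens) :
    v (E.generator b) = (E.valHom P γ l (Finsupp.single b 1) : WithTop (LexInt r)) := by
  rw [generator_eq, hl _ _ (E.expoF_mem _) (E.expoF_ne_zero _)]
  rfl

/-- This is the inequality v_W ≤ v: no preimage of F can have minimal weight above v(F). -/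
theorem le_val_presentation (hv : IsKValuation K v) (p : MvPolynomial E.gens K) {g : LexInt r}
    (h : ∀ α ∈ p.support, g ≤ E.valHom P γ l α) :
    (g : WithTop (LexInt r)) ≤ v (E.presentation p) := by
  rw [p.as_sum, map_sum]
  refine v.map_le_sum fun α hα => ?_
  rw [E.val_monomial hl hv α (MvPolynomial.mem_support_iff.mp hα)]
  exact_mod_cast h α hα

/-- Homogeneity reduces a value to that of one component f χ^u, which is also the value of a
monomial of degree u with the same order at P = Q_i. -/
theorem isKhovanskiiBasis_of_homogeneous [IsAlgClosed K]
    (hhom : D.IsHomogeneousValuation v) {i : Fin (E.m + 1)} (hi : E.Q i = P) :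
    IsKhovanskiiBasis v (Set.range E.generator) := by
  rw [E.isKhovanskiiBasis_iff (E.val_generator hl)]
  refine (E.closure_subset_valueSemigroup (E.val_generator hl)).antisymm ?_
  rintro g ⟨F, hF, hg⟩
  have hne : F.1.coeff.support.Nonempty := by
    rw [Finsupp.support_nonempty_iff]
    exact fun h => hF (Subtype.ext (AddMonoidAlgebra.coeff_eq_zero.mp h))
  obtain ⟨u, hu, hinf⟩ := Finset.exists_mem_eq_inf _ hne fun u => v (D.component F u)
  have hf0 := Finsupp.mem_support_iff.mp hu
  rw [hhom F, hinf, PolyhedralDivisor.component_eq_homog, hl _ _ (F.2 u) hf0,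
    WithTop.coe_inj] at hg
  obtain ⟨w, hw, hord⟩ := E.exists_mem_dualMonoid (F.2 u) hf0 i
  obtain ⟨α, hα⟩ := E.exists_expo_eq.mp hw
  have : g = E.valHom P γ l α := by
    rw [← hg, ← hi, ← hord]
    change _ = ordAt _ (E.zMonomial (E.expo α).2) • γ + l (E.expo α).1
    rw [hα, hi]
  rw [this]
  exact addMonoidHom_mem_closure _ α

/-- A homogeneous valuation is the weight valuation of the matrix of the values of the
generators. -/
theorem isWeightValuation_of_homogeneous [IsAlgClosed K] (hv : IsKValuation K v)
    (hhom : D.IsHomogeneousValuation v) (hγ : 0 ≤ γ) {i : Fin (E.m + 1)} (hi : E.Q i = P)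
    {W : Matrix (Fin r) E.gens ℚ}
    (hW : ∀ b, (toLex fun a => W a b : Lex (Fin r → ℚ))
      = (E.valHom P γ l (Finsupp.single b 1)).toRat) :
    IsWeightValuation E.presentation W v := by
  intro F hF
  obtain ⟨g, hg⟩ := PolyhedralDivisor.exists_val hv hF
  have hupper : ∀ p, E.presentation p = F → ∀ d : LexInt r,
      (∀ α ∈ p.support, d ≤ E.valHom P γ l α) → d ≤ g := fun p hp d hd => by
    have := E.le_val_presentation hl hv p hd
    rw [hp, hg] at this
    exact_mod_cast this
  refine ⟨g, hg, ?_, ?_⟩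
  -- Each component is lifted with monomials of its own degree and no smaller order at P. As γ ≥ 0,
  -- all their values are at least v(F).
  · choose q hq hq' using fun u => E.exists_presentation_eq (F.2 u) i
    have hF' : E.presentation (∑ u ∈ F.1.coeff.support, q u) = F := by
      rw [map_sum]
      simp only [hq]
      conv_rhs => rw [← PolyhedralDivisor.sum_component F]
      exact Finset.sum_congr rfl fun u _ => (PolyhedralDivisor.component_eq_homog F u).symm
    set p := ∑ u ∈ F.1.coeff.support, q u with hp
    have hge : ∀ α ∈ p.support, g ≤ E.valHom P γ l α := by
      classical
      intro α hα
      obtain ⟨u, hu, hαu⟩ := Finset.mem_biUnion.mp (MvPolynomial.support_sum hα)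
      have hf0 := Finsupp.mem_support_iff.mp hu
      obtain ⟨h1, h2⟩ := hq' u α hαu
      rw [ordV_of_ne_zero _ hf0, WithTop.coe_le_coe, hi] at h2
      have h3 : v F ≤ v (D.component F u) := by
        rw [hhom F]; exact Finset.inf_le hu
      rw [PolyhedralDivisor.component_eq_homog, hl _ _ (F.2 u) hf0, hg, WithTop.coe_le_coe] at h3
      refine h3.trans ?_
      change _ ≤ ordAt P (E.expoF α) • γ + l (E.expoU α)
      rw [h1]
      exact add_le_add_left (zsmul_le_zsmul_left hγ h2) _
    -- The minimal value on the support of p is at least g by construction and at most g by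
    -- `hupper`.
    have hex : ∃ α ∈ p.support, E.valHom P γ l α = g := by
      have hne : p.support.Nonempty := by
        rw [Finset.nonempty_iff_ne_empty, Ne, MvPolynomial.support_eq_empty]
        intro h0
        rw [h0, map_zero] at hF'
        exact hF hF'.symm
      obtain ⟨α, hα, hmin⟩ := p.support.exists_min_image (E.valHom P γ l) hne
      exact ⟨α, hα, le_antisymm (hupper p hF' _ hmin) (hge α hα)⟩
    refine ⟨p, hF', ?_, ?_⟩
    · obtain ⟨α, hα, h⟩ := hex
      exact ⟨α, hα, by rw [matWeight_eq_toRat hW, h]⟩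
    · rintro _ ⟨α, hα, rfl⟩
      rw [matWeight_eq_toRat hW]
      exact LexInt.toRat_strictMono.monotone (hge α hα)
  · rintro d ⟨p, hp, ⟨α, hα, rfl⟩, hmin⟩
    rw [matWeight_eq_toRat hW]
    refine LexInt.toRat_strictMono.monotone (hupper p hp _ fun β hβ => ?_)
    have := hmin ⟨β, hβ, rfl⟩
    rw [matWeight_eq_toRat hW, matWeight_eq_toRat hW] at this
    exact LexInt.toRat_strictMono.le_iff_le.mp this

end

/-- The columns of a weight matrix of `v` are the values of the generators. -/
theorem IsWeightMatrix.exists_val {E : SemiCanonicalEmbedding D} {W : Matrix (Fin r) E.gens ℚ}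
    (hW : E.IsWeightMatrix W v) (b : E.gens) :
    ∃ g : LexInt r, v (E.generator b) = (g : WithTop (LexInt r)) ∧
      (toLex fun a => W a b : Lex (Fin r → ℚ)) = g.toRat := by
  classical
  obtain ⟨g, hg, ⟨p, hp, hpl⟩, hmax⟩ := hW.eq_weight _ (E.generator_ne_zero b)
  refine ⟨g, hg, ?_⟩
  rw [← matWeight_single]
  set x : MvPolynomial E.gens K := MvPolynomial.monomial (Finsupp.single b 1) 1 with hx
  have hxs : x.support = {Finsupp.single b 1} := by
    rw [hx, MvPolynomial.support_monomial, if_neg one_ne_zero]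
  have hle := hmax ⟨x, (E.generator_eq_presentation b).symm, by
    rw [hxs, Finset.coe_singleton, Set.image_singleton]; exact isLeast_singleton⟩
  -- If an optimal preimage p had larger weight than x_b, the monomial x_b would be the initial form
  -- of x_b - p ∈ J.
  refine hle.eq_of_not_lt fun hlt => hW.mem_trop ⟨Finsupp.single b 1, ?_⟩
  have hJ : x - p ∈ E.idealJ := by
    rw [idealJ, RingHom.mem_ker, map_sub, hp, ← E.generator_eq_presentation, sub_self]
  have := initialForm_mem (wt := matWeight W) hJ
  rwa [initialForm_sub (d := matWeight W (Finsupp.single b 1)) (by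
      rw [hx, Ne, MvPolynomial.monomial_eq_zero]; exact one_ne_zero) (fun α hα => by
      rw [hxs, Finset.mem_singleton] at hα
      rw [hα]) fun α hα => hlt.trans_le (hpl.2 ⟨α, hα, rfl⟩)] at this

/-- The value of F is the weight of some monomial, hence a nonnegative integral combination of
columns of W, and these are values of generators. -/
theorem IsWeightMatrix.isKhovanskiiBasis {E : SemiCanonicalEmbedding D}
    {W : Matrix (Fin r) E.gens ℚ} (hW : E.IsWeightMatrix W v) :
    IsKhovanskiiBasis v (Set.range E.generator) := by
  choose val hval hval' using hW.exists_val
  rw [E.isKhovanskiiBasis_iff hval]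
  refine (E.closure_subset_valueSemigroup hval).antisymm ?_
  rintro g ⟨F, hF, hg⟩
  obtain ⟨g', hg', ⟨p, -, ⟨α, -, hα⟩, -⟩, -⟩ := hW.eq_weight F hF
  rw [hg, WithTop.coe_inj] at hg'
  subst hg'
  let h : (E.gens →₀ ℕ) →+ LexInt r := (Finsupp.linearCombination ℕ val).toAddMonoidHom
  have hs : ∀ b, h (Finsupp.single b 1) = val b := fun b => by simp [h]
  rw [matWeight_eq_toRat (h := h) (fun b => by rw [hs, hval'])] at hα
  rw [← LexInt.toRat_strictMono.injective hα]
  have := addMonoidHom_mem_closure h α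
  rwa [show (fun b => h (Finsupp.single b 1)) = val from funext hs] at this

/-- If the values of a full-rank valuation are generated by those of homogeneous elements, then
`v(f χ^u)` determines `u` and `ord_P(f)`. -/
theorem injective_of_isKhovanskiiBasis
    (hl : ∀ (u : Fin k → ℤ) (f : RatFunc K), f ∈ D.part u → f ≠ 0 →
      v (D.homog u f) = ((ordAt P f • γ + l u : LexInt r) : WithTop (LexInt r)))
    (hrank : k + 1 ≤ valuationRank v) (hE : IsKhovanskiiBasis v (Set.range E.generator)) :
    (Function.Injective fun x : ℤ × (Fin k → ℤ) => x.1 • γ + l x.2) ∧ ∃ i, E.Q i = P := by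
  rw [E.isKhovanskiiBasis_iff (E.val_generator hl)] at hE
  constructor
  -- All values lie in the image of Φ, whose source has rank k + 1.
  · let Φ : ℤ × (Fin k → ℤ) →ₗ[ℤ] LexInt r :=
      (LinearMap.toSpanSingleton ℤ (LexInt r) γ).coprod l.toIntLinearMap
    refine injective_of_le_finrank Φ (valueSemigroup v) ?_ ?_
    · rw [← hE]
      intro x hx
      have hle : AddSubmonoid.closure (Set.range fun b => E.valHom P γ l (Finsupp.single b 1))
          ≤ (LinearMap.range Φ).toAddSubmonoid := by
        rw [AddSubmonoid.closure_le]
        rintro _ ⟨b, rfl⟩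
        exact ⟨(ordAt P (E.expoF (Finsupp.single b 1)), E.expoU (Finsupp.single b 1)), rfl⟩
      exact hle hx
    · refine le_trans ?_ hrank
      simp [add_comm]
  -- Away from the Q_i every z^v has order 0, so all values would come from l alone and have rank at
  -- most k.
  · by_contra hP
    push Not at hP
    have hle : AddSubmonoid.closure (Set.range fun b => E.valHom P γ l (Finsupp.single b 1))
        ≤ (LinearMap.range l.toIntLinearMap).toAddSubmonoid := by
      rw [AddSubmonoid.closure_le]
      rintro _ ⟨b, rfl⟩
      refine ⟨E.expoU (Finsupp.single b 1), ?_⟩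
      change _ = ordAt P (E.zMonomial _) • γ + _
      rw [E.ordAt_zMonomial_of_ne fun i => (hP i).symm, zero_smul, zero_add]
      rfl
    have h1 := Submodule.finrank_mono (Submodule.span_le.mpr
      (show valueSemigroup v ⊆ LinearMap.range l.toIntLinearMap from hE ▸ hle))
    have h2 := LinearMap.finrank_range_le l.toIntLinearMap
    rw [Module.finrank_fin_fun] at h2
    have h3 : k + 1 ≤ Module.finrank ℤ (Submodule.span ℤ (valueSemigroup v)) := hrank
    omega

end SemiCanonicalEmbedding

/-! ### Consequences of injectivity -/

namespace PolyhedralDivisor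

variable {K : Type*} [Field K] {k r : ℕ} {D : PolyhedralDivisor K k}
  {v : AddValuation D.coordinateRing (WithTop (LexInt r))} {P : OnePoint K} {γ : LexInt r}
  {l : (Fin k → ℤ) →+ LexInt r}

/-- Components of different degrees have different values, so v of their sum is the minimum. -/
theorem isHomogeneousValuation_of_injective
    (hl : ∀ (u : Fin k → ℤ) (f : RatFunc K), f ∈ D.part u → f ≠ 0 →
      v (D.homog u f) = ((ordAt P f • γ + l u : LexInt r) : WithTop (LexInt r)))
    (hinj : Function.Injective fun x : ℤ × (Fin k → ℤ) => x.1 • γ + l x.2) :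
    D.IsHomogeneousValuation v := by
  intro F
  have h : ∀ u ∈ F.1.coeff.support, v (D.component F u)
      = ((ordAt P (F.1.coeff u) • γ + l u : LexInt r) : WithTop (LexInt r)) := fun u hu => by
    rw [component_eq_homog, hl _ _ (F.2 u) (Finsupp.mem_support_iff.mp hu)]
  conv_lhs => rw [← sum_component F]
  refine map_sum_of_injOn v _ _ fun u hu u' hu' he => ?_
  simp only [h u hu, h u' hu', WithTop.coe_inj] at he
  exact congrArg Prod.snd (hinj (a₁ := (_, u)) (a₂ := (_, u')) he)

end PolyhedralDivisor

/-- If γ were 0, the pairs (1, 0) and (0, 0) would have the same image. -/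
theorem pos_of_injective {k r : ℕ} {γ : LexInt r} {l : (Fin k → ℤ) →+ LexInt r} (hγ : 0 ≤ γ)
    (hinj : Function.Injective fun x : ℤ × (Fin k → ℤ) => x.1 • γ + l x.2) : 0 < γ := by
  refine lt_of_le_of_ne hγ fun h => ?_
  have := @hinj (1, 0) (0, 0) (by simp [← h])
  simp at this

namespace SemiCanonicalEmbedding

variable {K : Type*} [Field K] {k r : ℕ} {D : PolyhedralDivisor K k}
  (E : SemiCanonicalEmbedding D)

theorem strictMono_valHom {γ : LexInt r} (hγ : 0 < γ) (l : (Fin k → ℤ) →+ LexInt r)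
    (u : Fin k → ℤ) : StrictMono fun a : ℤ => (a • γ + l u).toRat := fun _ _ hab =>
  LexInt.toRat_strictMono (add_lt_add_left (zsmul_left_strictMono hγ hab) _)

/-- The weight of x^α is aγ + l(u), strictly increasing in a because γ > 0. -/
theorem initialIdeal_matWeight_eq [IsAlgClosed K] {γ : LexInt r} (hγ : 0 < γ)
    {l : (Fin k → ℤ) →+ LexInt r} {i : Fin (E.m + 1)} {W : Matrix (Fin r) E.gens ℚ}
    (hW : ∀ b, (toLex fun a => W a b : Lex (Fin r → ℚ))
      = (E.valHom (E.Q i) γ l (Finsupp.single b 1)).toRat) :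
    initialIdeal (matWeight W) E.idealJ = E.orderIdeal i :=
  E.initialIdeal_eq_orderIdeal i (θ := fun u a => (a • γ + l u).toRat)
    (strictMono_valHom hγ l) fun α => matWeight_eq_toRat hW α

/-- The matrix of the values of the generators is a weight matrix of a homogeneous valuation. -/
theorem isWeightMatrix_of_homogeneous [IsAlgClosed K]
    {v : AddValuation D.coordinateRing (WithTop (LexInt r))} {i : Fin (E.m + 1)} {γ : LexInt r}
    {l : (Fin k → ℤ) →+ LexInt r} (hv : IsKValuation K v) (hr : valuationRank v = r)
    (hl : ∀ (u : Fin k → ℤ) (f : RatFunc K), f ∈ D.part u → f ≠ 0 →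
      v (D.homog u f) = ((ordAt (E.Q i) f • γ + l u : LexInt r) : WithTop (LexInt r)))
    (hγ : 0 < γ) (hhom : D.IsHomogeneousValuation v) {W : Matrix (Fin r) E.gens ℚ}
    (hW : ∀ b, (toLex fun a => W a b : Lex (Fin r → ℚ))
      = (E.valHom (E.Q i) γ l (Finsupp.single b 1)).toRat) : E.IsWeightMatrix W v := by
  refine ⟨?_, ?_, ?_⟩
  · change ¬ ContainsMonomial _
    rw [E.initialIdeal_matWeight_eq hγ hW]
    exact E.not_containsMonomial_orderIdeal i
  -- The columns generate the value semigroup, so the rank of W is at least r; W has only r rows.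
  · have hE := E.isKhovanskiiBasis_of_homogeneous hl hhom rfl
    rw [E.isKhovanskiiBasis_iff (E.val_generator hl)] at hE
    have hsub : valueSemigroup v ⊆ (AddSubmonoid.closure (Set.range fun b =>
        E.valHom (E.Q i) γ l (Finsupp.single b 1)) : Set (LexInt r)) := by
      rw [hE]
    have h := le_rank_of_subset_closure W
      (fun b => E.valHom (E.Q i) γ l (Finsupp.single b 1)) hW (valueSemigroup v) hsub
    rw [valuationRank] at hr
    have h2 := W.rank_le_card_height
    rw [Fintype.card_fin] at h2
    omega
  · exact E.isWeightValuation_of_homogeneous hl hv hhom hγ.le rfl hW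

end SemiCanonicalEmbedding

end TVar

/-! ### Proof of the theorem -/

theorem mainTheorem3 {K : Type*} [Field K] [IsAlgClosed K] {k r : ℕ}
    (D : TVar.PolyhedralDivisor K k) (hD : D.IsProper)
    (v : AddValuation D.coordinateRing (WithTop (TVar.LexInt r)))
    (hv : TVar.IsKValuation K v) (hfull : TVar.IsFullRank v) (hr : TVar.valuationRank v = r) :
    List.TFAE
      [D.IsHomogeneousValuation v,
        ∃ E : TVar.SemiCanonicalEmbedding D, TVar.IsKhovanskiiBasis v (Set.range E.generator),
        ∃ (E : TVar.SemiCanonicalEmbedding D) (W : Matrix (Fin r) E.gens ℚ),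
          E.IsWeightMatrix W v] ∧
    ∀ (E : TVar.SemiCanonicalEmbedding D) (W : Matrix (Fin r) E.gens ℚ), E.IsWeightMatrix W v →
      (∃ (i : Fin (E.m + 1)) (γ : TVar.LexInt r),
        D.RestrictsToOrd v (E.Q i) γ ∧
        E.facet i ⊆ TVar.trop E.idealJ ∧
        ∀ w ∈ E.facetInterior i,
          TVar.initialIdeal (TVar.matWeight W) E.idealJ
            = TVar.initialIdeal (TVar.realWeight w) E.idealJ) ∧
      (AddSubmonoid.closure (Set.range fun b : E.gens => toLex fun a : Fin r => W a b) :
          Set (Lex (Fin r → ℚ)))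
        = TVar.LexInt.toRat '' TVar.valueSemigroup v := by
  obtain ⟨P, γ, l, hγ, hres, hl⟩ := TVar.PolyhedralDivisor.exists_val_homog_eq hD hv
  -- Any semi-canonical embedding shows that R_X is of finite type, as the dimension bound requires.
  -- Of full rank, only this inequality enters the equivalences.
  have hrank : k + 1 ≤ TVar.valuationRank v := by
    obtain ⟨E, -⟩ := TVar.SemiCanonicalEmbedding.exists_Q_eq D P
    have := E.finiteType
    have h := D.le_ringKrullDim hD
    rw [hfull] at h
    exact_mod_cast h
  constructor
  · tfae_have 1 → 2 := fun hhom => by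
      obtain ⟨E, i, hi⟩ := TVar.SemiCanonicalEmbedding.exists_Q_eq D P
      exact ⟨E, E.isKhovanskiiBasis_of_homogeneous hl hhom hi⟩
    tfae_have 2 → 1 := fun ⟨E, hE⟩ =>
      TVar.PolyhedralDivisor.isHomogeneousValuation_of_injective hl
        (E.injective_of_isKhovanskiiBasis hl hrank hE).1
    tfae_have 1 → 3 := fun hhom => by
      -- The embedding must have the centre P of v among its boundary points; the entries of W are
      -- the values of its generators.
      obtain ⟨E, i, rfl⟩ := TVar.SemiCanonicalEmbedding.exists_Q_eq D P
      have hE := E.isKhovanskiiBasis_of_homogeneous hl hhom rfl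
      exact ⟨E, fun a b => (ofLex (E.valHom (E.Q i) γ l (Finsupp.single b 1)) a : ℚ),
        E.isWeightMatrix_of_homogeneous hv hr hl
          (TVar.pos_of_injective hγ (E.injective_of_isKhovanskiiBasis hl hrank hE).1) hhom
          fun b => rfl⟩
    tfae_have 3 → 2 := fun ⟨E, W, hW⟩ => ⟨E, hW.isKhovanskiiBasis⟩
    tfae_finish
  · intro E W hW
    have hE := hW.isKhovanskiiBasis
    -- Here the embedding is given, and the rank forces P to be one of its boundary points.
    obtain ⟨hinj, i, rfl⟩ := E.injective_of_isKhovanskiiBasis hl hrank hE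
    have hcol : ∀ b, (toLex fun a => W a b : Lex (Fin r → ℚ))
        = (E.valHom (E.Q i) γ l (Finsupp.single b 1)).toRat := fun b => by
      obtain ⟨g, hg, hg'⟩ := hW.exists_val b
      rw [E.val_generator hl, WithTop.coe_inj] at hg
      rw [hg', hg]
    refine ⟨⟨i, γ, hres, E.facet_subset_trop i, fun w hw => ?_⟩, ?_⟩
    · rw [E.initialIdeal_matWeight_eq (TVar.pos_of_injective hγ hinj) hcol,
        E.initialIdeal_facetInterior i hw]
    · rw [TVar.closure_toRat_image hcol]
      rw [E.isKhovanskiiBasis_iff (E.val_generator hl)] at hE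
      rw [hE]
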